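/- Conventions. A vocabulary $\tau$ is a finite list of relation symbols $R_1,\dots,R_m$ with arities $\mathrm{ar}(R_i)\in\mathbb N$. A $\tau$-structure $\mathbf A$ has a nonempty finite universe $A$ (normalized to $\{0,\dots,n-1\}$) and relations $R^{\mathbf A}\subseteq A^{\mathrm{ar}(R)}$; its size is $|\mathbf A|=|\tau|+|A|+\sum_{R\in\tau}|R^{\mathbf A}|\cdot\mathrm{ar}(R)$. An embedding of $\mathbf A$ into a structure $\mathbf B$ of the same vocabulary is an injective homomorphism. A class $\mathcal A$ of structures (of possibly different vocabularies) has bounded arity if some $r\in\mathbb N$ bounds the arities of all symbols of the vocabularies of all $\mathbf A\in\mathcal A$; it has bounded pathwidth if some $w\in\mathbb N$ bounds the pathwidth of the Gaifman graphs of all $\mathbf A\in\mathcal A$ (two distinct elements are adjacent if they occur together in a tuple of a relation). Structures, and pairs of structures of the same vocabulary, are encoded by binary strings: the vocabulary with arities in unary, followed, for each structure, by the size of the universe in unary and, for each relation, a repetition-free list of its tuples with entries in binary, everything self-delimiting. $\mathcal A$ is decidable if the set of strings that encode a structure in $\mathcal A$ is decidable. The parameterized problem $p\text{-}\mathrm{EMB}(\mathcal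 A)=(Q,\kappa)$ consists of the set $Q\subseteq\{0,1\}^*$ of encodings of pairs $(\mathbf A,\mathbf B)$ such that $\mathbf A\in\mathcal A$ and $\mathbf A$ embeds into $\mathbf B$, and of the parameterization $\kappa:\{0,1\}^*\to\mathbb N$ with $\kappa(x)=|\mathbf A|$ if $x$ encodes a pair $(\mathbf A,\mathbf B)$, and $\kappa(x)=0$ for all other $x$. The class $\mathrm{PATH}$ consists of the pairs $(Q,\kappa)$ of a set $Q\subseteq\{0,1\}^*$ and a function $\kappa:\{0,1\}^*\to\mathbb N$ computable in logarithmic space for which there are computable functions $f,g:\mathbb N\to\mathbb N$ and a nondeterministic Turing machine (with a read-only input tape, several work tapes and binary guesses) that accepts exactly the strings in $Q$ and such that every run on every input $x$ uses space $O(g(\kappa(x))+\log|x|)$ and makes at most $f(\kappa(x))\cdot\log|x|$ binary guesses. (Here $\log$ is the logarithm to base $2$ rounded down, with $\log 0:=0$.) Theorem. Let $\mathcal A$ be a decidable class of structures of bounded arity and of bounded pathwidth. Then $p\text{-}\mathrm{EMB}(\mathcal A)\in\mathrm{PATH}$; in particular its parameterization $\kappa$ is computable in logarithmic space. -/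

import Mathlib

namespace ParamLog

/-! ## Turing machines with a read-only input tape and several work tapes -/

inductive Move where
  | left
  | stay
  | right

/-- Content of an input cell: the input bits are enclosed by two end markers. -/
inductive InputSymbol where
  | startMark
  | bit (b : Bool)
  | endMark

/-- What a machine with `k` work tapes does in one deterministic step: next state, move of the
input head, symbol written and move on each work tape, and possibly a bit appended to the
write-only output tape. -/
structure Action (k : ℕ) (State Symbol : Type) where
  state : State
  inputMove : Move
  write : Fin k → Symbol
  workMove : Fin k → Move
  output : Option Bool

/-- A nondeterministic Turing machine with binary nondeterminism: in the state `guess` it changes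
its state to `guess0` or to `guess1`, in every other state it acts as `delta` says (`none` means
that it halts). -/
structure TuringMachine where
  State : Type
  Symbol : Type
  finite_state : Finite State
  finite_symbol : Finite Symbol
  tapes : ℕ
  blank : Symbol
  start : State
  accept : State
  guess : State
  guess0 : State
  guess1 : State
  delta : State → InputSymbol → (Fin tapes → Symbol) → Option (Action tapes State Symbol)

/-- Move of a head on a one-way infinite tape; a left move from the leftmost cell has no effect. -/
def Move.apply : Move → ℕ → ℕ
  | .left, p => p - 1
  | .stay, p => p
  | .right, p => p + 1

/-- The input tape has cells `0, …, |x| + 1`: the start marker, the bits of `x`, the end marker. -/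
def inputSymbol (x : List Bool) : ℕ → InputSymbol
  | 0 => .startMark
  | p + 1 => match x[p]? with
    | some b => .bit b
    | none => .endMark

namespace TuringMachine

variable (M : TuringMachine)

structure Config where
  state : M.State
  inputHead : ℕ
  work : Fin M.tapes → ℕ → M.Symbol
  workHead : Fin M.tapes → ℕ
  output : List Bool

def init : M.Config where
  state := M.start
  inputHead := 0
  work := fun _ _ => M.blank
  workHead := fun _ => 0
  output := []

variable {M}

/-- The configuration after a deterministic step; the input head never leaves the cells
`0, …, |x| + 1`. -/
def Config.perform (x : List Bool) (c : M.Config) (a : Action M.tapes M.State M.Symbol) :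
    M.Config where
  state := a.state
  inputHead := min (a.inputMove.apply c.inputHead) (x.length + 1)
  work := fun i => Function.update (c.work i) (c.workHead i) (a.write i)
  workHead := fun i => (a.workMove i).apply (c.workHead i)
  output := c.output ++ a.output.toList

variable (M)

/-- The action prescribed by the transition function in a configuration. -/
def action (x : List Bool) (c : M.Config) : Option (Action M.tapes M.State M.Symbol) :=
  M.delta c.state (inputSymbol x c.inputHead) (fun i => c.work i (c.workHead i))

/-- One step of the machine on input `x`. -/
inductive Step (x : List Bool) : M.Config → M.Config → Prop
  | guess0 (c : M.Config) : c.state = M.guess → Step x c { c with state := M.guess0 }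
  | guess1 (c : M.Config) : c.state = M.guess → Step x c { c with state := M.guess1 }
  | det (c : M.Config) (a : Action M.tapes M.State M.Symbol) :
      c.state ≠ M.guess → M.action x c = some a → Step x c (c.perform x a)

def Halted (x : List Bool) (c : M.Config) : Prop := ∀ c', ¬ M.Step x c c'

/-- `l` is an initial segment of a run of `M` on `x`. -/
def IsRun (x : List Bool) (l : List M.Config) : Prop :=
  l.head? = some M.init ∧ l.IsChain (M.Step x)

/-- Some run on `x` halts in the accepting state. -/
def Accepts (x : List Bool) : Prop :=
  ∃ l, M.IsRun x l ∧ ∃ c ∈ l, M.Halted x c ∧ c.state = M.accept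

/-- Some run on `x` halts with `y` on the output tape. -/
def Outputs (x y : List Bool) : Prop :=
  ∃ l, M.IsRun x l ∧ ∃ c ∈ l, M.Halted x c ∧ c.output = y

/-- On every run on `x`, at most `s` cells of each work tape are visited. -/
def RunsInSpace (x : List Bool) (s : ℕ) : Prop :=
  ∀ l, M.IsRun x l → ∀ c ∈ l, ∀ i, c.workHead i < s

open Classical in
/-- Every run on `x` contains at most `b` configurations with the guess state. -/
def UsesNondetBits (x : List Bool) (b : ℕ) : Prop :=
  ∀ l, M.IsRun x l → l.countP (fun c => decide (c.state = M.guess)) ≤ b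

/-- Parameterized logarithmic space: `O(f(κ(x)) + log |x|)` for some computable `f`. -/
def PLSpaceBounded (κ : List Bool → ℕ) : Prop :=
  ∃ f : ℕ → ℕ, Computable f ∧ ∃ c : ℕ, ∀ x : List Bool,
    M.RunsInSpace x (c * (f (κ x) + Nat.log 2 x.length))

end TuringMachine

/-- `κ` is computable in logarithmic space: some machine that never guesses and runs in space
`O(log |x|)` halts on every input `x` with the binary representation of `κ x` on its output tape
(least significant bit first). -/
def LogSpaceComputable (κ : List Bool → ℕ) : Prop :=
  ∃ M : TuringMachine, ∃ c : ℕ, ∀ x : List Bool,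
    M.UsesNondetBits x 0 ∧ M.RunsInSpace x (c * (1 + Nat.log 2 x.length)) ∧
      M.Outputs x (Nat.bits (κ x))

/-- The pair `(Q, κ)` is a parameterized problem in the class PATH: `κ` is a parameterization
(computable in logarithmic space), and there are a computable `f` and a nondeterministic machine
that accepts `Q`, is pl-space bounded with respect to `κ`, and uses `f(κ(x)) * log |x|` many
nondeterministic bits. -/
def InPATH (Q : Set (List Bool)) (κ : List Bool → ℕ) : Prop :=
  LogSpaceComputable κ ∧
    ∃ f : ℕ → ℕ, Computable f ∧ ∃ M : TuringMachine,
      (∀ x, M.Accepts x ↔ x ∈ Q) ∧ M.PLSpaceBounded κ ∧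
        ∀ x, M.UsesNondetBits x (f (κ x) * Nat.log 2 x.length)

/-! ## Finite relational structures -/

/-- A finite relational vocabulary with relation symbols `0, …, m - 1`. -/
structure Vocabulary where
  m : ℕ
  ar : Fin m → ℕ

/-- A finite structure, with nonempty universe `{0, …, n - 1}`. -/
structure Str (τ : Vocabulary) where
  n : ℕ
  pos : 0 < n
  rel : (i : Fin τ.m) → Finset (Fin (τ.ar i) → Fin n)

/-- A class of structures of arbitrary vocabularies. -/
abbrev StrClass := (τ : Vocabulary) → Set (Str τ)

namespace Str

variable {τ : Vocabulary}

/-- `|A| = |τ| + |universe| + ∑_R |R^A| * ar(R)`. -/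
def size (A : Str τ) : ℕ := τ.m + A.n + ∑ i, (A.rel i).card * τ.ar i

def IsHom (A B : Str τ) (h : Fin A.n → Fin B.n) : Prop :=
  ∀ i, ∀ t ∈ A.rel i, h ∘ t ∈ B.rel i

/-- An embedding is an injective homomorphism. -/
def Embeds (A B : Str τ) : Prop := ∃ h, A.IsHom B h ∧ Function.Injective h

def gaifman (A : Str τ) : SimpleGraph (Fin A.n) where
  Adj a b := a ≠ b ∧ ∃ i, ∃ t ∈ A.rel i, a ∈ Set.range t ∧ b ∈ Set.range t
  symm := ⟨fun _ _ ⟨h, i, t, ht, ha, hb⟩ => ⟨h.symm, i, t, ht, hb, ha⟩⟩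
  loopless := ⟨fun _ h => h.1 rfl⟩

end Str

/-- A path-decomposition of a graph: bags along a path with `k` vertices. -/
structure PathDecomposition {V : Type} (G : SimpleGraph V) where
  k : ℕ
  bag : Fin k → Finset V
  cover : ∀ v, ∃ i, v ∈ bag i
  edge : ∀ u v, G.Adj u v → ∃ i, u ∈ bag i ∧ v ∈ bag i
  between : ∀ i j l, i ≤ j → j ≤ l → ∀ v, v ∈ bag i → v ∈ bag l → v ∈ bag j

/-- Largest size of a bag, minus one. -/
def PathDecomposition.width {V : Type} {G : SimpleGraph V} (D : PathDecomposition G) : ℕ :=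
  (Finset.univ.sup fun i => (D.bag i).card) - 1

noncomputable def pathwidth {V : Type} (G : SimpleGraph V) : ℕ :=
  sInf {w | ∃ D : PathDecomposition G, D.width = w}

namespace StrClass

def BoundedArity (𝒜 : StrClass) : Prop :=
  ∃ r : ℕ, ∀ τ, ∀ A ∈ 𝒜 τ, ∀ i, τ.ar i ≤ r

def BoundedPathwidth (𝒜 : StrClass) : Prop :=
  ∃ w : ℕ, ∀ τ, ∀ A ∈ 𝒜 τ, pathwidth (Str.gaifman A) ≤ w

end StrClass

/-! ## Binary encodings -/

/-- Self-delimiting encoding of a list. -/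
def encList {α : Type} (e : α → List Bool) (l : List α) : List Bool :=
  l.flatMap (fun a => true :: e a) ++ [false]

def encUnary (n : ℕ) : List Bool := encList (fun _ => []) (List.replicate n ())

def encBinary (n : ℕ) : List Bool := encList (fun b => [b]) (Nat.bits n)

def encTuple {r n : ℕ} (t : Fin r → Fin n) : List Bool :=
  (List.ofFn fun j => (t j : ℕ)).flatMap encBinary

def encVocabulary (τ : Vocabulary) : List Bool := encList encUnary (List.ofFn τ.ar)

/-- `y` encodes the universe and the relations of `A`: the size of the universe in unary, and for
each relation symbol a list of the tuples of the relation, in any order, without repetition, the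
entries in binary. -/
def EncodesBody {τ : Vocabulary} (y : List Bool) (A : Str τ) : Prop :=
  ∃ L : (i : Fin τ.m) → List (Fin (τ.ar i) → Fin A.n),
    (∀ i, (L i).Nodup ∧ ∀ t, t ∈ L i ↔ t ∈ A.rel i) ∧
      y = encUnary A.n ++ (List.finRange τ.m).flatMap fun i => encList encTuple (L i)

/-- `x` encodes the structure `A` (with its vocabulary). -/
def Encodes {τ : Vocabulary} (x : List Bool) (A : Str τ) : Prop :=
  ∃ y, EncodesBody y A ∧ x = encVocabulary τ ++ y

/-- `x` encodes the pair `(A, B)` of structures of the same vocabulary. -/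
def EncodesPair {τ : Vocabulary} (x : List Bool) (A B : Str τ) : Prop :=
  ∃ y z, EncodesBody y A ∧ EncodesBody z B ∧ x = encVocabulary τ ++ y ++ z

/-- The set of encodings of structures in the class is decidable. -/
def StrClass.IsDecidable (𝒜 : StrClass) : Prop :=
  ComputablePred fun x : List Bool => ∃ τ, ∃ A ∈ 𝒜 τ, Encodes x A

/-! ## The parameterized embedding problem -/

/-- The yes-instances: encodings of pairs `(A, B)` with `A` in the class that embeds into `B`. -/
def embProblem (𝒜 : StrClass) : Set (List Bool) :=
  {x | ∃ τ, ∃ A ∈ 𝒜 τ, ∃ B : Str τ, EncodesPair x A B ∧ A.Embeds B}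

open Classical in
/-- The parameter: `|A|` on encodings of pairs `(A, B)`, and `0` on all other strings. -/
noncomputable def embParam (x : List Bool) : ℕ :=
  if h : ∃ k, ∃ τ, ∃ A B : Str τ, EncodesPair x A B ∧ A.size = k then h.choose else 0

/-! ### Encodings are uniquely readable, so the parameter is well defined -/

/-- Words of the code `e` can be read off uniquely from the left. -/
def UniqueRead {α : Type} (e : α → List Bool) : Prop :=
  ∀ a b y z, e a ++ y = e b ++ z → a = b ∧ y = z

theorem uniqueRead_encList {α : Type} {e : α → List Bool} (he : UniqueRead e) :
    UniqueRead (encList e) := by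
  intro l
  induction l with
  | nil =>
    intro l' y z h
    cases l' with
    | nil => exact ⟨rfl, by simpa [encList] using h⟩
    | cons b l' => simp [encList] at h
  | cons a l ih =>
    intro l' y z h
    cases l' with
    | nil => simp [encList] at h
    | cons b l' =>
      have h1 : e a ++ (encList e l ++ y) = e b ++ (encList e l' ++ z) := by
        simpa [encList] using h
      obtain ⟨rfl, h2⟩ := he _ _ _ _ h1
      obtain ⟨rfl, h3⟩ := ih _ _ _ h2
      exact ⟨rfl, h3⟩

theorem uniqueRead_encUnary : UniqueRead encUnary := by
  intro a b y z h
  have := uniqueRead_encList (e := fun _ : Unit => []) (fun a b y z h => ⟨rfl, by simpa using h⟩)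
    _ _ _ _ h
  exact ⟨by simpa using congrArg List.length this.1, this.2⟩

theorem uniqueRead_encBinary : UniqueRead encBinary := by
  intro a b y z h
  have := uniqueRead_encList (e := fun b : Bool => [b]) (fun a b y z h => by simpa using h)
    _ _ _ _ h
  refine ⟨(Nat.digits_inj_iff (b := 2)).1 ?_, this.2⟩
  rw [Nat.digits_two_eq_bits, Nat.digits_two_eq_bits, this.1]

theorem uniqueRead_flatMap {ι : Type} {β : ι → Type} {e : (i : ι) → β i → List Bool}
    (he : ∀ i, UniqueRead (e i)) (L L' : (i : ι) → β i) (l : List ι) :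
    ∀ y z, (l.flatMap fun i => e i (L i)) ++ y = (l.flatMap fun i => e i (L' i)) ++ z →
      (∀ i ∈ l, L i = L' i) ∧ y = z := by
  induction l with
  | nil => intro y z h; simpa using h
  | cons a l ih =>
    intro y z h
    simp only [List.flatMap_cons, List.append_assoc] at h
    obtain ⟨h1, h2⟩ := he a _ _ _ _ h
    obtain ⟨h3, h4⟩ := ih _ _ h2
    exact ⟨by simpa [h1] using h3, h4⟩

theorem uniqueRead_encTuple {r n : ℕ} : UniqueRead (encTuple (r := r) (n := n)) := by
  intro t t' y z h
  have key (t : Fin r → Fin n) :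
      encTuple t = (List.finRange r).flatMap fun i => encBinary (t i) := by
    rw [encTuple, List.ofFn_eq_map, List.flatMap_map]
  rw [key, key] at h
  have := uniqueRead_flatMap (β := fun _ : Fin r => ℕ) (e := fun _ => encBinary)
    (fun _ => uniqueRead_encBinary) (fun i => (t i : ℕ)) (fun i => (t' i : ℕ)) _ _ _ h
  exact ⟨funext fun i => Fin.ext (this.1 i (List.mem_finRange i)), this.2⟩

theorem uniqueRead_encVocabulary : UniqueRead encVocabulary := by
  rintro ⟨m, a⟩ ⟨m', a'⟩ y z h
  obtain ⟨h1, h2⟩ := uniqueRead_encList uniqueRead_encUnary _ _ _ _ h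
  have h3 := List.ofFn_inj'.1 h1
  obtain rfl : m = m' := congrArg Sigma.fst h3
  exact ⟨by simpa using h3, h2⟩

theorem EncodesBody.unique {τ : Vocabulary} {A A' : Str τ} {y y' z z' : List Bool}
    (h : EncodesBody y A) (h' : EncodesBody y' A') (e : y ++ z = y' ++ z') :
    A = A' ∧ z = z' := by
  obtain ⟨n, hn, R⟩ := A
  obtain ⟨n', hn', R'⟩ := A'
  obtain ⟨L, hL, rfl⟩ := h
  obtain ⟨L', hL', rfl⟩ := h'
  rw [List.append_assoc, List.append_assoc] at e
  obtain ⟨h1, h2⟩ := uniqueRead_encUnary _ _ _ _ e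
  change n = n' at h1
  subst h1
  obtain ⟨h3, h4⟩ := uniqueRead_flatMap (fun _ => uniqueRead_encList uniqueRead_encTuple)
    L L' _ _ _ h2
  refine ⟨?_, h4⟩
  have : R = R' := by
    funext i
    ext t
    have h5 := (hL i).2 t
    have h6 := (hL' i).2 t
    rw [h3 i (List.mem_finRange i)] at h5
    exact h5.symm.trans h6
  subst this
  rfl

theorem embParam_eq {τ : Vocabulary} {x : List Bool} {A B : Str τ} (h : EncodesPair x A B) :
    embParam x = A.size := by
  have hx : ∃ k, ∃ τ, ∃ A B : Str τ, EncodesPair x A B ∧ A.size = k := ⟨_, τ, A, B, h, rfl⟩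
  rw [embParam, dif_pos hx]
  obtain ⟨τ', A', B', h', e⟩ := hx.choose_spec
  rw [← e]
  obtain ⟨y, z, hA, -, rfl⟩ := h
  obtain ⟨y', z', hA', -, e'⟩ := h'
  simp only [List.append_assoc] at e'
  obtain ⟨rfl, e2⟩ := uniqueRead_encVocabulary _ _ _ _ e'
  rw [(hA.unique hA' e2).1]

end ParamLog

/-! Let `A` have `n` elements and a path-decomposition with bags of at most `w + 1` elements. A
homomorphism to `B` can be guessed bag by bag: guess the images of the elements of one bag, check
that tuples inside the bag go to tuples of `B` and that the images agree with those guessed for the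
previous bag, then forget the previous bag. A bag costs `w + 1` times about `log |B|` bits, and `n`
bags suffice (`PathDecomposition.exists_bags`), so the number of guesses is bounded by a function of
the parameter times `log |x|`.

Local checks do not see injectivity, since earlier images are forgotten. It is recovered by hashing:
for an injective map into `B` some modulus `p` of order `n² log |B|` leaves all images with
different residues (`exists_separating_modulus`). The modulus and the residues, called colours, are
guessed in advance and stored during the whole run. If the colours are pairwise different and each
guessed image has the residue prescribed by the colour of its element, the glued map is injective
(`embeds_of_local`). This stored certificate takes about `n log log |B|` bits for fixed `n`, and a
product `k log log |B|` is at most `k² + O(log |B|)`, so it fits into the space bound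
(`certBits_le_add`). The decomposition is guessed along with it, as `n²` bits.
`EncodesPair.embeds_iff` is the resulting characterization of embeddability.

Membership of `A` in the class is decided by an arbitrary algorithm. With bounded arity the code of
`A` has a length bounded in terms of `|A|`, so the space used is bounded by a computable function of
the parameter (`sem_of_computable`, `exists_sem_mem`).

The machines come from while-programs over counters that are stored in binary, so that counters
below `V` need about `log V` cells (`exists_machine`). Functions with polynomially bounded counters
(`PC`) are closed under composition, recursion with polynomially bounded values, and bounded
quantifiers. The parser, the parameter and the checks of certificates are built in this way;
`exists_rounds_machine` supplies the machine that guesses in rounds. -/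

namespace ParamLog

/-! ## Guess-labelled paths of a machine -/

namespace TuringMachine

variable {M : TuringMachine} {x : List Bool} {B : ℕ}

/-- `M` gets from one configuration to another using the given guesses, with all work heads to the
left of cell `B`. -/
inductive Path (M : TuringMachine) (x : List Bool) (B : ℕ) :
    M.Config → List Bool → M.Config → Prop
  | refl (c : M.Config) : (∀ i, c.workHead i < B) → Path M x B c [] c
  | det (c c' : M.Config) (g : List Bool) (a : Action M.tapes M.State M.Symbol) :
      (∀ i, c.workHead i < B) → c.state ≠ M.guess → M.action x c = some a →
      Path M x B (c.perform x a) g c' → Path M x B c g c'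
  | guess (c c' : M.Config) (g : List Bool) (b : Bool) :
      (∀ i, c.workHead i < B) → c.state = M.guess →
      Path M x B { c with state := bif b then M.guess1 else M.guess0 } g c' →
      Path M x B c (b :: g) c'

theorem Path.trans {c d e : M.Config} {g g' : List Bool} (h : M.Path x B c g d)
    (h' : M.Path x B d g' e) : M.Path x B c (g ++ g') e := by
  induction h with
  | refl => simpa
  | det c _ g a hB hs ha _ ih => exact .det _ _ _ a hB hs ha (ih h')
  | guess c _ g b hB hs _ ih => exact .guess _ _ _ b hB hs (ih h')

theorem Path.heads_lt {c d : M.Config} {g : List Bool} (h : M.Path x B c g d) :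
    ∀ i, c.workHead i < B := by
  cases h <;> assumption

theorem Path.eq_of_halted {c d : M.Config} {g : List Bool} (h : M.Path x B c g d)
    (hc : M.Halted x c) : g = [] ∧ d = c := by
  cases h with
  | refl => exact ⟨rfl, rfl⟩
  | det _ _ _ a _ hs ha => exact absurd (Step.det c a hs ha) (hc _)
  | guess _ _ _ b _ hs => exact absurd (Step.guess0 c hs) (hc _)

/-- The hypothesis `h` is the invariant that controls all runs: each guess word of length `T` drives
`c` to a halt. A deterministic step inherits it with the same `T`, because all these paths start
with that step. -/
theorem Path.of_step {c d e : M.Config} {T : ℕ}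
    (h : ∀ g : List Bool, g.length = T → ∃ c', M.Path x B c g c' ∧ M.Halted x c')
    (hs : M.Step x c d) (hd : c.state ≠ M.guess) :
    (∀ g, M.Path x B d g e → M.Path x B c g e) ∧
      ∀ g : List Bool, g.length = T → ∃ c', M.Path x B d g c' ∧ M.Halted x c' := by
  obtain ⟨c', hp, -⟩ := h (List.replicate T false) (by simp)
  have hB := hp.heads_lt
  cases hs with
  | guess0 h => exact absurd h hd
  | guess1 h => exact absurd h hd
  | det a _ ha =>
    refine ⟨fun g hg => .det _ _ _ a hB hd ha hg, fun g hg => ?_⟩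
    obtain ⟨c', hp, hc'⟩ := h g hg
    refine ⟨c', ?_, hc'⟩
    cases hp with
    | refl => exact absurd (Step.det c a hd ha) (hc' _)
    | det _ _ _ a' _ _ ha' hp =>
      rw [ha] at ha'
      cases ha'
      exact hp
    | guess _ _ _ b _ h => exact absurd h hd

/-- A guess uses up one bit of the budget. With `T = 0` the path for the empty guess word could only
stay in `c`, which is not halted. -/
theorem Path.of_guess_step {c d e : M.Config} {T : ℕ}
    (h : ∀ g : List Bool, g.length = T → ∃ c', M.Path x B c g c' ∧ M.Halted x c')
    (hs : M.Step x c d) (hd : c.state = M.guess) :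
    ∃ S, T = S + 1 ∧ (∃ b, ∀ g, M.Path x B d g e → M.Path x B c (b :: g) e) ∧
      ∀ g : List Bool, g.length = S → ∃ c', M.Path x B d g c' ∧ M.Halted x c' := by
  obtain ⟨c', hp, hc'⟩ := h (List.replicate T false) (by simp)
  have hB := hp.heads_lt
  obtain ⟨S, rfl⟩ : ∃ S, T = S + 1 := by
    cases T with
    | succ S => exact ⟨S, rfl⟩
    | zero =>
      cases hp with
      | refl => exact absurd (Step.guess0 c hd) (hc' _)
      | det _ _ _ a' _ h' _ hp => exact absurd hd h'
  obtain ⟨b, rfl⟩ : ∃ b, d = { c with state := bif b then M.guess1 else M.guess0 } := by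
    cases hs with
    | guess0 => exact ⟨false, rfl⟩
    | guess1 => exact ⟨true, rfl⟩
    | det a h' => exact absurd hd h'
  refine ⟨S, rfl, ⟨b, fun g hg => .guess _ _ _ b hB hd hg⟩, fun g hg => ?_⟩
  obtain ⟨c', hp, hc'⟩ := h (b :: g) (by simp [hg])
  refine ⟨c', ?_, hc'⟩
  cases hp with
  | det _ _ _ a' _ h' _ hp => exact absurd hd h'
  | guess _ _ _ _ _ _ hp => exact hp

-- An arbitrary run, finished or not, follows one of the halting paths provided by `h`, because each
-- guess made in the run can be taken as the next bit of the word. Bounds along these paths are thus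
-- bounds for all runs.
open Classical in
theorem run_bounds {T : ℕ} {c : M.Config} {l : List M.Config}
    (h : ∀ g : List Bool, g.length = T → ∃ c', M.Path x B c g c' ∧ M.Halted x c')
    (hl : (c :: l).IsChain (M.Step x)) :
    (∀ d ∈ c :: l, ∀ i, d.workHead i < B) ∧
      (c :: l).countP (fun c => decide (c.state = M.guess)) ≤ T := by
  induction l generalizing c T with
  | nil =>
    obtain ⟨c', hp, hc'⟩ := h (List.replicate T false) (by simp)
    refine ⟨by simpa using hp.heads_lt, ?_⟩
    by_cases hs : c.state = M.guess
    · obtain ⟨S, rfl, -⟩ := Path.of_guess_step (e := c) h (Step.guess0 c hs) hs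
      simp [hs]
    · simp [hs]
  | cons d l ih =>
    rw [List.isChain_cons_cons] at hl
    obtain ⟨c', hp, hc'⟩ := h (List.replicate T false) (by simp)
    by_cases hs : c.state = M.guess
    · obtain ⟨S, rfl, -, h'⟩ := Path.of_guess_step (e := c) h hl.1 hs
      obtain ⟨h1, h2⟩ := ih h' hl.2
      refine ⟨by simpa using ⟨hp.heads_lt, by simpa using h1⟩, ?_⟩
      rw [List.countP_cons]
      simp only [hs, decide_true, if_true]
      omega
    · obtain ⟨-, h'⟩ := Path.of_step (e := c) h hl.1 hs
      obtain ⟨h1, h2⟩ := ih h' hl.2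
      refine ⟨by simpa using ⟨hp.heads_lt, by simpa using h1⟩, ?_⟩
      rw [List.countP_cons]
      simpa [hs] using h2

/-- A halting run uses exactly `T` guesses: with fewer it would halt on a proper prefix of a word
that is consumed entirely by `h`. -/
theorem exists_path_of_run {T : ℕ} {c e : M.Config} {l : List M.Config}
    (h : ∀ g : List Bool, g.length = T → ∃ c', M.Path x B c g c' ∧ M.Halted x c')
    (hl : (c :: l).IsChain (M.Step x)) (he : e ∈ c :: l) (hh : M.Halted x e) :
    ∃ g : List Bool, g.length = T ∧ M.Path x B c g e := by
  induction l generalizing c T with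
  | nil =>
    obtain rfl : e = c := by simpa using he
    obtain ⟨c', hp, hc'⟩ := h (List.replicate T false) (by simp)
    obtain ⟨h1, rfl⟩ := hp.eq_of_halted hh
    exact ⟨_, by simp, hp⟩
  | cons d l ih =>
    rw [List.isChain_cons_cons] at hl
    rcases List.mem_cons.1 he with rfl | he
    · exact absurd hl.1 (hh _)
    by_cases hs : c.state = M.guess
    · obtain ⟨S, rfl, ⟨b, hb⟩, h'⟩ := Path.of_guess_step (e := e) h hl.1 hs
      obtain ⟨g, rfl, hg⟩ := ih h' hl.2 he
      exact ⟨b :: g, rfl, hb g hg⟩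
    · obtain ⟨hb, h'⟩ := Path.of_step (e := e) h hl.1 hs
      obtain ⟨g, rfl, hg⟩ := ih h' hl.2 he
      exact ⟨g, rfl, hb g hg⟩

theorem Path.exists_run {c d : M.Config} {g : List Bool} (h : M.Path x B c g d) :
    ∃ l, (c :: l).IsChain (M.Step x) ∧ d ∈ c :: l := by
  induction h with
  | refl c => exact ⟨[], by simp, by simp⟩
  | det c d g a _ hs ha _ ih =>
    obtain ⟨l, h1, h2⟩ := ih
    exact ⟨_ :: l, List.isChain_cons_cons.2 ⟨.det c a hs ha, h1⟩, List.mem_cons_of_mem _ h2⟩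
  | guess c d g b _ hs _ ih =>
    obtain ⟨l, h1, h2⟩ := ih
    refine ⟨_ :: l, List.isChain_cons_cons.2 ⟨?_, h1⟩, List.mem_cons_of_mem _ h2⟩
    cases b
    · exact .guess0 c hs
    · exact .guess1 c hs

theorem IsRun.exists_cons {l : List M.Config} (h : M.IsRun x l) :
    ∃ l', l = M.init :: l' ∧ (M.init :: l').IsChain (M.Step x) := by
  obtain ⟨h1, h2⟩ := h
  cases l with
  | nil => simp at h1
  | cons a l =>
    obtain rfl : a = M.init := by simpa using h1
    exact ⟨l, rfl, h2⟩

theorem runsInSpace_of_paths {T : ℕ}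
    (h : ∀ g : List Bool, g.length = T → ∃ c', M.Path x B M.init g c' ∧ M.Halted x c') :
    M.RunsInSpace x B := by
  intro l hl
  obtain ⟨l, rfl, hl'⟩ := hl.exists_cons
  exact (run_bounds h hl').1

theorem usesNondetBits_of_paths {T : ℕ}
    (h : ∀ g : List Bool, g.length = T → ∃ c', M.Path x B M.init g c' ∧ M.Halted x c') :
    M.UsesNondetBits x T := by
  intro l hl
  obtain ⟨l, rfl, hl'⟩ := hl.exists_cons
  exact (run_bounds h hl').2

theorem accepts_iff_of_paths {T : ℕ}
    (h : ∀ g : List Bool, g.length = T → ∃ c', M.Path x B M.init g c' ∧ M.Halted x c') :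
    M.Accepts x ↔
    ∃ g : List Bool, ∃ c, g.length = T ∧ M.Path x B M.init g c ∧ M.Halted x c ∧
      c.state = M.accept := by
  constructor
  · rintro ⟨l, hl, c, hc, hh, ha⟩
    obtain ⟨l, rfl, hl'⟩ := hl.exists_cons
    obtain ⟨g, hg, hp⟩ := exists_path_of_run h hl' hc hh
    exact ⟨g, c, hg, hp, hh, ha⟩
  · rintro ⟨g, c, hg, hp, hh, ha⟩
    obtain ⟨l, h1, h2⟩ := hp.exists_run
    exact ⟨_, ⟨rfl, h1⟩, c, h2, hh, ha⟩

theorem Path.outputs {c : M.Config} {g : List Bool} (h : M.Path x B M.init g c)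
    (hc : M.Halted x c) : M.Outputs x c.output := by
  obtain ⟨l, h1, h2⟩ := h.exists_run
  exact ⟨_, ⟨rfl, h1⟩, c, h2, hc, rfl⟩

end TuringMachine

/-! ## While-programs over counters -/

inductive Test where
  | reg (r : ℕ)
  | inp (f : InputSymbol → Bool)
  | coin

/-- The only operations on counters are increment, decrement and the test for zero, each of which is
a single sweep over a number written in binary on its own tape. -/
inductive Prog where
  | inc (r : ℕ)
  | dec (r : ℕ)
  | move (m : Move)
  | emit (b : Bool)
  | seq (p q : Prog)
  | ite (t : Test) (p q : Prog)
  | loop (t : Test) (p : Prog)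

structure Mem where
  reg : ℕ → ℕ
  head : ℕ
  out : List Bool

def Mem.set (σ : Mem) (r v : ℕ) : Mem := { σ with reg := Function.update σ.reg r v }

inductive TestEv (x : List Bool) (σ : Mem) : Test → List Bool → Bool → Prop
  | reg (r : ℕ) : TestEv x σ (.reg r) [] (decide (σ.reg r ≠ 0))
  | inp (f : InputSymbol → Bool) : TestEv x σ (.inp f) [] (f (inputSymbol x σ.head))
  | coin (b : Bool) : TestEv x σ .coin [b] b

/-- The program, started in the first memory, terminates in the second one when the guesses are as
in the list; no counter is ever increased beyond `V`. -/
inductive Ev (x : List Bool) (V : ℕ) : Prog → Mem → List Bool → Mem → Prop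
  | inc (r : ℕ) (σ : Mem) : σ.reg r + 1 ≤ V → Ev x V (.inc r) σ [] (σ.set r (σ.reg r + 1))
  | dec (r : ℕ) (σ : Mem) : σ.reg r ≠ 0 → Ev x V (.dec r) σ [] (σ.set r (σ.reg r - 1))
  | move (m : Move) (σ : Mem) :
      Ev x V (.move m) σ [] { σ with head := min (m.apply σ.head) (x.length + 1) }
  | emit (b : Bool) (σ : Mem) : Ev x V (.emit b) σ [] { σ with out := σ.out ++ [b] }
  | seq {p q σ σ' σ'' g g'} : Ev x V p σ g σ' → Ev x V q σ' g' σ'' →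
      Ev x V (.seq p q) σ (g ++ g') σ''
  | ite {t p q σ σ' g g' b} : TestEv x σ t g b → Ev x V (bif b then p else q) σ g' σ' →
      Ev x V (.ite t p q) σ (g ++ g') σ'
  | loop_false {t p σ g} : TestEv x σ t g false → Ev x V (.loop t p) σ g σ
  | loop_true {t p σ σ' σ'' g g' g''} : TestEv x σ t g true → Ev x V p σ g' σ' →
      Ev x V (.loop t p) σ' g'' σ'' → Ev x V (.loop t p) σ (g ++ (g' ++ g'')) σ''

/-- An upper bound on the registers used. -/
def Prog.top : Prog → ℕ
  | .inc r => r
  | .dec r => r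
  | .move _ => 0
  | .emit _ => 0
  | .seq p q => max p.top q.top
  | .ite (.reg r) p q => max r (max p.top q.top)
  | .ite _ p q => max p.top q.top
  | .loop (.reg r) p => max r p.top
  | .loop _ p => p.top

/-! ### Flowcharts of programs -/

inductive Instr (K : Type) where
  | inc (r : ℕ) (k : K)
  | dec (r : ℕ) (k : K)
  | move (m : Move) (k : K)
  | emit (b : Bool) (k : K)
  | test (t : Test) (k1 k0 : K)
  | halt (acc : Bool)

/-- There is one label for each atomic instruction and for each test. The point behind the program
is not a label; it is the argument `exit` of `Prog.instr`. -/
def Lab : Prog → Type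
  | .seq p q => Lab p ⊕ Lab q
  | .ite _ p q => Option (Lab p ⊕ Lab q)
  | .loop _ p => Option (Lab p)
  | _ => Unit

theorem finite_lab : ∀ p : Prog, Finite (Lab p)
  | .seq p q => by
    have := finite_lab p
    have := finite_lab q
    exact inferInstanceAs (Finite (Lab p ⊕ Lab q))
  | .ite _ p q => by
    have := finite_lab p
    have := finite_lab q
    exact inferInstanceAs (Finite (Option (Lab p ⊕ Lab q)))
  | .loop _ p => by
    have := finite_lab p
    exact inferInstanceAs (Finite (Option (Lab p)))
  | .inc _ => inferInstanceAs (Finite Unit)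
  | .dec _ => inferInstanceAs (Finite Unit)
  | .move _ => inferInstanceAs (Finite Unit)
  | .emit _ => inferInstanceAs (Finite Unit)

def Prog.entry : (p : Prog) → Lab p
  | .seq p _ => Sum.inl p.entry
  | .ite _ _ _ => none
  | .loop _ _ => none
  | .inc _ => ()
  | .dec _ => ()
  | .move _ => ()
  | .emit _ => ()

/-- The instruction at a label of a program that is embedded into a larger flowchart. -/
def Prog.instr {K : Type} : (p : Prog) → (Lab p → K) → K → Lab p → Instr K
  | .inc r, _, exit, _ => .inc r exit
  | .dec r, _, exit, _ => .dec r exit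
  | .move m, _, exit, _ => .move m exit
  | .emit b, _, exit, _ => .emit b exit
  | .seq p q, emb, exit, l => match (show Lab p ⊕ Lab q from l) with
    | .inl l => p.instr (fun l => emb (Sum.inl l)) (emb (Sum.inr q.entry)) l
    | .inr l => q.instr (fun l => emb (Sum.inr l)) exit l
  | .ite t p q, emb, exit, l => match (show Option (Lab p ⊕ Lab q) from l) with
    | none => .test t (emb (some (Sum.inl p.entry))) (emb (some (Sum.inr q.entry)))
    | some (.inl l) => p.instr (fun l => emb (some (Sum.inl l))) exit l
    | some (.inr l) => q.instr (fun l => emb (some (Sum.inr l))) exit l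
  | .loop t p, emb, exit, l => match (show Option (Lab p) from l) with
    | none => .test t (emb (some p.entry)) exit
    | some l => p.instr (fun l => emb (some l)) (emb none) l

end ParamLog

namespace ParamLog

/-! ### The machine of a flowchart -/

inductive Phase where
  | boot | run | carry | borrow | scan | back | coin | coin0 | coin1 | acc | rej
  deriving DecidableEq

instance : Finite Phase := by
  have : Fintype Phase := ⟨{.boot, .run, .carry, .borrow, .scan, .back, .coin, .coin0, .coin1, .acc,
    .rej}, by intro x; cases x <;> simp⟩
  infer_instance

/-- Tape symbols: blank, the mark of the leftmost cell, bits, and pairs of labels. -/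
abbrev TapeSymbol (K : Type) := Option (Option (Bool ⊕ K × K))

namespace TapeSymbol

variable {K : Type}

abbrev blank : TapeSymbol K := none
abbrev mark : TapeSymbol K := some none
abbrev bit (b : Bool) : TapeSymbol K := some (some (.inl b))
abbrev lab (k1 k0 : K) : TapeSymbol K := some (some (.inr (k1, k0)))

end TapeSymbol

open TapeSymbol

variable {K : Type} {N : ℕ}

/-- The components are the phase, the work tape being processed, and two labels at which execution
may continue. Components that are not in use have default values. -/
abbrev FlowState (K : Type) (N : ℕ) := Phase × Fin (N + 1) × K × K

/-- The action that does something on one work tape only. -/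
def Action.single (q : FlowState K N) (reads : Fin (N + 1) → TapeSymbol K) (r : Fin (N + 1))
    (s : TapeSymbol K) (m : Move) : Action (N + 1) (FlowState K N) (TapeSymbol K) where
  state := q
  inputMove := .stay
  write := Function.update reads r s
  workMove := Function.update (fun _ => .stay) r m
  output := none

/-- An operation on a register is a sweep from the mark in cell `0` to the right, least significant
bit first, followed by the phase `back`, which returns to the mark. Between two instructions all
work heads are on cell `0`. -/
def flowDelta (code : K → Instr K) (start : K) :
    FlowState K N → InputSymbol → (Fin (N + 1) → TapeSymbol K) →
      Option (Action (N + 1) (FlowState K N) (TapeSymbol K))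
  | (.boot, _, _, _), _, _ => some ⟨(.run, 0, start, start), .stay, fun _ => mark, fun _ => .stay, none⟩
  | (.run, _, k, _), s, w => match code k with
    | .inc r k' => some (.single (.carry, Fin.ofNat (N + 1) r, k', k') w (Fin.ofNat (N + 1) r) mark .right)
    | .dec r k' => some (.single (.borrow, Fin.ofNat (N + 1) r, k', k') w (Fin.ofNat (N + 1) r) mark .right)
    | .move m k' => some ⟨(.run, 0, k', k'), m, w, fun _ => .stay, none⟩
    | .emit b k' => some ⟨(.run, 0, k', k'), .stay, w, fun _ => .stay, some b⟩
    | .test (.reg r) k1 k0 =>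
      some (.single (.scan, Fin.ofNat (N + 1) r, k1, k0) w (Fin.ofNat (N + 1) r) mark .right)
    | .test (.inp f) k1 k0 =>
      some ⟨(.run, 0, bif f s then k1 else k0, bif f s then k1 else k0), .stay, w, fun _ => .stay,
        none⟩
    -- The machine has a single guess state, which cannot remember where to continue. Both labels
    -- are written on tape `0` in place of the mark; the phases `coin0` and `coin1` read them there
    -- and restore the mark.
    | .test .coin k1 k0 => some (.single (.coin, 0, start, start) w 0 (lab k1 k0) .stay)
    | .halt b => some ⟨(bif b then .acc else .rej, 0, start, start), .stay, w, fun _ => .stay, none⟩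
  | (.carry, r, k, k'), _, w => match w r with
    | some (some (.inl true)) => some (.single (.carry, r, k, k') w r (bit false) .right)
    | _ => some (.single (.back, r, k, k') w r (bit true) .left)
  | (.borrow, r, k, k'), _, w => match w r with
    | some (some (.inl true)) => some (.single (.back, r, k, k') w r (bit false) .left)
    | _ => some (.single (.borrow, r, k, k') w r (bit true) .right)
  | (.scan, r, k1, k0), _, w => match w r with
    | some (some (.inl true)) => some (.single (.back, r, k1, k1) w r (bit true) .left)
    | some (some (.inl false)) => some (.single (.scan, r, k1, k0) w r (bit false) .right)
    | s => some (.single (.back, r, k0, k0) w r s .left)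
  | (.back, r, k, k'), _, w => match w r with
    | some none => some (.single (.run, 0, k, k) w r mark .stay)
    | s => some (.single (.back, r, k, k') w r s .left)
  | (.coin1, _, _, _), _, w => match w 0 with
    | some (some (.inr (k, _))) => some (.single (.run, 0, k, k) w 0 mark .stay)
    | _ => none
  | (.coin0, _, _, _), _, w => match w 0 with
    | some (some (.inr (_, k))) => some (.single (.run, 0, k, k) w 0 mark .stay)
    | _ => none
  | _, _, _ => none

@[reducible]
def flowMachine (K : Type) (hK : Finite K) (code : K → Instr K) (start : K) (N : ℕ) :
    TuringMachine where
  State := FlowState K N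
  Symbol := TapeSymbol K
  finite_state := inferInstance
  finite_symbol := inferInstance
  tapes := N + 1
  blank := blank
  start := (.boot, 0, start, start)
  accept := (.acc, 0, start, start)
  guess := (.coin, 0, start, start)
  guess0 := (.coin0, 0, start, start)
  guess1 := (.coin1, 0, start, start)
  delta := flowDelta code start

/-- The tape with a mark in the leftmost cell, followed by the bits of a list. -/
def bitTape (l : List Bool) : ℕ → TapeSymbol K
  | 0 => mark
  | j + 1 => match l[j]? with
    | some b => bit b
    | none => blank

/-- The number with the given bits, least significant bit first. -/
def bitVal : List Bool → ℕ
  | [] => 0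
  | b :: l => b.toNat + 2 * bitVal l

def bitInc : List Bool → List Bool
  | [] => [true]
  | false :: l => true :: l
  | true :: l => false :: bitInc l

def bitDec : List Bool → List Bool
  | [] => []
  | false :: l => true :: bitDec l
  | true :: l => false :: l

theorem bitVal_bitInc (l : List Bool) : bitVal (bitInc l) = bitVal l + 1 := by
  induction l with
  | nil => rfl
  | cons b l ih =>
    cases b
    · simp [bitInc, bitVal]; omega
    · simp [bitInc, bitVal, ih]; omega

theorem bitVal_bitDec (l : List Bool) (h : bitVal l ≠ 0) : bitVal (bitDec l) = bitVal l - 1 := by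
  induction l with
  | nil => simp [bitVal] at h
  | cons b l ih =>
    cases b
    · have : bitVal l ≠ 0 := fun h' => h (by simp [bitVal, h'])
      simp [bitDec, bitVal, ih this]
      omega
    · simp [bitDec, bitVal]

/-- Decrements leave leading zeros, so the length is not determined by the value and has to be
bounded separately. A carry out of the top occurs only when all bits are one; then `2 ^ l.length`
equals the new value, which is at most `V`. -/
theorem length_bitInc (l : List Bool) {V : ℕ} (hl : l.length ≤ V.size) (hV : bitVal l + 1 ≤ V) :
    (bitInc l).length ≤ V.size := by
  have key : (bitInc l).length = l.length ∨ 2 ^ l.length = bitVal l + 1 ∧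
      (bitInc l).length = l.length + 1 := by
    clear hl hV
    induction l with
    | nil => right; simp [bitVal, bitInc]
    | cons b l ih =>
      cases b
      · left; simp [bitInc]
      · rcases ih with h | h
        · left; simp [bitInc, h]
        · right; simp only [bitInc, bitVal, List.length_cons, pow_succ, Bool.toNat_true]; omega
  rcases key with h | ⟨h1, h2⟩
  · omega
  · rw [h2]
    have : l.length < V.size := Nat.lt_size.2 (by omega)
    omega

theorem length_bitDec (l : List Bool) : (bitDec l).length = l.length := by
  induction l with
  | nil => rfl
  | cons b l ih => cases b <;> simp [bitDec, ih]

theorem bitTape_mid (pre : List Bool) (b : Bool) (l : List Bool) :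
    bitTape (K := K) (pre ++ b :: l) (pre.length + 1) = bit b := by
  simp [bitTape]

theorem bitTape_end (pre : List Bool) :
    bitTape (K := K) pre (pre.length + 1) = blank := by
  simp [bitTape]

theorem update_bitTape_mid (pre : List Bool) (b b' : Bool) (l : List Bool) :
    Function.update (bitTape (K := K) (pre ++ b :: l)) (pre.length + 1) (bit b') =
      bitTape (pre ++ b' :: l) := by
  funext j
  by_cases h : j = pre.length + 1
  · subst h; simp [bitTape]
  · rw [Function.update_of_ne h]
    cases j with
    | zero => rfl
    | succ j =>
      have hj : j ≠ pre.length := by omega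
      simp only [bitTape]
      rcases lt_or_gt_of_ne hj with h | h
      · simp [List.getElem?_append_left h]
      · rw [List.getElem?_append_right h.le, List.getElem?_append_right h.le]
        obtain ⟨d, hd⟩ : ∃ d, j - pre.length = d + 1 := ⟨j - pre.length - 1, by omega⟩
        simp [hd]

theorem update_bitTape_end (pre : List Bool) (b' : Bool) :
    Function.update (bitTape (K := K) pre) (pre.length + 1) (bit b') = bitTape (pre ++ [b']) := by
  funext j
  by_cases h : j = pre.length + 1
  · subst h; simp [bitTape]
  · rw [Function.update_of_ne h]
    cases j with
    | zero => rfl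
    | succ j =>
      have hj : j ≠ pre.length := by omega
      simp only [bitTape]
      rcases lt_or_gt_of_ne hj with h | h
      · simp [List.getElem?_append_left h]
      · rw [List.getElem?_eq_none (by omega), List.getElem?_eq_none (by simp; omega)]

theorem bitTape_ne_mark (l : List Bool) (j : ℕ) : bitTape (K := K) l (j + 1) ≠ mark := by
  simp only [bitTape]
  cases l[j]? <;> simp

end ParamLog

/-! ### Sweeps of the flowchart machine over its tapes. -/

namespace ParamLog
open TapeSymbol TuringMachine

variable {K : Type} {N : ℕ} {hK : Finite K} {code : K → Instr K} {start : K} {x : List Bool}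
  {B : ℕ}

/-- One step of the flowchart machine that changes one work tape. -/
theorem Path.single {q q' : FlowState K N} {h : ℕ} {w : Fin (N + 1) → ℕ → TapeSymbol K}
    {wh : Fin (N + 1) → ℕ} {o g : List Bool} {d : (flowMachine K hK code start N).Config}
    {r : Fin (N + 1)} {s : TapeSymbol K} {m : Move}
    (hp : (flowMachine K hK code start N).Path x B
      ⟨q', h, Function.update w r (Function.update (w r) (wh r) s),
        Function.update wh r (m.apply (wh r)), o⟩ g d)
    (hB : ∀ i, wh i < B) (hq : q.1 ≠ .coin) (hh : h ≤ x.length + 1)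
    (hd : flowDelta code start q (inputSymbol x h) (fun i => w i (wh i)) =
      some (.single q' (fun i => w i (wh i)) r s m)) :
    (flowMachine K hK code start N).Path x B ⟨q, h, w, wh, o⟩ g d := by
  refine .det _ _ _ _ hB ?_ hd ?_
  · rintro h
    apply hq
    exact congrArg Prod.fst h
  · convert hp using 1
    simp only [Config.perform, Action.single, Config.mk.injEq, Option.toList_none,
      List.append_nil, and_true, true_and]
    refine ⟨by simpa [Move.apply] using hh, ?_, ?_⟩
    · funext i
      by_cases hi : i = r
      · subst hi; simp
      · simp [Function.update_of_ne hi]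
    · funext i
      by_cases hi : i = r
      · subst hi; simp
      · simp [Function.update_of_ne hi, Move.apply]

theorem path_back {r : Fin (N + 1)} {k k' : K} {h : ℕ} {w : Fin (N + 1) → ℕ → TapeSymbol K}
    {o : List Bool} (j : ℕ) (hj : j < B) (hh : h ≤ x.length + 1) (h0 : w r 0 = mark)
    (h1 : ∀ j, w r (j + 1) ≠ mark) :
    (flowMachine K hK code start N).Path x B
      ⟨(.back, r, k, k'), h, w, Function.update (fun _ => 0) r j, o⟩ []
      ⟨(.run, 0, k, k), h, w, fun _ => 0, o⟩ := by
  induction j with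
  | zero =>
    refine Path.single (q' := (.run, 0, k, k)) (r := r) (s := mark) (m := .stay) ?_ ?_ ?_ hh ?_
    · have e1 : Function.update w r (Function.update (w r)
          (Function.update (fun _ => 0) r 0 r) mark) = w := by
        rw [Function.update_self, ← h0, Function.update_eq_self, Function.update_eq_self]
      have e2 : Function.update (Function.update (fun _ => 0) r 0) r
          (Move.stay.apply (Function.update (fun _ => 0) r 0 r)) = fun _ : Fin (N + 1) => 0 := by
        simp [Move.apply]
      rw [e1, e2]
      exact .refl _ fun i => hj
    · intro i; simpa using hj
    · simp
    · simp [flowDelta, h0]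
  | succ j ih =>
    refine Path.single (q' := (.back, r, k, k')) (r := r) (s := w r (j + 1)) (m := .left)
      ?_ ?_ ?_ hh ?_
    · convert ih (by omega) using 2
      · rw [Function.update_self, Function.update_eq_self, Function.update_eq_self]
      · simp [Move.apply]
    · intro i
      by_cases hi : i = r
      · subst hi; simpa using hj
      · rw [Function.update_of_ne hi]; omega
    · simp
    · have := h1 j
      simp only [flowDelta, Function.update_self]

theorem update_lt {r : Fin (N + 1)} {j : ℕ} (hj : j < B) (i : Fin (N + 1)) :
    Function.update (fun _ => 0) r j i < B := by
  by_cases hi : i = r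
  · subst hi; simpa using hj
  · rw [Function.update_of_ne hi]; omega

/-- The work tapes with the given bits. -/
abbrev bitTapes (l : Fin (N + 1) → List Bool) : Fin (N + 1) → ℕ → TapeSymbol K :=
  fun i => bitTape (l i)

theorem update_bitTapes (l : Fin (N + 1) → List Bool) (r : Fin (N + 1)) (m : List Bool) :
    Function.update (bitTapes (K := K) l) r (bitTape m) = bitTapes (Function.update l r m) := by
  funext i
  by_cases hi : i = r
  · subst hi; simp [bitTapes]
  · simp [bitTapes, Function.update_of_ne hi]

theorem path_back_bitTapes {r : Fin (N + 1)} {k k' : K} {h : ℕ} {l : Fin (N + 1) → List Bool}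
    {o : List Bool} (j : ℕ) (hj : j < B) (hh : h ≤ x.length + 1) :
    (flowMachine K hK code start N).Path x B
      ⟨(.back, r, k, k'), h, bitTapes l, Function.update (fun _ => 0) r j, o⟩ []
      ⟨(.run, 0, k, k), h, bitTapes l, fun _ => 0, o⟩ :=
  path_back j hj hh rfl fun _ => bitTape_ne_mark _ _

/-- The induction is over the part `m` of the number to the right of the head. The bits already
passed form `pre`; they have been rewritten, so the tape contents `l` vary along the induction. -/
theorem path_carry {r : Fin (N + 1)} {k k' : K} {h : ℕ} {o : List Bool} (hh : h ≤ x.length + 1)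
    (m : List Bool) : ∀ (pre : List Bool) (l : Fin (N + 1) → List Bool), l r = pre ++ m →
    pre.length + m.length + 1 < B →
    (flowMachine K hK code start N).Path x B
      ⟨(.carry, r, k, k'), h, bitTapes l, Function.update (fun _ => 0) r (pre.length + 1), o⟩ []
      ⟨(.run, 0, k, k), h, bitTapes (Function.update l r (pre ++ bitInc m)), fun _ => 0, o⟩ := by
  induction m with
  | nil =>
    intro pre l hl hB
    simp only [List.append_nil] at hl
    refine Path.single (q' := (.back, r, k, k')) (r := r) (s := bit true) (m := .left) ?_
      (update_lt (by omega)) (by simp) hh ?_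
    · convert path_back_bitTapes (x := x) (B := B) (h := h) (r := r) (k := k) (k' := k')
        (l := Function.update l r (pre ++ [true])) (o := o) pre.length (by omega) hh using 2
      · rw [← update_bitTapes]
        simp [bitTapes, hl, update_bitTape_end]
      · simp [Move.apply]
      · simp [bitInc]
    · simp [flowDelta, bitTapes, hl, bitTape_end]
  | cons b m ih =>
    intro pre l hl hB
    simp only [List.length_cons] at hB
    cases b
    · refine Path.single (q' := (.back, r, k, k')) (r := r) (s := bit true) (m := .left) ?_
        (update_lt (by omega)) (by simp) hh ?_
      · convert path_back_bitTapes (x := x) (B := B) (h := h) (r := r) (k := k) (k' := k')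
          (l := Function.update l r (pre ++ true :: m)) (o := o) pre.length (by omega) hh using 2
        · rw [← update_bitTapes]
          simp [bitTapes, hl, update_bitTape_mid]
        · simp [Move.apply]
        · simp [bitInc]
      · simp [flowDelta, bitTapes, hl, bitTape_mid]
    · refine Path.single (q' := (.carry, r, k, k')) (r := r) (s := bit false) (m := .right) ?_
        (update_lt (by omega)) (by simp) hh ?_
      · convert ih (pre ++ [false]) (Function.update l r (pre ++ false :: m)) (by simp)
          (by simp; omega) using 2
        · rw [← update_bitTapes]
          simp [bitTapes, hl, update_bitTape_mid]
        · simp [Move.apply]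
        · simp [bitInc]
      · simp [flowDelta, bitTapes, hl, bitTape_mid]

theorem path_borrow {r : Fin (N + 1)} {k k' : K} {h : ℕ} {o : List Bool} (hh : h ≤ x.length + 1)
    (m : List Bool) : ∀ (pre : List Bool) (l : Fin (N + 1) → List Bool), l r = pre ++ m →
    pre.length + m.length + 1 < B → bitVal m ≠ 0 →
    (flowMachine K hK code start N).Path x B
      ⟨(.borrow, r, k, k'), h, bitTapes l, Function.update (fun _ => 0) r (pre.length + 1), o⟩ []
      ⟨(.run, 0, k, k), h, bitTapes (Function.update l r (pre ++ bitDec m)), fun _ => 0, o⟩ := by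
  induction m with
  | nil =>
    intro pre l hl hB h
    simp [bitVal] at h
  | cons b m ih =>
    intro pre l hl hB hv
    simp only [List.length_cons] at hB
    cases b
    · refine Path.single (q' := (.borrow, r, k, k')) (r := r) (s := bit true) (m := .right) ?_
        (update_lt (by omega)) (by simp) hh ?_
      · convert ih (pre ++ [true]) (Function.update l r (pre ++ true :: m)) (by simp)
          (by simp; omega) (fun h' => hv (by simp [bitVal, h'])) using 2
        · rw [← update_bitTapes]
          simp [bitTapes, hl, update_bitTape_mid]
        · simp [Move.apply]
        · simp [bitDec]
      · simp [flowDelta, bitTapes, hl, bitTape_mid]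
    · refine Path.single (q' := (.back, r, k, k')) (r := r) (s := bit false) (m := .left) ?_
        (update_lt (by omega)) (by simp) hh ?_
      · convert path_back_bitTapes (x := x) (B := B) (h := h) (r := r) (k := k) (k' := k')
          (l := Function.update l r (pre ++ false :: m)) (o := o) pre.length (by omega) hh using 2
        · rw [← update_bitTapes]
          simp [bitTapes, hl, update_bitTape_mid]
        · simp [Move.apply]
        · simp [bitDec]
      · simp [flowDelta, bitTapes, hl, bitTape_mid]

theorem path_scan {r : Fin (N + 1)} {k1 k0 : K} {h : ℕ} {o : List Bool} (hh : h ≤ x.length + 1)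
    {l : Fin (N + 1) → List Bool} (m : List Bool) : ∀ (pre : List Bool), l r = pre ++ m →
    pre.length + m.length + 1 < B →
    (flowMachine K hK code start N).Path x B
      ⟨(.scan, r, k1, k0), h, bitTapes l, Function.update (fun _ => 0) r (pre.length + 1), o⟩ []
      ⟨(.run, 0, bif decide (bitVal m ≠ 0) then k1 else k0, bif decide (bitVal m ≠ 0) then k1 else k0),
        h, bitTapes l, fun _ => 0, o⟩ := by
  induction m with
  | nil =>
    intro pre hl hB
    simp only [List.append_nil] at hl
    refine Path.single (q' := (.back, r, k0, k0)) (r := r) (s := blank) (m := .left) ?_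
      (update_lt (by omega)) (by simp) hh ?_
    · convert path_back_bitTapes (x := x) (B := B) (h := h) (r := r) (k := k0) (k' := k0)
        (l := l) (o := o) pre.length (by omega) hh using 2
      · have : (blank : TapeSymbol K) = bitTapes l r (pre.length + 1) := by
          simp [bitTapes, hl, bitTape_end]
        rw [Function.update_self, this, Function.update_eq_self, Function.update_eq_self]
      · simp [Move.apply]
      · simp [bitVal]
    · simp [flowDelta, bitTapes, hl, bitTape_end]
  | cons b m ih =>
    intro pre hl hB
    simp only [List.length_cons] at hB
    have hb : (bit b : TapeSymbol K) = bitTapes l r (pre.length + 1) := by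
      simp [bitTapes, hl, bitTape_mid]
    cases b
    · refine Path.single (q' := (.scan, r, k1, k0)) (r := r) (s := bit false) (m := .right) ?_
        (update_lt (by omega)) (by simp) hh ?_
      · convert ih (pre ++ [false]) (by simp [hl]) (by simp; omega) using 2
        · rw [Function.update_self, hb, Function.update_eq_self, Function.update_eq_self]
        · simp [Move.apply]
        · simp [bitVal]
      · simp [flowDelta, bitTapes, hl, bitTape_mid]
    · refine Path.single (q' := (.back, r, k1, k1)) (r := r) (s := bit true) (m := .left) ?_
        (update_lt (by omega)) (by simp) hh ?_
      · convert path_back_bitTapes (x := x) (B := B) (h := h) (r := r) (k := k1) (k' := k1)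
          (l := l) (o := o) pre.length (by omega) hh using 2
        · rw [Function.update_self, hb, Function.update_eq_self, Function.update_eq_self]
        · simp [Move.apply]
        · simp [bitVal]
      · simp [flowDelta, bitTapes, hl, bitTape_mid]

end ParamLog

/-! ### Simulation of counter programs by the flowchart machine. -/

namespace ParamLog
open TapeSymbol TuringMachine

variable {K : Type} {N : ℕ} {hK : Finite K} {code : K → Instr K} {start : K} {x : List Bool}
  {V : ℕ}

/-- The tapes hold the registers of a memory whose values never exceeded `V`. -/
def Holds (V : ℕ) (σ : Mem) (l : Fin (N + 1) → List Bool) : Prop :=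
  ∀ i : Fin (N + 1), bitVal (l i) = σ.reg i ∧ (l i).length ≤ V.size

/-- The configuration of the flowchart machine at a label. -/
abbrev atLabel (hK : Finite K) (code : K → Instr K) (start : K) (k : K) (h : ℕ)
    (l : Fin (N + 1) → List Bool) (o : List Bool) : (flowMachine K hK code start N).Config :=
  ⟨(.run, 0, k, k), h, bitTapes l, fun _ => 0, o⟩

/-- Execution of the flowchart from label to label. -/
def Sim (hK : Finite K) (code : K → Instr K) (start : K) (N : ℕ) (x : List Bool) (V : ℕ)
    (k : K) (σ : Mem) (g : List Bool) (k' : K) (σ' : Mem) : Prop :=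
  ∀ l : Fin (N + 1) → List Bool, Holds V σ l → σ.head ≤ x.length + 1 →
    σ'.head ≤ x.length + 1 ∧ ∃ l', Holds V σ' l' ∧
      -- Cell `0` carries the mark, at most `V.size` cells carry bits, and a sweep may stop on the
      -- blank cell behind them.
      (flowMachine K hK code start N).Path x (V.size + 2) (atLabel hK code start k σ.head l σ.out) g
        (atLabel hK code start k' σ'.head l' σ'.out)

theorem Sim.trans {k k' k'' : K} {σ σ' σ'' : Mem} {g g' : List Bool}
    (h : Sim hK code start N x V k σ g k' σ') (h' : Sim hK code start N x V k' σ' g' k'' σ'') :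
    Sim hK code start N x V k σ (g ++ g') k'' σ'' := by
  intro l hl hh
  obtain ⟨h1, l1, hl1, p1⟩ := h l hl hh
  obtain ⟨h2, l2, hl2, p2⟩ := h' l1 hl1 h1
  exact ⟨h2, l2, hl2, p1.trans p2⟩

theorem ofNat_val {r : ℕ} (hr : r ≤ N) : ((Fin.ofNat (N + 1) r : Fin (N + 1)) : ℕ) = r :=
  Nat.mod_eq_of_lt (by omega)

theorem Holds.update {σ : Mem} {l : Fin (N + 1) → List Bool} (h : Holds V σ l) {r : ℕ}
    (hr : r ≤ N) {v : ℕ} {m : List Bool} (hv : bitVal m = v) (hm : m.length ≤ V.size) :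
    Holds V (σ.set r v) (Function.update l (Fin.ofNat (N + 1) r) m) := by
  intro i
  by_cases hi : i = Fin.ofNat (N + 1) r
  · subst hi
    rw [Function.update_self, ofNat_val hr, hv]
    exact ⟨(Function.update_self r v σ.reg).symm, hm⟩
  · have : (i : ℕ) ≠ r := fun h' => hi (Fin.ext (by rw [ofNat_val hr, h']))
    rw [Function.update_of_ne hi, Mem.set]
    simpa only [Function.update_of_ne this] using h i

theorem update_mark (l : Fin (N + 1) → List Bool) (r : Fin (N + 1)) :
    Function.update (bitTapes (K := K) l) r
      (Function.update (bitTapes (K := K) l r) 0 mark) = bitTapes l := by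
  have : (mark : TapeSymbol K) = bitTapes l r 0 := rfl
  rw [this, Function.update_eq_self, Function.update_eq_self]

theorem sim_inc {k k' : K} {r : ℕ} {σ : Mem} (hk : code k = .inc r k') (hr : r ≤ N)
    (hV : σ.reg r + 1 ≤ V) :
    Sim hK code start N x V k σ [] k' (σ.set r (σ.reg r + 1)) := by
  intro l hl hh
  have h0 := hl (Fin.ofNat (N + 1) r)
  rw [ofNat_val hr] at h0
  refine ⟨hh, Function.update l (Fin.ofNat (N + 1) r) (bitInc (l (Fin.ofNat (N + 1) r))),
    hl.update hr (by rw [bitVal_bitInc, h0.1]) (length_bitInc _ h0.2 (by rw [h0.1]; exact hV)), ?_⟩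
  refine Path.single (q' := (.carry, Fin.ofNat (N + 1) r, k', k')) (r := Fin.ofNat (N + 1) r)
    (s := mark) (m := .right) ?_ (fun _ => by omega) (by simp) hh ?_
  · rw [update_mark]
    exact path_carry (k := k') (k' := k') hh (l (Fin.ofNat (N + 1) r)) [] l rfl
      (by simp only [List.length_nil]; omega)
  · simp [flowDelta, hk]

theorem sim_dec {k k' : K} {r : ℕ} {σ : Mem} (hk : code k = .dec r k') (hr : r ≤ N)
    (hV : σ.reg r ≠ 0) :
    Sim hK code start N x V k σ [] k' (σ.set r (σ.reg r - 1)) := by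
  intro l hl hh
  have h0 := hl (Fin.ofNat (N + 1) r)
  rw [ofNat_val hr] at h0
  refine ⟨hh, Function.update l (Fin.ofNat (N + 1) r) (bitDec (l (Fin.ofNat (N + 1) r))),
    hl.update hr (by rw [bitVal_bitDec _ (by rw [h0.1]; exact hV), h0.1])
      (by rw [length_bitDec]; exact h0.2), ?_⟩
  refine Path.single (q' := (.borrow, Fin.ofNat (N + 1) r, k', k')) (r := Fin.ofNat (N + 1) r)
    (s := mark) (m := .right) ?_ (fun _ => by omega) (by simp) hh ?_
  · rw [update_mark]
    exact path_borrow (k := k') (k' := k') hh (l (Fin.ofNat (N + 1) r)) [] l rfl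
      (by simp only [List.length_nil]; omega) (by rw [h0.1]; exact hV)
  · simp [flowDelta, hk]

theorem Path.simple {q q' : FlowState K N} {h : ℕ} {w : Fin (N + 1) → ℕ → TapeSymbol K}
    {o g : List Bool} {d : (flowMachine K hK code start N).Config}
    {m : Move} {ob : Option Bool} {B : ℕ}
    (hp : (flowMachine K hK code start N).Path x B
      ⟨q', min (m.apply h) (x.length + 1), w, fun _ => 0, o ++ ob.toList⟩ g d)
    (hB : 0 < B) (hq : q.1 ≠ .coin)
    (hd : flowDelta code start q (inputSymbol x h) (fun i => w i 0) =
      some ⟨q', m, fun i => w i 0, fun _ => .stay, ob⟩) :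
    (flowMachine K hK code start N).Path x B ⟨q, h, w, fun _ => 0, o⟩ g d := by
  refine .det _ _ _ _ (fun _ => hB) ?_ hd ?_
  · rintro h
    apply hq
    exact congrArg Prod.fst h
  · convert hp using 1
    simp [Config.perform, Move.apply]

theorem sim_move {k k' : K} {m : Move} {σ : Mem} (hk : code k = .move m k') :
    Sim hK code start N x V k σ [] k'
      { σ with head := min (m.apply σ.head) (x.length + 1) } := by
  intro l hl hh
  refine ⟨min_le_right _ _, l, hl, ?_⟩
  refine Path.simple (q' := (.run, 0, k', k')) (m := m) (ob := none) ?_ (by omega) (by simp) ?_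
  · rw [Option.toList_none, List.append_nil]
    exact .refl _ fun _ => by simp
  · simp [flowDelta, hk]

theorem sim_emit {k k' : K} {b : Bool} {σ : Mem} (hk : code k = .emit b k') :
    Sim hK code start N x V k σ [] k' { σ with out := σ.out ++ [b] } := by
  intro l hl hh
  refine ⟨hh, l, hl, ?_⟩
  refine Path.simple (q' := (.run, 0, k', k')) (m := .stay) (ob := some b) ?_ (by omega)
    (by simp) ?_
  · simp only [Move.apply, min_eq_left hh]
    exact .refl _ fun _ => by simp
  · simp [flowDelta, hk]

theorem sim_test {k k1 k0 : K} {t : Test} {σ : Mem} {g : List Bool} {b : Bool}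
    (hk : code k = .test t k1 k0) (ht : ∀ r, t = .reg r → r ≤ N) (he : TestEv x σ t g b) :
    Sim hK code start N x V k σ g (bif b then k1 else k0) σ := by
  intro l hl hh
  refine ⟨hh, l, hl, ?_⟩
  cases he with
  | reg r =>
    have hr := ht r rfl
    have h0 := hl (Fin.ofNat (N + 1) r)
    rw [ofNat_val hr] at h0
    refine Path.single (q' := (.scan, Fin.ofNat (N + 1) r, k1, k0)) (r := Fin.ofNat (N + 1) r)
      (s := mark) (m := .right) ?_ (fun _ => by omega) (by simp) hh ?_
    · rw [update_mark, ← h0.1]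
      exact path_scan (k1 := k1) (k0 := k0) hh (l (Fin.ofNat (N + 1) r)) [] rfl
        (by simp only [List.length_nil]; omega)
    · simp [flowDelta, hk]
  | inp f =>
    refine Path.simple (q' := (.run, 0, bif f (inputSymbol x σ.head) then k1 else k0,
      bif f (inputSymbol x σ.head) then k1 else k0)) (m := .stay) (ob := none) ?_ (by omega)
      (by simp) ?_
    · rw [Option.toList_none, List.append_nil, Move.apply, min_eq_left hh]
      exact .refl _ fun _ => by simp
    · simp [flowDelta, hk]
  | coin b =>
    refine Path.single (q' := (.coin, 0, start, start)) (r := 0)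
      (s := lab k1 k0) (m := .stay) ?_ (fun _ => by omega) (by simp) hh ?_
    · refine .guess _ _ _ _ ?_ rfl ?_
      · intro i; simp [Move.apply]
      · refine Path.single (q' := (.run, 0, bif b then k1 else k0, bif b then k1 else k0)) (r := 0)
          (s := mark) (m := .stay) ?_ ?_ ?_ hh ?_
        -- The two labels written for the guess state have been overwritten by the mark again, so
        -- the tapes are unchanged.
        · have e1 : Function.update (Function.update (bitTapes (K := K) l) 0
              (Function.update (bitTapes (K := K) l 0) 0 (lab k1 k0))) 0 (Function.update
              (Function.update (bitTapes (K := K) l) 0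
              (Function.update (bitTapes (K := K) l 0) 0 (lab k1 k0)) 0) 0 mark) = bitTapes l := by
            rw [Function.update_self, Function.update_idem, Function.update_idem, update_mark]
          have e2 : Function.update (fun _ : Fin (N + 1) => 0) 0 0 = fun _ => 0 := by simp
          simp only [Move.apply]
          rw [e2, e1, e2]
          exact .refl _ fun _ => by simp
        · intro i; simp [Move.apply]
        · cases b <;> simp
        · cases b <;> simp [flowDelta, Move.apply]
    · simp [flowDelta, hk]

/-- The induction is over the execution and not over the program: after one pass through the body a
loop is at its own test label, with the same `emb` and `exit`. These two are arbitrary because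
subprograms live inside a larger flowchart. -/
theorem Ev.sim {p : Prog} {σ σ' : Mem} {g : List Bool} (h : Ev x V p σ g σ') :
    ∀ (emb : Lab p → K) (exit : K), p.top ≤ N → (∀ l, code (emb l) = p.instr emb exit l) →
      Sim hK code start N x V (emb p.entry) σ g exit σ' := by
  induction h with
  | inc r σ hV => exact fun emb exit hN hc => sim_inc (hc ()) hN hV
  | dec r σ hV => exact fun emb exit hN hc => sim_dec (hc ()) hN hV
  | move m σ => exact fun emb exit hN hc => sim_move (hc ())
  | emit b σ => exact fun emb exit hN hc => sim_emit (hc ())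
  | @seq p q σ σ' σ'' g g' _ _ ih1 ih2 =>
    intro emb exit hN hc
    simp only [Prog.top, max_le_iff] at hN
    exact (ih1 (fun l => emb (Sum.inl l)) _ hN.1 fun l => hc (Sum.inl l)).trans
      (ih2 (fun l => emb (Sum.inr l)) exit hN.2 fun l => hc (Sum.inr l))
  | @ite t p q σ σ' g g' b ht _ ih =>
    intro emb exit hN hc
    have hN' : p.top ≤ N ∧ q.top ≤ N ∧ ∀ r, t = .reg r → r ≤ N := by
      cases t <;> simp_all [Prog.top]
    refine (sim_test (hc none) hN'.2.2 ht).trans ?_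
    cases b
    · exact ih (fun l => emb (some (Sum.inr l))) exit hN'.2.1 fun l => hc (some (Sum.inr l))
    · exact ih (fun l => emb (some (Sum.inl l))) exit hN'.1 fun l => hc (some (Sum.inl l))
  | @loop_false t p σ g ht =>
    intro emb exit hN hc
    have hN' : ∀ r, t = .reg r → r ≤ N := by
      cases t <;> simp_all [Prog.top]
    exact sim_test (hc none) hN' ht
  | @loop_true t p σ σ' σ'' g g' g'' ht _ _ ih1 ih2 =>
    intro emb exit hN hc
    have hN' : p.top ≤ N ∧ ∀ r, t = .reg r → r ≤ N := by
      cases t <;> simp_all [Prog.top]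
    exact (sim_test (hc none) hN'.2 ht).trans
      ((ih1 (fun l => emb (some l)) _ hN'.1 fun l => hc (some l)).trans (ih2 emb exit hN hc))

theorem TuringMachine.Path.unique {M : TuringMachine} {B : ℕ} {c d e : M.Config} {g : List Bool}
    (h : M.Path x B c g d) (hd : M.Halted x d) (h' : M.Path x B c g e) (he : M.Halted x e) :
    d = e := by
  induction h with
  | refl c => exact (h'.eq_of_halted hd).2.symm
  | det c d g a _ hs ha _ ih =>
    cases h' with
    | refl => exact absurd (Step.det e a hs ha) (he _)
    | det _ _ _ a' _ _ ha' hp =>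
      rw [ha] at ha'
      cases ha'
      exact ih hd hp
    | guess _ _ _ b _ h => exact absurd h hs
  | guess c d g b _ hs _ ih =>
    cases h' with
    | det _ _ _ a' _ h' _ hp => exact absurd hs h'
    | guess _ _ _ _ _ _ hp => exact ih hd hp

/-- The flowchart of a program that finally accepts if a register is not zero. -/
def progCode (p : Prog) (acc : ℕ) : Lab p ⊕ Fin 3 → Instr (Lab p ⊕ Fin 3)
  | .inl l => p.instr Sum.inl (.inr 0) l
  | .inr 0 => .test (.reg acc) (.inr 1) (.inr 2)
  | .inr 1 => .halt true
  | .inr 2 => .halt false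

def Mem.init : Mem := ⟨fun _ => 0, 0, []⟩

/-- A machine that executes a program and accepts if finally a given register is not zero. -/
theorem exists_machine (p : Prog) (acc : ℕ) : ∃ M : TuringMachine, ∀ x V T,
    (∀ g : List Bool, g.length = T → ∃ σ', Ev x V p Mem.init g σ') →
    M.RunsInSpace x (V.size + 2) ∧ M.UsesNondetBits x T ∧
      (M.Accepts x ↔ ∃ g σ', g.length = T ∧ Ev x V p Mem.init g σ' ∧ σ'.reg acc ≠ 0) ∧
      ∀ g σ', g.length = T → Ev x V p Mem.init g σ' → M.Outputs x σ'.out := by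
  have hL := finite_lab p
  have hK : Finite (Lab p ⊕ Fin 3) := inferInstance
  set N := max p.top acc with hN
  set start : Lab p ⊕ Fin 3 := Sum.inl p.entry with hstart
  set M := flowMachine (Lab p ⊕ Fin 3) hK (progCode p acc) start N with hM
  refine ⟨M, fun x V T h => ?_⟩
  have key : ∀ g σ', Ev x V p Mem.init g σ' → ∃ c, M.Path x (V.size + 2) M.init g c ∧
      M.Halted x c ∧ (c.state = M.accept ↔ σ'.reg acc ≠ 0) ∧ c.output = σ'.out := by
    intro g σ' he
    have h1 := he.sim (hK := hK) (code := progCode p acc) (start := start)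
      (N := N) Sum.inl (Sum.inr 0) (le_max_left _ _) fun l => rfl
    have h2 := h1.trans (sim_test (k := Sum.inr 0) (k1 := Sum.inr 1) (k0 := Sum.inr 2)
      (t := .reg acc) rfl (by rintro r ⟨⟩; exact le_max_right _ _) (TestEv.reg acc))
    rw [List.append_nil] at h2
    obtain ⟨h3, l, hl, hp⟩ := h2 (fun _ => []) (by intro i; simp [bitVal, Mem.init])
      (by simp [Mem.init])
    obtain ⟨b, hb⟩ : ∃ b, b = decide (σ'.reg acc ≠ 0) := ⟨_, rfl⟩
    rw [← hb] at hp
    have hlast : M.Path x (V.size + 2) (atLabel hK (progCode p acc) start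
        (bif b then Sum.inr 1 else Sum.inr 2) σ'.head l σ'.out) []
        ⟨(bif b then .acc else .rej, 0, start, start), σ'.head, bitTapes l,
          fun _ => 0, σ'.out⟩ := by
      refine Path.simple (q' := (bif b then .acc else .rej, 0, start, start))
        (m := .stay) (ob := none) ?_ (by omega) (by simp) ?_
      · rw [Option.toList_none, List.append_nil, Move.apply, min_eq_left h3]
        exact .refl _ fun _ => by simp
      · cases b <;> simp [flowDelta, progCode]
    -- The boot step marks cell `0` of each tape. A marked tape without bits represents the number
    -- zero.
    have hfirst : M.Path x (V.size + 2) M.init [] (atLabel hK (progCode p acc) start start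
        Mem.init.head (fun _ => []) Mem.init.out) := by
      refine .det _ _ _ ⟨(.run, 0, start, start), .stay, fun _ => mark, fun _ => .stay, none⟩
        (fun _ => by simp [TuringMachine.init]) (fun h => ?_) rfl ?_
      · have := congrArg Prod.fst h
        simp [TuringMachine.init] at this
      · convert TuringMachine.Path.refl _ _ using 1
        · simp only [Config.perform, TuringMachine.init, Move.apply, Option.toList_none,
            List.append_nil, atLabel, Mem.init, Nat.zero_le, min_eq_left, Config.mk.injEq,
            and_true, true_and]
          refine ⟨?_, rfl⟩
          funext i j
          cases j with
          | zero => simp [bitTape]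
          | succ j => simp [bitTape]; rfl
        · simp [TuringMachine.init, Config.perform, Move.apply]
    refine ⟨_, by simpa using hfirst.trans (hp.trans hlast), ?_, ?_, rfl⟩
    · intro c hc
      cases hc with
      | guess0 h =>
        have := congrArg Prod.fst h
        change _ = Phase.coin at this
        cases b <;> simp at this
      | guess1 h =>
        have := congrArg Prod.fst h
        change _ = Phase.coin at this
        cases b <;> simp at this
      | det a _ ha =>
        cases b
        · change none = some a at ha
          simp at ha
        · change none = some a at ha
          simp at ha
    · change (_, (0 : Fin (N + 1)), start, start) = (Phase.acc, (0 : Fin (N + 1)), start, start) ↔ _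
      cases b <;> simp_all
  have hT : ∀ g : List Bool, g.length = T →
      ∃ c', M.Path x (V.size + 2) M.init g c' ∧ M.Halted x c' := fun g hg => by
    obtain ⟨σ', he⟩ := h g hg
    obtain ⟨c, h1, h2, -⟩ := key g σ' he
    exact ⟨c, h1, h2⟩
  refine ⟨runsInSpace_of_paths hT, usesNondetBits_of_paths hT, ?_, fun g σ' hg he => ?_⟩
  · rw [accepts_iff_of_paths hT]
    constructor
    · rintro ⟨g, c, hg, hp, hh, ha⟩
      obtain ⟨σ', he⟩ := h g hg
      obtain ⟨c', h1, h2, h3, -⟩ := key g σ' he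
      obtain rfl := hp.unique hh h1 h2
      exact ⟨g, σ', hg, he, h3.1 ha⟩
    · rintro ⟨g, σ', hg, he, ha⟩
      obtain ⟨c', h1, h2, h3, -⟩ := key g σ' he
      exact ⟨g, c', hg, h1, h2, h3.2 ha⟩
  · obtain ⟨c', h1, h2, h3, h4⟩ := key g σ' he
    rw [← h4]
    exact h1.outputs h2

end ParamLog

namespace ParamLog

variable {x : List Bool} {V : ℕ}

/-! ## Counter programs for functions -/

theorem Ev.mono {V' : ℕ} {p : Prog} {σ σ' : Mem} {g : List Bool} (h : Ev x V p σ g σ')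
    (hV : V ≤ V') : Ev x V' p σ g σ' := by
  induction h with
  | inc r σ h => exact .inc r σ (h.trans hV)
  | dec r σ h => exact .dec r σ h
  | move m σ => exact .move m σ
  | emit b σ => exact .emit b σ
  | seq _ _ ih1 ih2 => exact .seq ih1 ih2
  | ite ht _ ih => exact .ite ht ih
  | loop_false ht => exact .loop_false ht
  | loop_true ht _ _ ih1 ih2 => exact .loop_true ht ih1 ih2

theorem Ev.seq' {p q : Prog} {σ σ' σ'' : Mem} {g : List Bool} (h : Ev x V p σ [] σ')
    (h' : Ev x V q σ' g σ'') : Ev x V (.seq p q) σ g σ'' := .seq h h'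

@[simp] theorem Mem.set_reg_self (σ : Mem) (r v : ℕ) : (σ.set r v).reg r = v := by
  simp [Mem.set]

theorem Mem.set_reg_of_ne (σ : Mem) {r r' : ℕ} (v : ℕ) (h : r' ≠ r) :
    (σ.set r v).reg r' = σ.reg r' := by
  simp [Mem.set, h]

@[simp] theorem Mem.set_out (σ : Mem) (r v : ℕ) : (σ.set r v).out = σ.out := rfl

@[simp] theorem Mem.set_head (σ : Mem) (r v : ℕ) : (σ.set r v).head = σ.head := rfl

/-- Run the body as often as the register says, counting it down. -/
def Prog.for (r : ℕ) (p : Prog) : Prog := .loop (.reg r) (.seq (.dec r) p)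

/-- The invariant is indexed by the guess words that the remaining iterations will consume, one word
for each iteration; the loop register holds the number of these words. -/
theorem ev_for_guess {r : ℕ} {p : Prog} (I : List (List Bool) → Mem → Prop)
    (hr : ∀ gs σ, I gs σ → σ.reg r = gs.length)
    (hs : ∀ g gs σ, I (g :: gs) σ → ∃ σ', Ev x V p (σ.set r gs.length) g σ' ∧ I gs σ')
    (gs : List (List Bool)) (σ : Mem) (h : I gs σ) :
    ∃ σ', Ev x V (.for r p) σ gs.flatten σ' ∧ I [] σ' := by
  induction gs generalizing σ with
  | nil =>
    refine ⟨σ, .loop_false ?_, h⟩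
    have := TestEv.reg (x := x) (σ := σ) r
    rw [hr _ _ h] at this
    simpa using this
  | cons g gs ih =>
    obtain ⟨σ', h1, h2⟩ := hs g gs σ h
    obtain ⟨σ'', h3, h4⟩ := ih σ' h2
    refine ⟨σ'', ?_, h4⟩
    have ht := TestEv.reg (x := x) (σ := σ) r
    have hrr := hr _ _ h
    rw [hrr] at ht
    have hd := Ev.dec (x := x) (V := V) r σ (by simp [hrr])
    rw [hrr] at hd
    exact .loop_true (by simpa using ht) (.seq' hd h1) h3

theorem ev_for {r : ℕ} {p : Prog} (I : ℕ → Mem → Prop)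
    (hr : ∀ k σ, I k σ → σ.reg r = k)
    (hs : ∀ k σ, I (k + 1) σ → ∃ σ', Ev x V p (σ.set r k) [] σ' ∧ I k σ')
    (k : ℕ) (σ : Mem) (h : I k σ) :
    ∃ σ', Ev x V (.for r p) σ [] σ' ∧ I 0 σ' := by
  obtain ⟨σ', h1, h2⟩ := ev_for_guess (x := x) (V := V) (r := r) (p := p)
    (fun gs σ => I gs.length σ ∧ ∀ g ∈ gs, g = []) (fun gs σ h => hr _ _ h.1)
    (fun g gs σ h => by
      obtain rfl : g = [] := h.2 g (by simp)
      obtain ⟨σ', h1, h2⟩ := hs _ _ h.1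
      exact ⟨σ', h1, h2, fun g hg => h.2 g (by simp [hg])⟩)
    (List.replicate k []) σ (by simpa using h)
  exact ⟨σ', by simpa using h1, h2.1⟩

/-- A move truncates the head position to the input tape, so this is the identity only on memories
whose head is in range. -/
def Prog.skip : Prog := .move .stay

theorem ev_skip (σ : Mem) : Ev x V .skip σ [] { σ with head := min σ.head (x.length + 1) } :=
  .move .stay σ

def Prog.clear (r : ℕ) : Prog := .loop (.reg r) (.dec r)

theorem ev_clear (r : ℕ) (σ : Mem) : Ev x V (.clear r) σ [] (σ.set r 0) := by
  obtain ⟨k, hk⟩ : ∃ k, k = σ.reg r := ⟨_, rfl⟩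
  have ht := TestEv.reg (x := x) (σ := σ) r
  induction k generalizing σ with
  | zero =>
    have : σ.set r 0 = σ := by simp [Mem.set, hk]
    rw [this]
    exact .loop_false (by simpa [← hk] using ht)
  | succ k ih =>
    have h1 := ih (σ.set r k) (by simp) (by simpa using TestEv.reg (x := x) (σ := σ.set r k) r)
    have hd := Ev.dec (x := x) (V := V) r σ (by simp [← hk])
    rw [← hk] at hd
    have : (σ.set r k).set r 0 = σ.set r 0 := by simp [Mem.set]
    rw [this] at h1
    exact .loop_true (g := []) (by simpa [← hk] using ht) hd h1

/-- The program stores `y` in the register `out`, without changing other registers below `base`. -/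
def Does (x : List Bool) (V : ℕ) (p : Prog) (σ : Mem) (out base y : ℕ) : Prop :=
  ∃ σ', Ev x V p σ [] σ' ∧ σ'.reg out = y ∧ (∀ r < base, r ≠ out → σ'.reg r = σ.reg r) ∧
    σ'.out = σ.out

/-- A counter can be read only by counting it down. The value is moved to both `dst` and `tmp`, and
then `src` is restored from `tmp`. -/
def Prog.copy (src dst tmp : ℕ) : Prog :=
  .seq (.clear dst) (.seq (.clear tmp)
    (.seq (.for src (.seq (.inc dst) (.inc tmp))) (.for tmp (.inc src))))

theorem ev_copy {src dst tmp : ℕ} (h1 : src ≠ dst) (h2 : src ≠ tmp) (h3 : dst ≠ tmp) (σ : Mem)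
    (hV : σ.reg src ≤ V) : ∃ σ', Ev x V (.copy src dst tmp) σ [] σ' ∧ σ'.reg dst = σ.reg src ∧
      (∀ r, r ≠ dst → r ≠ tmp → σ'.reg r = σ.reg r) ∧ σ'.out = σ.out := by
  set v := σ.reg src with hv
  obtain ⟨τ, e1, i1⟩ := ev_for (x := x) (V := V) (r := src) (p := .seq (.inc dst) (.inc tmp))
    (fun k τ => k ≤ v ∧ τ.reg src = k ∧ τ.reg dst = v - k ∧ τ.reg tmp = v - k ∧
      (∀ r, r ≠ src → r ≠ dst → r ≠ tmp → τ.reg r = σ.reg r) ∧ τ.out = σ.out)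
    (fun k τ h => h.2.1)
    (fun k τ ⟨a1, a2, a3, a4, a5, a6⟩ => by
      refine ⟨_, .seq' (.inc _ _ ?_) (.inc _ _ ?_), ?_, ?_, ?_, ?_, ?_, ?_⟩
      · rw [Mem.set_reg_of_ne _ _ h1.symm]; omega
      · rw [Mem.set_reg_of_ne _ _ h3.symm, Mem.set_reg_of_ne _ _ h2.symm]; omega
      · omega
      · rw [Mem.set_reg_of_ne _ _ h2, Mem.set_reg_of_ne _ _ h1, Mem.set_reg_self]
      · rw [Mem.set_reg_of_ne _ _ h3, Mem.set_reg_self, Mem.set_reg_of_ne _ _ h1.symm]; omega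
      · rw [Mem.set_reg_self, Mem.set_reg_of_ne _ _ h3.symm, Mem.set_reg_of_ne _ _ h2.symm]; omega
      · intro r b1 b2 b3
        rw [Mem.set_reg_of_ne _ _ b3, Mem.set_reg_of_ne _ _ b2, Mem.set_reg_of_ne _ _ b1,
          a5 r b1 b2 b3]
      · simpa using a6)
    v ((σ.set dst 0).set tmp 0) ⟨le_rfl, by
      rw [Mem.set_reg_of_ne _ _ h2, Mem.set_reg_of_ne _ _ h1], by
      rw [Mem.set_reg_of_ne _ _ h3]; simp, by simp, fun r b1 b2 b3 => by
        rw [Mem.set_reg_of_ne _ _ b3, Mem.set_reg_of_ne _ _ b2], rfl⟩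
  obtain ⟨i1, i2, i3, i4, i5, i6⟩ := i1
  obtain ⟨τ', e2, j⟩ := ev_for (x := x) (V := V) (r := tmp) (p := .inc src)
    (fun k τ => k ≤ v ∧ τ.reg tmp = k ∧ τ.reg src = v - k ∧ τ.reg dst = v ∧
      (∀ r, r ≠ src → r ≠ dst → r ≠ tmp → τ.reg r = σ.reg r) ∧ τ.out = σ.out)
    (fun k τ h => h.2.1)
    (fun k τ ⟨a1, a2, a3, a4, a5, a6⟩ => by
      refine ⟨_, .inc _ _ ?_, ?_, ?_, ?_, ?_, ?_, ?_⟩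
      · rw [Mem.set_reg_of_ne _ _ h2]; omega
      · omega
      · rw [Mem.set_reg_of_ne _ _ h2.symm, Mem.set_reg_self]
      · rw [Mem.set_reg_self, Mem.set_reg_of_ne _ _ h2]; omega
      · rw [Mem.set_reg_of_ne _ _ h1.symm, Mem.set_reg_of_ne _ _ h3, a4]
      · intro r b1 b2 b3
        rw [Mem.set_reg_of_ne _ _ b1, Mem.set_reg_of_ne _ _ b3, a5 r b1 b2 b3]
      · simpa using a6)
    v τ ⟨le_rfl, by omega, by omega, by omega, i5, i6⟩
  obtain ⟨j1, j2, j3, j4, j5, j6⟩ := j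
  refine ⟨τ', .seq' (ev_clear _ _) (.seq' (ev_clear _ _) (.seq' e1 e2)), j4, fun r b2 b3 => ?_, j6⟩
  by_cases hr : r = src
  · subst hr; omega
  · exact j5 r hr b2 b3

/-- There is a program for the relation `D`: `D x v y V` means that for the input `x` and the
arguments `v` the value is `y`, and `V` is large enough for all counters. -/
def Sem {n : ℕ} (D : List Bool → (Fin n → ℕ) → ℕ → ℕ → Prop) : Prop :=
  ∃ P : (Fin n → ℕ) → ℕ → ℕ → Prog, ∀ ins out base, (∀ i, ins i < base) → out < base →
    (∀ i, ins i ≠ out) → ∀ x y V σ, D x (fun i => σ.reg (ins i)) y V →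
      Does x V (P ins out base) σ out base y

theorem Sem.mono {n : ℕ} {D D' : List Bool → (Fin n → ℕ) → ℕ → ℕ → Prop} (h : Sem D)
    (h' : ∀ x v y V, D' x v y V → ∃ V' ≤ V, D x v y V') : Sem D' := by
  obtain ⟨P, hP⟩ := h
  refine ⟨P, fun ins out base h1 h2 h3 x y V σ h4 => ?_⟩
  obtain ⟨V', hV, h5⟩ := h' _ _ _ _ h4
  obtain ⟨σ', e, h6⟩ := hP ins out base h1 h2 h3 x y V' σ h5
  exact ⟨σ', e.mono hV, h6⟩

theorem sem_zero {n : ℕ} : Sem (n := n) fun _ _ y _ => y = 0 := by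
  refine ⟨fun _ out _ => .clear out, fun ins out base h1 h2 h3 x y V σ h4 =>
    ⟨_, ev_clear _ _, by simp [h4], fun r _ hr => Mem.set_reg_of_ne _ _ hr, rfl⟩⟩

theorem sem_proj {n : ℕ} (i : Fin n) : Sem (n := n) fun _ v y V => y = v i ∧ v i ≤ V := by
  refine ⟨fun ins out base => .copy (ins i) out base,
    fun ins out base h1 h2 h3 x y V σ ⟨h4, h5⟩ => ?_⟩
  obtain ⟨σ', e, a1, a2, a3⟩ := ev_copy (x := x) (h3 i) (h1 i).ne h2.ne σ h5
  exact ⟨σ', e, by rw [a1, h4], fun r hr hr' => a2 r hr' hr.ne, a3⟩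

theorem sem_succ : Sem (n := 1) fun _ v y V => y = v 0 + 1 ∧ v 0 + 1 ≤ V := by
  refine ⟨fun ins out base => .seq (.copy (ins 0) out base) (.inc out),
    fun ins out base h1 h2 h3 x y V σ ⟨h4, h5⟩ => ?_⟩
  obtain ⟨σ', e, a1, a2, a3⟩ := ev_copy (x := x) (V := V) (h3 0) (h1 0).ne h2.ne σ
    (by dsimp only at h5; omega)
  refine ⟨_, .seq' e (.inc _ _ (by rw [a1]; exact h5)), by rw [Mem.set_reg_self, a1, h4], fun r hr hr' => ?_, a3⟩
  rw [Mem.set_reg_of_ne _ _ hr', a2 r hr' hr.ne]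

def Prog.seqN (f : ℕ → Prog) : ℕ → Prog
  | 0 => .skip
  | j + 1 => .seq (seqN f j) (f j)

/-- The inner values are kept in the registers from `base` to `base + m - 1`. All subprograms work
above `base + m` and leave these registers alone. -/
theorem Sem.comp {m n : ℕ} {D : List Bool → (Fin m → ℕ) → ℕ → ℕ → Prop}
    {E : Fin m → List Bool → (Fin n → ℕ) → ℕ → ℕ → Prop} (hD : Sem D) (hE : ∀ i, Sem (E i)) :
    Sem fun x v y V => ∃ w, (∀ i, E i x v (w i) V) ∧ D x w y V := by
  obtain ⟨P, hP⟩ := hD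
  choose Q hQ using hE
  refine ⟨fun ins out base => .seq
    (.seqN (fun j => if h : j < m then Q ⟨j, h⟩ ins (base + j) (base + m) else .skip) m)
    (P (fun i => base + i) out (base + m)),
    fun ins out base h1 h2 h3 x y V σ ⟨w, h4, h5⟩ => ?_⟩
  have key : ∀ j ≤ m, ∃ σ', Ev x V (.seqN (fun j => if h : j < m then
      Q ⟨j, h⟩ ins (base + j) (base + m) else .skip) j) σ [] σ' ∧
      (∀ i : Fin m, (i : ℕ) < j → σ'.reg (base + i) = w i) ∧
      (∀ r < base, σ'.reg r = σ.reg r) ∧ σ'.out = σ.out := by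
    intro j hj
    induction j with
    | zero => exact ⟨_, ev_skip _, by simp, fun _ _ => rfl, rfl⟩
    | succ j ih =>
      obtain ⟨σ', e, a1, a2, a3⟩ := ih (by omega)
      have hv : (fun i => σ'.reg (ins i)) = fun i => σ.reg (ins i) :=
        funext fun i => a2 _ (h1 i)
      obtain ⟨σ'', e', b1, b2, b3⟩ := hQ ⟨j, hj⟩ ins (base + j) (base + m)
        (fun i => (h1 i).trans_le (by omega)) (by omega) (fun i => by have := h1 i; omega)
        x (w ⟨j, hj⟩) V σ' (by rw [hv]; exact h4 _)
      refine ⟨σ'', .seq' e ?_, fun i hi => ?_, fun r hr => ?_, b3.trans a3⟩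
      · simpa only [show j < m from hj, dif_pos] using e'
      · rcases Nat.lt_succ_iff_lt_or_eq.1 hi with hi | hi
        · rw [b2 _ (by omega) (by omega), a1 i hi]
        · obtain rfl : i = ⟨j, hj⟩ := Fin.ext hi
          exact b1
      · rw [b2 r (by omega) (by omega), a2 r hr]
  obtain ⟨σ', e, a1, a2, a3⟩ := key m le_rfl
  have hv : (fun i : Fin m => σ'.reg (base + i)) = w := funext fun i => a1 i i.2
  obtain ⟨σ'', e', b1, b2, b3⟩ := hP (fun i => base + i) out (base + m) (fun i => by
    have := i.2; simp) (by omega) (fun i => by omega) x y V σ' (by rw [hv]; exact h5)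
  exact ⟨σ'', .seq' e e', b1, fun r hr hr' => by rw [b2 r (by omega) hr', a2 r hr], b3.trans a3⟩

/-- Register `base` counts the remaining iterations, `base + 1` is the index counted upwards, `base
+ 2` the current value and `base + 3` the next value; scratch registers start at `base + 4`. The
sequence `s` is the trace of the recursion, which must stay below `V`. -/
theorem Sem.prec {n : ℕ} {D : List Bool → (Fin n → ℕ) → ℕ → ℕ → Prop}
    {E : List Bool → (Fin (n + 2) → ℕ) → ℕ → ℕ → Prop} (hD : Sem D) (hE : Sem E) :
    Sem (n := n + 1) fun x v y V => ∃ s : ℕ → ℕ, s (v 0) = y ∧ D x (Fin.tail v) (s 0) V ∧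
      (∀ j < v 0, E x (Fin.cons j (Fin.cons (s j) (Fin.tail v) : Fin (n + 1) → ℕ)) (s (j + 1)) V) ∧
      v 0 ≤ V ∧ ∀ j ≤ v 0, s j ≤ V := by
  obtain ⟨P, hP⟩ := hD
  obtain ⟨Q, hQ⟩ := hE
  refine ⟨fun ins out base => .seq (P (Fin.tail ins) (base + 2) (base + 4))
    (.seq (.copy (ins 0) base (base + 4)) (.seq (.clear (base + 1))
      (.seq (.for base (.seq (Q (Fin.cons (base + 1) (Fin.cons (base + 2) (Fin.tail ins) :
        Fin (n + 1) → ℕ)) (base + 3) (base + 4)) (.seq (.copy (base + 3) (base + 2) (base + 4))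
        (.inc (base + 1))))) (.copy (base + 2) out (base + 4))))),
    fun ins out base h1 h2 h3 x y V σ ⟨s, hs, h0, hj, hV, hsV⟩ => ?_⟩
  dsimp only at hs h0 hj hV hsV
  set c := σ.reg (ins 0) with hc
  obtain ⟨σ1, e1, a1, a2, a3⟩ := hP (Fin.tail ins) (base + 2) (base + 4)
    (fun i => by have := h1 i.succ; simp only [Fin.tail]; omega) (by omega)
    (fun i => by have := h1 i.succ; simp only [Fin.tail]; omega) x (s 0) V σ h0
  obtain ⟨σ2, e2, b1, b2, b3⟩ := ev_copy (x := x) (V := V) (src := ins 0) (dst := base)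
    (tmp := base + 4) (by have := h1 0; omega) (by have := h1 0; omega) (by omega) σ1
    (by rw [a2 _ (by have := h1 0; omega) (by have := h1 0; omega)]; exact hV)
  rw [a2 _ (by have := h1 0; omega) (by have := h1 0; omega)] at b1
  obtain ⟨σ3, e3, i3⟩ := ev_for (x := x) (V := V) (r := base)
    (p := .seq (Q (Fin.cons (base + 1) (Fin.cons (base + 2) (Fin.tail ins) :
        Fin (n + 1) → ℕ)) (base + 3) (base + 4)) (.seq (.copy (base + 3) (base + 2) (base + 4))
        (.inc (base + 1))))
    (fun k τ => k ≤ c ∧ τ.reg base = k ∧ τ.reg (base + 1) = c - k ∧ τ.reg (base + 2) = s (c - k) ∧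
      (∀ r < base, τ.reg r = σ.reg r) ∧ τ.out = σ.out)
    (fun k τ h => h.2.1)
    (fun k τ ⟨d1, d2, d3, d4, d5, d6⟩ => by
      have hv : (fun i => (τ.set base k).reg ((Fin.cons (base + 1) (Fin.cons (base + 2)
          (Fin.tail ins) : Fin (n + 1) → ℕ) : Fin (n + 2) → ℕ) i)) =
          Fin.cons (c - (k + 1)) (Fin.cons (s (c - (k + 1))) (Fin.tail fun i => σ.reg (ins i)) :
            Fin (n + 1) → ℕ) := by
        funext i
        refine Fin.cases ?_ (fun i => Fin.cases ?_ (fun i => ?_) i) i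
        · simp [Mem.set_reg_of_ne, d3]
        · simp [Mem.set_reg_of_ne, d4]
        · have := h1 i.succ
          simp only [Fin.cons_succ, Fin.tail]
          rw [Mem.set_reg_of_ne _ _ (by omega), d5 _ this]
      obtain ⟨τ1, f1, g1, g2, g3⟩ := hQ (Fin.cons (base + 1) (Fin.cons (base + 2) (Fin.tail ins) :
        Fin (n + 1) → ℕ)) (base + 3) (base + 4)
        (fun i => by
          refine Fin.cases ?_ (fun i => Fin.cases ?_ (fun i => ?_) i) i
          · simp
          · simp
          · have := h1 i.succ
            simp only [Fin.cons_succ, Fin.tail]; omega) (by omega)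
        (fun i => by
          refine Fin.cases ?_ (fun i => Fin.cases ?_ (fun i => ?_) i) i
          · simp
          · simp
          · have := h1 i.succ
            simp only [Fin.cons_succ, Fin.tail]; omega) x (s (c - (k + 1) + 1)) V (τ.set base k)
        (by rw [hv]; exact hj _ (by omega))
      rw [show c - (k + 1) + 1 = c - k by omega] at g1
      obtain ⟨τ2, f2, l1, l2, l3⟩ := ev_copy (x := x) (V := V) (src := base + 3) (dst := base + 2)
        (tmp := base + 4) (by omega) (by omega) (by omega) τ1
        (by rw [g1]; exact hsV _ (by omega))
      have hr : ∀ r < base + 2, τ2.reg r = (τ.set base k).reg r := fun r hr => by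
        rw [l2 r (by omega) (by omega), g2 r (by omega) (by omega)]
      refine ⟨_, .seq' f1 (.seq' f2 (.inc _ _ ?_)), ?_, ?_, ?_, ?_, ?_, ?_⟩
      · rw [hr _ (by omega), Mem.set_reg_of_ne _ _ (by omega)]; omega
      · omega
      · rw [Mem.set_reg_of_ne _ _ (by omega), hr _ (by omega), Mem.set_reg_self]
      · rw [Mem.set_reg_self, hr _ (by omega), Mem.set_reg_of_ne _ _ (by omega)]; omega
      · rw [Mem.set_reg_of_ne _ _ (by omega), l1, g1]
      · intro r hr'
        rw [Mem.set_reg_of_ne _ _ (by omega), hr _ (by omega), Mem.set_reg_of_ne _ _ (by omega),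
          d5 r hr']
      · rw [Mem.set_out, l3, g3, Mem.set_out, d6])
    c (σ2.set (base + 1) 0) ⟨le_rfl, by rw [Mem.set_reg_of_ne _ _ (by omega), b1], by simp, by
      rw [Mem.set_reg_of_ne _ _ (by omega), b2 _ (by omega) (by omega), a1]; simp, fun r hr => by
      rw [Mem.set_reg_of_ne _ _ (by omega), b2 _ (by omega) (by omega), a2 _ (by omega) (by omega)],
      by rw [Mem.set_out, b3, a3]⟩
  obtain ⟨i1, i2, i3, i4, i5, i6⟩ := i3
  obtain ⟨σ4, e4, c1, c2, c3⟩ := ev_copy (x := x) (V := V) (src := base + 2) (dst := out)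
    (tmp := base + 4) (by omega) (by omega) (by omega) σ3 (by rw [i4]; exact hsV _ (by omega))
  refine ⟨σ4, .seq' e1 (.seq' e2 (.seq' (ev_clear _ _) (.seq' e3 e4))), ?_, fun r hr hr' => ?_, ?_⟩
  · rw [c1, i4]; simpa using hs
  · rw [c2 _ hr' (by omega), i5 r hr]
  · rw [c3, i6]

/-! ### Access to the input -/

/-- The input bit at a position: `0` beyond the end, `1` for false, `2` for true. -/
def bitAt (x : List Bool) (p : ℕ) : ℕ :=
  match x[p]? with
  | none => 0
  | some false => 1
  | some true => 2

def InputSymbol.isStart : InputSymbol → Bool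
  | .startMark => true
  | _ => false

def InputSymbol.isBit : InputSymbol → Bool
  | .bit _ => true
  | _ => false

def InputSymbol.isOne : InputSymbol → Bool
  | .bit true => true
  | _ => false

def Prog.rewind : Prog := .loop (.inp fun s => !s.isStart) (.move .left)

theorem isStart_inputSymbol_succ (x : List Bool) (k : ℕ) :
    (inputSymbol x (k + 1)).isStart = false := by
  rw [inputSymbol]
  cases x[k]? <;> rfl

theorem ev_rewind (σ : Mem) : Ev x V .rewind σ [] { σ with head := 0 } := by
  obtain ⟨r, h, o⟩ := σ
  induction h using Nat.strong_induction_on with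
  | _ h ih =>
    have ht := TestEv.inp (x := x) (σ := ⟨r, h, o⟩) fun s => !s.isStart
    cases h with
    | zero => exact .loop_false ht
    | succ k =>
      simp only [isStart_inputSymbol_succ] at ht
      exact .loop_true ht (.move .left _) (ih _ (by simp only [Move.apply]; omega))

theorem inputSymbol_min (p : ℕ) :
    (inputSymbol x (min (p + 1) (x.length + 1))).isBit = decide (p < x.length) ∧
      (inputSymbol x (min (p + 1) (x.length + 1))).isOne = decide (x[p]? = some true) := by
  by_cases h : p < x.length
  · rw [min_eq_left (by omega), inputSymbol]
    simp only [List.getElem?_eq_getElem h, h]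
    cases x[p] <;> simp [InputSymbol.isBit, InputSymbol.isOne]
  · rw [min_eq_right (by omega), inputSymbol]
    have h1 : x[p]? = none := List.getElem?_eq_none (by omega)
    have h2 : x[x.length]? = none := List.getElem?_eq_none (by omega)
    rw [h1, h2]
    simp [InputSymbol.isBit, InputSymbol.isOne, h]

/-- The head position is not preserved by programs, so each access rewinds and walks to cell `v 0 +
1`. Beyond the end of the input the head stays on the end marker, which gives the value `0`. -/
theorem sem_bitAt : Sem (n := 1) fun x v y V => y = bitAt x (v 0) ∧ v 0 ≤ V ∧ 2 ≤ V := by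
  refine ⟨fun ins out base => .seq (.copy (ins 0) base (base + 1)) (.seq .rewind
    (.seq (.move .right) (.seq (.for base (.move .right)) (.seq (.clear out)
      (.ite (.inp InputSymbol.isBit)
        (.seq (.inc out) (.ite (.inp InputSymbol.isOne) (.inc out) .skip)) .skip))))),
    fun ins out base h1 h2 h3 x y V σ ⟨h4, h5, h6⟩ => ?_⟩
  dsimp only at h4 h5
  obtain ⟨σ1, e1, a1, a2, a3⟩ := ev_copy (x := x) (V := V) (src := ins 0) (dst := base)
    (tmp := base + 1) (by have := h1 0; omega) (by have := h1 0; omega) (by omega) σ h5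
  set c := σ.reg (ins 0) with hc
  obtain ⟨σ2, e2, b0, b1, b2, b3, b4⟩ := ev_for (x := x) (V := V) (r := base) (p := .move .right)
    (fun k τ => k ≤ c ∧ τ.reg base = k ∧ τ.head = min (c - k + 1) (x.length + 1) ∧
      (∀ r < base, τ.reg r = σ.reg r) ∧ τ.out = σ.out)
    (fun k τ h => h.2.1)
    (fun k τ ⟨d0, d1, d2, d3, d4⟩ => by
      refine ⟨_, .move _ _, by omega, by simp, ?_, fun r hr => ?_, d4⟩
      · simp only [Mem.set_head, d2, Move.apply]; omega
      · simp only
        rw [Mem.set_reg_of_ne _ _ (by omega), d3 r hr])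
    c { σ1 with head := min 1 (x.length + 1) } ⟨le_rfl, a1, by simp,
      fun r hr => a2 r (by omega) (by omega), a3⟩
  rw [Nat.sub_zero] at b2
  obtain ⟨hs1, hs2⟩ := inputSymbol_min (x := x) c
  rw [← b2] at hs1 hs2
  have t1 := TestEv.inp (x := x) (σ := σ2.set out 0) InputSymbol.isBit
  rw [Mem.set_head, hs1] at t1
  have hpre : ∀ σ', Ev x V (.ite (.inp InputSymbol.isBit)
        (.seq (.inc out) (.ite (.inp InputSymbol.isOne) (.inc out) .skip)) .skip)
        (σ2.set out 0) [] σ' → Ev x V _ σ [] σ' := fun σ' h =>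
    .seq' e1 (.seq' (ev_rewind _) (.seq' (.move .right _) (.seq' e2 (.seq' (ev_clear out _) h))))
  by_cases hlt : c < x.length
  · simp only [hlt, decide_true] at t1
    have t2 := TestEv.inp (x := x) (σ := (σ2.set out 0).set out (0 + 1)) InputSymbol.isOne
    rw [Mem.set_head, Mem.set_head, hs2] at t2
    have einc := Ev.inc (x := x) (V := V) out (σ2.set out 0) (by simp; omega)
    rw [Mem.set_reg_self] at einc
    by_cases hone : x[c]? = some true
    · simp only [hone, decide_true] at t2
      refine ⟨_, hpre _ (.ite t1 (g' := []) (.seq' einc (.ite t2 (g' := [])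
        (.inc _ _ (by simpa using h6))))), ?_, fun r hr hr' => ?_, b4⟩
      · simp [h4, bitAt, hone]
      · simp only [Mem.set_reg_of_ne _ _ hr', b3 r hr]
    · simp only [hone, decide_false] at t2
      refine ⟨_, hpre _ (.ite t1 (g' := []) (.seq' einc (.ite t2 (g' := []) (ev_skip _)))), ?_,
        fun r hr hr' => ?_, b4⟩
      · rw [List.getElem?_eq_getElem hlt] at hone
        have : x[c] = false := by simpa using hone
        simp [h4, bitAt, List.getElem?_eq_getElem hlt, this]
      · simp only [Mem.set_reg_of_ne _ _ hr', b3 r hr]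
  · simp only [hlt, decide_false] at t1
    refine ⟨_, hpre _ (.ite t1 (g' := []) (ev_skip _)), ?_, fun r hr hr' => ?_, b4⟩
    · simp [h4, bitAt, List.getElem?_eq_none (not_lt.1 hlt)]
    · simp only [Mem.set_reg_of_ne _ _ hr', b3 r hr]

theorem sem_length : Sem (n := 0) fun x _ y V => y = x.length ∧ x.length ≤ V := by
  refine ⟨fun _ out _ => .seq .rewind (.seq (.clear out) (.seq (.move .right)
    (.loop (.inp InputSymbol.isBit) (.seq (.move .right) (.inc out))))),
    fun ins out base h1 h2 h3 x y V σ ⟨h4, h5⟩ => ?_⟩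
  have key : ∀ d c τ, c + d = x.length → τ.head = min (c + 1) (x.length + 1) → τ.reg out = c →
      ∃ σ', Ev x V (.loop (.inp InputSymbol.isBit) (.seq (.move .right) (.inc out))) τ [] σ' ∧
        σ'.reg out = x.length ∧ (∀ r ≠ out, σ'.reg r = τ.reg r) ∧ σ'.out = τ.out := by
    intro d
    induction d with
    | zero =>
      intro c τ hd hh hr
      have ht := TestEv.inp (x := x) (σ := τ) InputSymbol.isBit
      rw [hh, (inputSymbol_min c).1, show c = x.length by omega] at ht
      simp only [lt_irrefl, decide_false] at ht
      exact ⟨τ, .loop_false ht, by omega, fun _ _ => rfl, rfl⟩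
    | succ d ih =>
      intro c τ hd hh hr
      have ht := TestEv.inp (x := x) (σ := τ) InputSymbol.isBit
      rw [hh, (inputSymbol_min c).1] at ht
      simp only [show c < x.length by omega, decide_true] at ht
      obtain ⟨τ', hτ⟩ : ∃ τ' : Mem, τ' =
          { τ with head := min (Move.right.apply τ.head) (x.length + 1) } := ⟨_, rfl⟩
      have hr' : τ'.reg out = c := by rw [hτ]; exact hr
      have e1 := Ev.seq' (Ev.move (x := x) (V := V) .right τ) (hτ ▸ Ev.inc out τ' (by omega))
      obtain ⟨σ', e2, a1, a2, a3⟩ := ih (c + 1) (τ'.set out (τ'.reg out + 1)) (by omega) (by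
        simp only [Mem.set_head, hτ, hh, Move.apply]; omega) (by
        rw [Mem.set_reg_self, hr'])
      exact ⟨σ', .loop_true ht (g' := []) e1 (hτ ▸ e2), a1, fun r hr => by
        rw [a2 r hr, Mem.set_reg_of_ne _ _ hr, hτ], by rw [a3, hτ]; rfl⟩
  obtain ⟨σ', e, a1, a2, a3⟩ := key x.length 0
    { reg := (σ.set out 0).reg, head := min 1 (x.length + 1), out := σ.out }
    (by simp) rfl (by simp)
  refine ⟨σ', .seq' (ev_rewind _) (.seq' (ev_clear _ _) (.seq' (.move _ _) e)), by rw [a1, h4],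
    fun r hr hr' => ?_, a3⟩
  rw [a2 r hr']
  exact Mem.set_reg_of_ne _ _ hr'

end ParamLog

namespace ParamLog

/-! ## Functions computable with polynomially bounded counters -/

/-- `B` is a bound for the length of the input and for the arguments. -/
def Big {n : ℕ} (x : List Bool) (v : Fin n → ℕ) (B : ℕ) : Prop :=
  2 ≤ B ∧ x.length ≤ B ∧ ∀ i, v i ≤ B

/-- The function has a counter program whose counters are bounded by a polynomial in the length of
the input and the arguments. -/
def PC {n : ℕ} (f : List Bool → (Fin n → ℕ) → ℕ) : Prop :=
  ∃ c, (∀ x v B, Big x v B → f x v ≤ B ^ c) ∧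
    Sem fun x v y V => y = f x v ∧ ∃ B, Big x v B ∧ B ^ c ≤ V

variable {n : ℕ}

theorem PC.intro {f : List Bool → (Fin n → ℕ) → ℕ} {D : List Bool → (Fin n → ℕ) → ℕ → ℕ → Prop}
    (hD : Sem D) (c : ℕ)
    (h : ∀ x v B, Big x v B → f x v ≤ B ^ c ∧ ∀ V, B ^ c ≤ V → D x v (f x v) V) : PC f := by
  refine ⟨c, fun x v B hB => (h x v B hB).1, hD.mono ?_⟩
  rintro x v y V ⟨rfl, B, hB, hV⟩
  exact ⟨V, le_rfl, (h x v B hB).2 V hV⟩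

theorem PC.of_eq {f g : List Bool → (Fin n → ℕ) → ℕ} (hf : PC f) (h : ∀ x v, f x v = g x v) :
    PC g := by
  obtain rfl : f = g := funext fun x => funext (h x)
  exact hf

theorem Big.pow_le {x : List Bool} {v : Fin n → ℕ} {B c d : ℕ} (h : Big x v B) (hcd : c ≤ d) :
    B ^ c ≤ B ^ d := Nat.pow_le_pow_right (by have := h.1; omega) hcd

theorem PC.bound {f : List Bool → (Fin n → ℕ) → ℕ} (h : PC f) :
    ∃ c, ∀ x v B, Big x v B → f x v ≤ B ^ c := ⟨h.choose, h.choose_spec.1⟩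

theorem PC.var (i : Fin n) : PC fun _ v => v i :=
  .intro (sem_proj i) 1 fun x v B hB => by
    have := hB.2.2 i
    rw [pow_one]
    exact ⟨this, fun V hV => ⟨rfl, this.trans hV⟩⟩

theorem PC.len : PC (n := n) fun x _ => x.length :=
  .intro ((Sem.comp (n := n) sem_length (E := fun i => i.elim0) fun i => i.elim0)) 1
    fun x v B hB => by
      rw [pow_one]
      exact ⟨hB.2.1, fun V hV => ⟨fun i => i.elim0, fun i => i.elim0, rfl, hB.2.1.trans hV⟩⟩

/-- Polynomial bounds compose: if `B` bounds the input length and the arguments, a fixed power `B ^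
C` bounds all inner values, and the counters of the outer program stay below `(B ^ C) ^ c`.
Intermediate results are numbers held in registers, so nothing has to be recomputed. -/
theorem PC.comp {m : ℕ} {f : List Bool → (Fin m → ℕ) → ℕ}
    {g : Fin m → List Bool → (Fin n → ℕ) → ℕ} (hf : PC f) (hg : ∀ i, PC (g i)) :
    PC fun x v => f x fun i => g i x v := by
  obtain ⟨c, hc, hf⟩ := hf
  choose d hd hg using hg
  set C := 1 + ∑ i, d i with hC
  have hdC : ∀ i, d i ≤ C := fun i =>
    (Finset.single_le_sum (f := d) (fun _ _ => Nat.zero_le _) (Finset.mem_univ i)).trans (by omega)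
  have hbig : ∀ x v B, Big x v B → Big x (fun i => g i x v) (B ^ C) := fun x v B hB =>
    ⟨hB.1.trans (by simpa using hB.pow_le (show 1 ≤ C by omega)),
      hB.2.1.trans (by simpa using hB.pow_le (show 1 ≤ C by omega)),
      fun i => (hd i x v B hB).trans (hB.pow_le (hdC i))⟩
  refine .intro (Sem.comp hf hg) (C * c + C) fun x v B hB => ⟨?_, fun V hV => ?_⟩
  · refine (hc x _ _ (hbig x v B hB)).trans ?_
    rw [← pow_mul]
    exact hB.pow_le (by omega)
  · refine ⟨fun i => g i x v, fun i => ⟨rfl, B, hB, (hB.pow_le ?_).trans hV⟩, rfl, B ^ C,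
      hbig x v B hB, ?_⟩
    · have := hdC i; omega
    · rw [← pow_mul]
      exact (hB.pow_le (by omega)).trans hV

theorem PC.comp1 {f : List Bool → (Fin 1 → ℕ) → ℕ} {g : List Bool → (Fin n → ℕ) → ℕ} (hf : PC f)
    (hg : PC g) : PC fun x v => f x ![g x v] := by
  have := hf.comp (g := ![g]) (by intro i; fin_cases i; exact hg)
  refine this.of_eq fun x v => congrArg (f x) (funext fun i => ?_)
  fin_cases i; rfl

theorem PC.comp2 {f : List Bool → (Fin 2 → ℕ) → ℕ} {g h : List Bool → (Fin n → ℕ) → ℕ} (hf : PC f)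
    (hg : PC g) (hh : PC h) : PC fun x v => f x ![g x v, h x v] := by
  have := hf.comp (g := ![g, h]) (by intro i; fin_cases i; exacts [hg, hh])
  refine this.of_eq fun x v => congrArg (f x) (funext fun i => ?_)
  fin_cases i <;> rfl

theorem PC.comp4 {f : List Bool → (Fin 4 → ℕ) → ℕ} {g h k l : List Bool → (Fin n → ℕ) → ℕ}
    (hf : PC f) (hg : PC g) (hh : PC h) (hk : PC k) (hl : PC l) :
    PC fun x v => f x ![g x v, h x v, k x v, l x v] := by
  have := hf.comp (g := ![g, h, k, l]) (by intro i; fin_cases i; exacts [hg, hh, hk, hl])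
  refine this.of_eq fun x v => congrArg (f x) (funext fun i => ?_)
  fin_cases i <;> rfl

theorem PC.bitAt {f : List Bool → (Fin n → ℕ) → ℕ} (hf : PC f) :
    PC fun x v => bitAt x (f x v) := by
  refine PC.comp1 (f := fun x v => ParamLog.bitAt x (v 0)) ?_ hf
  refine .intro sem_bitAt 1 fun x v B hB => ?_
  have h1 := hB.1
  have h2 := hB.2.2 0
  rw [pow_one]
  refine ⟨?_, fun V hV => ⟨rfl, h2.trans hV, h1.trans hV⟩⟩
  rw [ParamLog.bitAt]
  split <;> omega

theorem PC.succ {f : List Bool → (Fin n → ℕ) → ℕ} (hf : PC f) : PC fun x v => f x v + 1 := by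
  refine PC.comp1 (f := fun x v => v 0 + 1) ?_ hf
  refine .intro sem_succ 2 fun x v B hB => ?_
  have h1 := hB.1
  have h2 := hB.2.2 0
  have : v 0 + 1 ≤ B ^ 2 := by nlinarith
  exact ⟨this, fun V hV => ⟨rfl, this.trans hV⟩⟩

theorem PC.const (c : ℕ) : PC (n := n) fun _ _ => c := by
  induction c with
  | zero => exact .intro sem_zero 0 fun x v B hB => by simp
  | succ c ih => exact ih.succ

/-- Primitive recursion. -/
def iterRec (a : ℕ) (g : ℕ → ℕ → ℕ) : ℕ → ℕ
  | 0 => a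
  | j + 1 => g j (iterRec a g j)

/-- Iterating a polynomially bounded step may produce exponential growth. A bound on all
intermediate values is therefore an explicit hypothesis. -/
theorem PC.recRaw {k f : List Bool → (Fin n → ℕ) → ℕ} {g : List Bool → (Fin n → ℕ) → ℕ → ℕ → ℕ}
    (hk : PC k) (hf : PC f)
    (hg : PC (n := n + 2) fun x w => g x (Fin.tail (Fin.tail w)) (w 0) (w 1)) {c : ℕ}
    (h : ∀ x v B, Big x v B → ∀ j ≤ k x v, iterRec (f x v) (g x v) j ≤ B ^ c) :
    PC fun x v => iterRec (f x v) (g x v) (k x v) := by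
  obtain ⟨ck, hck, hk⟩ := hk
  obtain ⟨cf, hcf, hf⟩ := hf
  obtain ⟨cg, hcg, hg⟩ := hg
  choose cv hcv hv using fun i : Fin n => PC.var i
  have hs := Sem.comp (Sem.prec hf hg) (n := n)
    (E := Fin.cons (fun x v y V => y = k x v ∧ ∃ B, Big x v B ∧ B ^ ck ≤ V)
      fun i x v y V => y = v i ∧ v i ≤ V)
    (fun i => Fin.cases hk (fun i => sem_proj i) i)
  set C := 1 + c + ck + cf with hC
  refine .intro hs (C * cg + C) fun x v B hB => ⟨(h x v B hB _ le_rfl).trans (hB.pow_le (by omega)),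
    fun V hV => ?_⟩
  have hle : ∀ d ≤ C, B ^ d ≤ V := fun d hd => (hB.pow_le (by omega)).trans hV
  have hB1 : B ≤ V := by simpa using hle 1 (by omega)
  refine ⟨Fin.cons (k x v) v, fun i => ?_, iterRec (f x v) (g x v), by simp, ?_, ?_, ?_, ?_⟩
  · refine Fin.cases ?_ (fun i => ?_) i
    · exact ⟨rfl, B, hB, hle _ (by omega)⟩
    · exact ⟨rfl, (hB.2.2 i).trans hB1⟩
  · exact ⟨rfl, B, hB, hle _ (by omega)⟩
  · intro j hj
    refine ⟨rfl, B ^ C, ⟨?_, ?_, ?_⟩, ?_⟩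
    · exact hB.1.trans (by simpa using hB.pow_le (show 1 ≤ C by omega))
    · exact hB.2.1.trans (by simpa using hB.pow_le (show 1 ≤ C by omega))
    · intro i
      refine Fin.cases ?_ (fun i => Fin.cases ?_ (fun i => ?_) i) i
      · have : k x v ≤ B ^ C := (hck x v B hB).trans (hB.pow_le (by omega))
        simp only [Fin.cons_zero] at hj ⊢
        omega
      · exact (h x v B hB _ hj.le).trans (hB.pow_le (by omega))
      · exact (hB.2.2 i).trans (by simpa using hB.pow_le (show 1 ≤ C by omega))
    · rw [← pow_mul]
      exact (hB.pow_le (by omega)).trans hV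
  · exact (hck x v B hB).trans (hle _ (by omega))
  · intro j hj
    exact (h x v B hB _ hj).trans (hle _ (by omega))

theorem PC.recBound {k f b : List Bool → (Fin n → ℕ) → ℕ}
    {g : List Bool → (Fin n → ℕ) → ℕ → ℕ → ℕ} (hk : PC k) (hf : PC f)
    (hg : PC (n := n + 2) fun x w => g x (Fin.tail (Fin.tail w)) (w 0) (w 1)) (hb : PC b)
    (h : ∀ x v, ∀ j ≤ k x v, iterRec (f x v) (g x v) j ≤ b x v) :
    PC fun x v => iterRec (f x v) (g x v) (k x v) := by
  obtain ⟨c, hc⟩ := hb.bound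
  exact hk.recRaw hf hg fun x v B hB j hj => (h x v j hj).trans (hc x v B hB)

/-! ### Arithmetic -/

section

variable {f g h : List Bool → (Fin n → ℕ) → ℕ}

theorem PC.add (hf : PC f) (hg : PC g) : PC fun x v => f x v + g x v := by
  have key : ∀ a j, iterRec a (fun _ s => s + 1) j = a + j := by
    intro a j
    induction j with
    | zero => rfl
    | succ j ih => rw [iterRec, ih]; omega
  obtain ⟨c, hc⟩ := hf.bound
  obtain ⟨d, hd⟩ := hg.bound
  refine (hg.recRaw hf (g := fun _ _ _ s => s + 1) (PC.var 1).succ (c := c + d + 1) ?_).of_eq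
    fun x v => key _ _
  intro x v B hB j hj
  rw [key]
  have h1 := (hc x v B hB).trans (hB.pow_le (show c ≤ c + d by omega))
  have h2 := (hd x v B hB).trans (hB.pow_le (show d ≤ c + d by omega))
  have h3 := hB.1
  rw [pow_succ]
  nlinarith

theorem PC.mul (hf : PC f) (hg : PC g) : PC fun x v => f x v * g x v := by
  have hf' := PC.comp hf (n := n + 2) fun i => PC.var i.succ.succ
  have key : ∀ a j, iterRec 0 (fun _ s => s + a) j = a * j := by
    intro a j
    induction j with
    | zero => rfl
    | succ j ih => rw [iterRec, ih]; ring
  obtain ⟨c, hc⟩ := hf.bound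
  obtain ⟨d, hd⟩ := hg.bound
  refine (hg.recRaw (.const 0) (g := fun x v _ s => s + f x v) ((PC.var 1).add hf') (c := c + d)
    ?_).of_eq fun x v => key _ _
  intro x v B hB j hj
  rw [key, pow_add]
  exact Nat.mul_le_mul (hc x v B hB) (hj.trans (hd x v B hB))

theorem PC.pred (hf : PC f) : PC fun x v => f x v - 1 := by
  refine (hf.recBound (.const 0) (g := fun _ _ j _ => j) (PC.var 0) hf ?_).of_eq ?_
  · intro x v j hj
    cases j with
    | zero => exact Nat.zero_le _
    | succ j => rw [iterRec]; omega
  · intro x v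
    cases f x v <;> rfl

theorem PC.sub (hf : PC f) (hg : PC g) : PC fun x v => f x v - g x v := by
  have key : ∀ a j, iterRec a (fun _ s => s - 1) j = a - j := by
    intro a j
    induction j with
    | zero => rfl
    | succ j ih => rw [iterRec, ih]; omega
  exact (hg.recBound hf (g := fun _ _ _ s => s - 1) (PC.var 1).pred hf
    fun x v j _ => by rw [key]; omega).of_eq fun x v => key _ _

open Classical in
/-- Predicates with a characteristic function as above. -/
def PD (p : List Bool → (Fin n → ℕ) → Prop) : Prop := PC fun x v => if p x v then 1 else 0

variable {p q : List Bool → (Fin n → ℕ) → Prop}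

theorem PD.of_iff (hp : PD p) (hh : ∀ x v, p x v ↔ q x v) : PD q := by
  obtain rfl : p = q := funext fun x => funext fun v => propext (hh x v)
  exact hp

theorem PC.ite [∀ x v, Decidable (p x v)] (hp : PD p) (hf : PC f) (hg : PC g) :
    PC fun x v => if p x v then f x v else g x v :=
  ((PC.mul hp hf).add (((PC.const 1).sub hp).mul hg)).of_eq fun x v => by
    by_cases h' : p x v <;> simp [h']

theorem PD.eq_zero (hf : PC f) : PD fun x v => f x v = 0 :=
  ((PC.const 1).sub hf).of_eq fun x v => by split <;> omega

theorem PD.le (hf : PC f) (hg : PC g) : PD fun x v => f x v ≤ g x v :=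
  (PD.eq_zero (hf.sub hg)).of_iff fun x v => by omega

theorem PD.lt (hf : PC f) (hg : PC g) : PD fun x v => f x v < g x v := PD.le hf.succ hg

theorem PD.not (hp : PD p) : PD fun x v => ¬ p x v :=
  (PD.eq_zero hp).of_iff fun x v => by simp

theorem PD.and (hp : PD p) (hq : PD q) : PD fun x v => p x v ∧ q x v :=
  (PC.mul hp hq).of_eq fun x v => by by_cases h1 : p x v <;> by_cases h2 : q x v <;> simp [h1, h2]

theorem PD.or (hp : PD p) (hq : PD q) : PD fun x v => p x v ∨ q x v :=
  (hp.not.and hq.not).not.of_iff fun x v => by tauto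

theorem PD.imp (hp : PD p) (hq : PD q) : PD fun x v => p x v → q x v :=
  (hp.not.or hq).of_iff fun x v => by tauto

theorem PD.eq (hf : PC f) (hg : PC g) : PD fun x v => f x v = g x v :=
  ((PD.le hf hg).and (PD.le hg hf)).of_iff fun x v => by omega

/-- Weakening by two variables. -/
theorem PC.tail2 (hf : PC f) : PC (n := n + 2) fun x w => f x (Fin.tail (Fin.tail w)) :=
  PC.comp hf (n := n + 2) fun i => PC.var i.succ.succ

/-- There are at most `B ^ c` summands. The index of a summand is itself an argument, so the
summands are bounded by a power of `B ^ (c + 1)`. -/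
theorem PC.sum {f : List Bool → (Fin n → ℕ) → ℕ} {g : List Bool → (Fin n → ℕ) → ℕ → ℕ} (hf : PC f)
    (hg : PC (n := n + 1) fun x w => g x (Fin.tail w) (w 0)) :
    PC fun x v => ∑ i ∈ Finset.range (f x v), g x v i := by
  have key : ∀ (t : ℕ → ℕ) j, iterRec 0 (fun i s => s + t i) j = ∑ i ∈ Finset.range j, t i := by
    intro t j
    induction j with
    | zero => rfl
    | succ j ih => rw [iterRec, ih, Finset.sum_range_succ]
  obtain ⟨c, hc⟩ := hf.bound
  obtain ⟨d, hd⟩ := hg.bound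
  have hg' := PC.comp hg (n := n + 2)
    (g := Fin.cons (fun _ w => w 0) fun i _ w => w i.succ.succ)
    (fun i => Fin.cases (PC.var 0) (fun i => PC.var i.succ.succ) i)
  refine (hf.recRaw (.const 0) (g := fun x v i s => s + g x v i) ((PC.var 1).add hg')
    (c := c + (c + 1) * d) ?_).of_eq fun x v => key _ _
  intro x v B hB j hj
  rw [key]
  have hj' := hj.trans (hc x v B hB)
  calc ∑ i ∈ Finset.range j, g x v i ≤ ∑ i ∈ Finset.range j, B ^ ((c + 1) * d) := by
        refine Finset.sum_le_sum fun i hi => ?_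
        rw [pow_mul]
        refine hd x (Fin.cons i v) _ ⟨?_, ?_, ?_⟩
        · exact hB.1.trans (by simpa using hB.pow_le (show 1 ≤ c + 1 by omega))
        · exact hB.2.1.trans (by simpa using hB.pow_le (show 1 ≤ c + 1 by omega))
        · intro l
          refine Fin.cases ?_ (fun l => ?_) l
          · have := hB.pow_le (show c ≤ c + 1 by omega)
            have := Finset.mem_range.1 hi
            simp only [Fin.cons_zero]; omega
          · exact (hB.2.2 l).trans (by simpa using hB.pow_le (show 1 ≤ c + 1 by omega))
    _ = j * B ^ ((c + 1) * d) := by simp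
    _ ≤ B ^ c * B ^ ((c + 1) * d) := Nat.mul_le_mul_right _ hj'
    _ = _ := by rw [pow_add]

theorem PD.ball {p : List Bool → (Fin n → ℕ) → ℕ → Prop} (hf : PC f)
    (hp : PD (n := n + 1) fun x w => p x (Fin.tail w) (w 0)) :
    PD fun x v => ∀ i < f x v, p x v i := by
  classical
  have := PC.sum (g := fun x v i => if ¬ p x v i then 1 else 0) hf
    (hp.not.of_eq fun x w => by congr)
  exact (PD.eq_zero this).of_iff fun x v => by simp

theorem PD.bex {p : List Bool → (Fin n → ℕ) → ℕ → Prop} (hf : PC f)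
    (hp : PD (n := n + 1) fun x w => p x (Fin.tail w) (w 0)) :
    PD fun x v => ∃ i < f x v, p x v i :=
  (PD.ball (p := fun x v i => ¬ p x v i) hf hp.not).not.of_iff fun x v => by simp

open Classical in
/-- The least number with a property, if there is one below `k`, and otherwise `k`. -/
noncomputable def bsearch (k : ℕ) (p : ℕ → Prop) : ℕ :=
  -- The sum counts the numbers that lie strictly before the first one with the property.
  ∑ i ∈ Finset.range k, if ∀ j < i + 1, ¬ p j then 1 else 0

theorem bsearch_spec (k : ℕ) (p : ℕ → Prop) :
    bsearch k p ≤ k ∧ (∀ j < bsearch k p, ¬ p j) ∧ (bsearch k p < k → p (bsearch k p)) := by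
  induction k with
  | zero => simp [bsearch]
  | succ k ih =>
    obtain ⟨h1, h2, h3⟩ := ih
    classical
    have hs : bsearch (k + 1) p = bsearch k p + if ∀ j < k + 1, ¬ p j then 1 else 0 := by
      rw [bsearch, Finset.sum_range_succ, bsearch]
    by_cases h : ∀ j < k + 1, ¬ p j
    · rw [if_pos h] at hs
      have hk : bsearch k p = k := by
        by_contra hne
        exact h _ (by omega) (h3 (by omega))
      rw [hs, hk]
      exact ⟨le_rfl, h, fun h => by omega⟩
    · rw [if_neg h, add_zero] at hs
      rw [hs]
      refine ⟨by omega, h2, fun _ => ?_⟩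
      rcases h1.lt_or_eq with h4 | h4
      · exact h3 h4
      · push Not at h
        obtain ⟨j, hj, hpj⟩ := h
        rcases Nat.lt_succ_iff_lt_or_eq.1 hj with h5 | h5
        · exact absurd hpj (h2 j (by omega))
        · rw [h4, ← h5]; exact hpj

theorem bsearch_eq {k m : ℕ} {p : ℕ → Prop} (hm : m ≤ k) (h1 : m < k → p m)
    (h2 : ∀ j < m, ¬ p j) : bsearch k p = m := by
  obtain ⟨a1, a2, a3⟩ := bsearch_spec k p
  rcases lt_trichotomy (bsearch k p) m with h | h | h
  · exact absurd (a3 (by omega)) (h2 _ h)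
  · exact h
  · exact absurd (h1 (by omega)) (a2 _ h)

theorem PC.bsearch {p : List Bool → (Fin n → ℕ) → ℕ → Prop} (hf : PC f)
    (hp : PD (n := n + 1) fun x w => p x (Fin.tail w) (w 0)) :
    PC fun x v => ParamLog.bsearch (f x v) (p x v) := by
  classical
  have hp' : PD (n := n + 1 + 1) fun x w => ¬ p x (Fin.tail (Fin.tail w)) (w 0) := by
    refine PD.not ?_
    exact PC.comp (n := n + 2) hp (g := Fin.cons (fun _ w => w 0) fun i _ w => w i.succ.succ)
      (fun i => Fin.cases (PC.var 0) (fun i => PC.var i.succ.succ) i)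
  exact PC.sum (g := fun x v i => if ∀ j < i + 1, ¬ p x v j then 1 else 0) hf
    ((PD.ball (p := fun x w j => ¬ p x (Fin.tail w) j) (PC.var 0).succ hp').of_eq
      fun x w => by congr)

end

end ParamLog

namespace ParamLog

variable {n : ℕ} {f g h : List Bool → (Fin n → ℕ) → ℕ}

theorem PC.div (hf : PC f) (hg : PC g) : PC fun x v => f x v / g x v := by
  classical
  have h2 : PC (n := 2) fun _ v => v 0 / v 1 := by
    refine (PC.ite (PD.eq_zero (PC.var 1)) (.const 0) (PC.bsearch (n := 2) (f := fun _ v => v 0)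
      (p := fun _ v q => v 0 < (q + 1) * v 1) (PC.var 0)
      (PD.lt (PC.var 1) ((PC.var 0).succ.mul (PC.var 2))))).of_eq fun x v => ?_
    split
    · next h => rw [h, Nat.div_zero]
    · next h =>
      refine bsearch_eq (Nat.div_le_self _ _) (fun _ => ?_) fun j hj => ?_
      · have := Nat.lt_mul_div_succ (v 0) (Nat.pos_of_ne_zero h)
        rwa [mul_comm] at this
      · rw [not_lt]
        exact (Nat.mul_le_mul_right _ hj).trans (Nat.div_mul_le_self _ _)
  exact h2.comp2 hf hg

theorem PC.mod (hf : PC f) (hg : PC g) : PC fun x v => f x v % g x v :=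
  (hf.sub (hg.mul (hf.div hg))).of_eq fun x v => by
    have := Nat.mod_add_div (f x v) (g x v)
    omega

theorem PC.min (hf : PC f) (hg : PC g) : PC fun x v => min (f x v) (g x v) := by
  classical
  exact (PC.ite (PD.le hf hg) hf hg).of_eq fun x v => by rw [min_def]

/-- The digit with index `i` in base `b`. -/
def digit (b C i : ℕ) : ℕ := C / b ^ i % b

/-- The power itself is not polynomially bounded. Repeated division gives the same quotient and
never leaves the range below the dividend. -/
theorem PC.divPow (hf : PC f) (hg : PC g) (hh : PC h) :
    PC fun x v => f x v / g x v ^ h x v := by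
  have key : ∀ C b i, iterRec C (fun _ s => s / b) i = C / b ^ i := by
    intro C b i
    induction i with
    | zero => simp [iterRec]
    | succ i ih => rw [iterRec, ih, Nat.div_div_eq_div_mul, pow_succ]
  exact (hh.recBound hf (g := fun x v _ s => s / g x v) ((PC.var 1).div hg.tail2) hf
    fun x v j _ => by rw [key]; exact Nat.div_le_self _ _).of_eq fun x v => key _ _ _

theorem PC.digit (hf : PC f) (hg : PC g) (hh : PC h) :
    PC fun x v => digit (f x v) (g x v) (h x v) := (hg.divPow hf hh).mod hf

theorem PC.size (hf : PC f) : PC fun x v => (f x v).size := by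
  classical
  have h1 : PC (n := 1) fun _ v => (v 0).size := by
    refine (PC.sum (f := fun _ v => v 0) (g := fun _ v i => if ¬ v 0 / 2 ^ i = 0 then 1 else 0)
      (PC.var 0) (PC.of_eq (PD.not (PD.eq_zero ((PC.var 1).divPow (.const 2) (PC.var 0))))
        fun x w => by simp [Fin.tail])).of_eq fun x v => ?_
    have : ∀ i, (¬ v 0 / 2 ^ i = 0) ↔ i < (v 0).size := fun i => by
      rw [Nat.lt_size, Nat.div_eq_zero_iff]
      simp
    simp only [this]
    have hle : (v 0).size ≤ v 0 := Nat.size_le.2 Nat.lt_two_pow_self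
    rw [Finset.sum_ite, Finset.sum_const_zero, add_zero, Finset.sum_const, smul_eq_mul, mul_one]
    have : (Finset.range (v 0)).filter (fun i => i < (v 0).size) = Finset.range (v 0).size := by
      ext i; simp; omega
    rw [this, Finset.card_range]
  exact h1.comp1 hf

/-! ## Parsing encodings -/

variable (x : List Bool)

/-- The code of `v` is found at position `p` of `x`. -/
def binAt (p v : ℕ) : Prop :=
  (∀ j < v.size, bitAt x (p + 2 * j) = 2 ∧ bitAt x (p + 2 * j + 1) = 1 + v / 2 ^ j % 2) ∧
    bitAt x (p + 2 * v.size) = 1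

def unAt (p u : ℕ) : Prop := (∀ j < u, bitAt x (p + j) = 2) ∧ bitAt x (p + u) = 1

/-- The number whose binary code is found at position `p`; if there is none, the value is too
large. -/
noncomputable def binVal (p : ℕ) : ℕ := bsearch (x.length + 1) (binAt x p)

noncomputable def unVal (p : ℕ) : ℕ := bsearch (x.length + 1) (unAt x p)

/-- The truncation has no effect on genuine codes. It keeps positions polynomially bounded on
arbitrary inputs, as `PC.recBound` requires; the other end positions are truncated for the same
reason. -/
noncomputable def binEnd (p : ℕ) : ℕ := min (p + 2 * (binVal x p).size + 1) (x.length + 1)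

noncomputable def unEnd (p : ℕ) : ℕ := min (p + unVal x p + 1) (x.length + 1)

/-- Position of an entry of a tuple that starts at position `p`. -/
noncomputable def entryPos (p l : ℕ) : ℕ := iterRec p (fun _ s => binEnd x s) l

/-- Position of a tuple of a list of tuples of length `r` that starts at position `p`. -/
noncomputable def tuplePos (r p q : ℕ) : ℕ := iterRec p (fun _ s => entryPos x (s + 1) r) q

/-- In `encList` each entry is announced by the bit true, for which `bitAt` is `2`, so the list ends
at the first tuple position without it. -/
noncomputable def listLen (r p : ℕ) : ℕ :=
  bsearch (x.length + 1) fun q => bitAt x (tuplePos x r p q) ≠ 2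

noncomputable def listEnd (r p : ℕ) : ℕ := min (tuplePos x r p (listLen x r p) + 1) (x.length + 1)

/-- Position of the arity of a symbol in the vocabulary at the beginning of `x`. -/
noncomputable def vocPos (j : ℕ) : ℕ := iterRec 0 (fun _ s => unEnd x (s + 1)) j

noncomputable def vocLen : ℕ := bsearch (x.length + 1) fun j => bitAt x (vocPos x j) ≠ 2

noncomputable def vocAr (i : ℕ) : ℕ := unVal x (vocPos x i + 1)

noncomputable def vocEnd : ℕ := min (vocPos x (vocLen x) + 1) (x.length + 1)

/-- Position of a relation of the structure whose code starts at position `s`. -/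
noncomputable def relPos (s i : ℕ) : ℕ :=
  iterRec (unEnd x s) (fun j p => listEnd x (vocAr x j) p) i

noncomputable def bodyEnd (s : ℕ) : ℕ := relPos x s (vocLen x)

noncomputable def relLen (s i : ℕ) : ℕ := listLen x (vocAr x i) (relPos x s i)

/-- Entry `l` of tuple `q` of relation `i` of the structure whose code starts at position `s`. -/
noncomputable def entry (s i q l : ℕ) : ℕ :=
  binVal x (entryPos x (tuplePos x (vocAr x i) (relPos x s i) q + 1) l)

variable {x}

section

variable {p r k l : List Bool → (Fin n → ℕ) → ℕ}

theorem PD.comp1 {P : List Bool → (Fin 1 → ℕ) → Prop} (hP : PD P) (hf : PC f) :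
    PD fun x v => P x ![f x v] := PC.comp1 hP hf

theorem PD.comp2 {P : List Bool → (Fin 2 → ℕ) → Prop} (hP : PD P) (hf : PC f) (hg : PC g) :
    PD fun x v => P x ![f x v, g x v] := PC.comp2 hP hf hg

theorem pd_binAt (hf : PC f) (hg : PC g) : PD fun x v => binAt x (f x v) (g x v) := by
  refine PD.comp2 (P := fun x v => binAt x (v 0) (v 1)) ?_ hf hg
  refine (PD.ball (p := fun x v j => bitAt x (v 0 + 2 * j) = 2 ∧
    bitAt x (v 0 + 2 * j + 1) = 1 + v 1 / 2 ^ j % 2) (PC.var 1).size (PD.and ?_ ?_)).and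
    (PD.eq ((PC.var 0).add ((PC.const 2).mul (PC.var 1).size)).bitAt (.const 1))
  · exact PD.eq ((PC.var 1).add ((PC.const 2).mul (PC.var 0))).bitAt (.const 2)
  · exact PD.eq ((PC.var 1).add ((PC.const 2).mul (PC.var 0))).succ.bitAt
      ((PC.const 1).add (((PC.var 2).divPow (.const 2) (PC.var 0)).mod (.const 2)))

theorem pd_unAt (hf : PC f) (hg : PC g) : PD fun x v => unAt x (f x v) (g x v) := by
  refine PD.comp2 (P := fun x v => unAt x (v 0) (v 1)) ?_ hf hg
  exact (PD.ball (p := fun x v j => bitAt x (v 0 + j) = 2) (PC.var 1)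
    (PD.eq ((PC.var 1).add (PC.var 0)).bitAt (.const 2))).and
    (PD.eq ((PC.var 0).add (PC.var 1)).bitAt (.const 1))

theorem pc_binVal (hf : PC f) : PC fun x v => binVal x (f x v) :=
  (PC.bsearch (p := fun x v j => binAt x (v 0) j) PC.len.succ
    (pd_binAt (PC.var 1) (PC.var 0)) : PC (n := 1) _).comp1 hf

theorem pc_unVal (hf : PC f) : PC fun x v => unVal x (f x v) :=
  (PC.bsearch (p := fun x v j => unAt x (v 0) j) PC.len.succ
    (pd_unAt (PC.var 1) (PC.var 0)) : PC (n := 1) _).comp1 hf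

theorem pc_binEnd (hf : PC f) : PC fun x v => binEnd x (f x v) :=
  ((hf.add ((PC.const 2).mul (pc_binVal hf).size)).succ).min PC.len.succ

theorem pc_unEnd (hf : PC f) : PC fun x v => unEnd x (f x v) :=
  ((hf.add (pc_unVal hf)).succ).min PC.len.succ

theorem iterRec_le {a b : ℕ} {t : ℕ → ℕ → ℕ} (ht : ∀ j s, s ≤ b → t j s ≤ b) (ha : a ≤ b) (j : ℕ) :
    iterRec a t j ≤ b := by
  induction j with
  | zero => exact ha
  | succ j ih => exact ht _ _ ih

theorem entryPos_le (p l : ℕ) : entryPos x p l ≤ p + (x.length + 1) :=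
  iterRec_le (fun _ _ _ => (min_le_right _ _).trans (by omega)) (by omega) _

theorem pc_entryPos (hf : PC f) (hg : PC g) : PC fun x v => entryPos x (f x v) (g x v) :=
  hg.recBound hf (g := fun x _ _ s => binEnd x s) (pc_binEnd (PC.var 1)) (hf.add PC.len.succ)
    fun _ _ _ _ => entryPos_le _ _

theorem entryPos_le' (p l : ℕ) : entryPos x p l ≤ max p (x.length + 1) :=
  iterRec_le (fun _ _ _ => (min_le_right _ _).trans (by omega)) (by omega) _

theorem tuplePos_le (r p q : ℕ) : tuplePos x r p q ≤ p + q + (x.length + 1) := by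
  induction q with
  | zero => simp [tuplePos, iterRec]
  | succ q ih =>
    have := entryPos_le' (x := x) (tuplePos x r p q + 1) r
    rw [tuplePos, iterRec]
    rw [tuplePos] at this ih
    omega

theorem pc_tuplePos (hr : PC r) (hf : PC f) (hg : PC g) :
    PC fun x v => tuplePos x (r x v) (f x v) (g x v) :=
  hg.recBound hf (g := fun x v _ s => entryPos x (s + 1) (r x v))
    (pc_entryPos (PC.var 1).succ hr.tail2) ((hf.add hg).add PC.len.succ)
    fun _ _ _ hj => (tuplePos_le _ _ _).trans (by omega)

theorem pc_listLen (hr : PC r) (hf : PC f) : PC fun x v => listLen x (r x v) (f x v) :=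
  (PC.bsearch (p := fun x v j => bitAt x (tuplePos x (v 0) (v 1) j) ≠ 2) PC.len.succ
    (PD.not (PD.eq (pc_tuplePos (PC.var 1) (PC.var 2) (PC.var 0)).bitAt (.const 2))) :
      PC (n := 2) _).comp2 hr hf

theorem pc_listEnd (hr : PC r) (hf : PC f) : PC fun x v => listEnd x (r x v) (f x v) :=
  (pc_tuplePos hr hf (pc_listLen hr hf)).succ.min PC.len.succ

theorem pc_vocPos (hf : PC f) : PC fun x v => vocPos x (f x v) :=
  hf.recBound (.const 0) (g := fun x _ _ s => unEnd x (s + 1)) (pc_unEnd (PC.var 1).succ)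
    PC.len.succ fun _ _ _ _ => iterRec_le (fun _ _ _ => min_le_right _ _) (by omega) _

theorem pc_vocLen : PC (n := n) fun x _ => vocLen x :=
  PC.bsearch (p := fun x _ j => bitAt x (vocPos x j) ≠ 2) PC.len.succ
    (PD.not (PD.eq (pc_vocPos (PC.var 0)).bitAt (.const 2)))

theorem pc_vocAr (hf : PC f) : PC fun x v => vocAr x (f x v) := pc_unVal (pc_vocPos hf).succ

theorem pc_vocEnd : PC (n := n) fun x _ => vocEnd x := (pc_vocPos pc_vocLen).succ.min PC.len.succ

theorem pc_relPos (hf : PC f) (hg : PC g) : PC fun x v => relPos x (f x v) (g x v) :=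
  hg.recBound (pc_unEnd hf) (g := fun x _ j p => listEnd x (vocAr x j) p)
    (pc_listEnd (pc_vocAr (PC.var 0)) (PC.var 1)) PC.len.succ
    fun _ _ _ _ => iterRec_le (fun _ _ _ => min_le_right _ _) (min_le_right _ _) _

theorem pc_bodyEnd (hf : PC f) : PC fun x v => bodyEnd x (f x v) := pc_relPos hf pc_vocLen

theorem pc_relLen (hf : PC f) (hg : PC g) : PC fun x v => relLen x (f x v) (g x v) :=
  pc_listLen (pc_vocAr hg) (pc_relPos hf hg)

theorem pc_entry (hf : PC f) (hg : PC g) (hk : PC k) (hl : PC l) :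
    PC fun x v => entry x (f x v) (g x v) (k x v) (l x v) :=
  pc_binVal (pc_entryPos (pc_tuplePos (pc_vocAr hg) (pc_relPos hf hg) hk).succ hl)

end

end ParamLog

namespace ParamLog

variable {x : List Bool}

/-! ### Words at positions -/

/-- The word `w` is found at position `p` of `x`. -/
def At (x : List Bool) (p : ℕ) (w : List Bool) : Prop := w <+: x.drop p

theorem at_append {p : ℕ} {a b : List Bool} :
    At x p (a ++ b) ↔ At x p a ∧ At x (p + a.length) b := by
  unfold At
  constructor
  · rintro ⟨r, hr⟩
    rw [List.append_assoc] at hr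
    refine ⟨⟨_, hr⟩, r, ?_⟩
    rw [← List.drop_drop, ← hr]
    simp
  · rintro ⟨⟨r, hr⟩, r', hr'⟩
    rw [← List.drop_drop, ← hr, List.drop_left] at hr'
    exact ⟨r', by rw [← hr, ← hr', List.append_assoc]⟩

theorem at_nil {p : ℕ} : At x p [] := List.nil_prefix

theorem at_singleton {p : ℕ} {b : Bool} : At x p [b] ↔ bitAt x p = 1 + b.toNat := by
  unfold At bitAt
  by_cases h : p < x.length
  · rw [List.drop_eq_getElem_cons h, List.getElem?_eq_getElem h, List.cons_prefix_cons]
    cases x[p] <;> cases b <;> simp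
  · rw [List.drop_eq_nil_of_le (by omega), List.getElem?_eq_none (by omega)]
    cases b <;> simp

theorem at_cons {p : ℕ} {b : Bool} {a : List Bool} :
    At x p (b :: a) ↔ bitAt x p = 1 + b.toNat ∧ At x (p + 1) a := by
  rw [← List.singleton_append, at_append, at_singleton]
  rfl

theorem At.le {p : ℕ} {a : List Bool} (h : At x p a) (ha : a ≠ []) : p + a.length ≤ x.length := by
  have := h.length_le
  rw [List.length_drop] at this
  have := List.length_pos_of_ne_nil ha
  omega

theorem At.unique {α : Type} {e : α → List Bool} (he : UniqueRead e) {p : ℕ} {a b : α}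
    (ha : At x p (e a)) (hb : At x p (e b)) : a = b := by
  obtain ⟨r, hr⟩ := ha
  obtain ⟨r', hr'⟩ := hb
  exact (he a b r r' (hr.trans hr'.symm)).1

theorem encBinary_zero : encBinary 0 = [false] := by simp [encBinary, encList]

theorem bits_of_ne {v : ℕ} (hv : v ≠ 0) : v.bits = decide (v % 2 = 1) :: (v / 2).bits := by
  conv_lhs => rw [← Nat.bit_decide_mod_two_eq_one_shiftRight_one v]
  rw [Nat.shiftRight_one, Nat.bits_append_bit]
  intro h
  have : v = 1 := by omega
  simp [this]

theorem encBinary_of_ne {v : ℕ} (hv : v ≠ 0) :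
    encBinary v = true :: decide (v % 2 = 1) :: encBinary (v / 2) := by
  simp [encBinary, encList, bits_of_ne hv]

theorem size_of_ne {v : ℕ} (hv : v ≠ 0) : v.size = (v / 2).size + 1 := by
  conv_lhs => rw [← Nat.bit_decide_mod_two_eq_one_shiftRight_one v]
  rw [Nat.size_bit, Nat.shiftRight_one]
  rwa [Nat.bit_decide_mod_two_eq_one_shiftRight_one]

theorem length_encBinary (v : ℕ) : (encBinary v).length = 2 * v.size + 1 := by
  induction v using Nat.strong_induction_on with
  | _ v ih =>
    by_cases hv : v = 0
    · subst hv; simp [encBinary_zero]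
    · rw [encBinary_of_ne hv, size_of_ne hv]
      simp [ih (v / 2) (by omega)]
      omega

theorem binAt_iff (v : ℕ) : ∀ p, binAt x p v ↔ At x p (encBinary v) := by
  induction v using Nat.strong_induction_on with
  | _ v ih =>
    intro p
    by_cases hv : v = 0
    · subst hv; simp [encBinary_zero, binAt, at_singleton]
    · rw [encBinary_of_ne hv, at_cons, at_cons, ← ih (v / 2) (by omega), binAt, binAt,
        size_of_ne hv, ← and_assoc, ← and_assoc]
      refine and_congr ?_ ?_
      · constructor
        · intro h
          refine ⟨⟨(h 0 (by omega)).1, ?_⟩, fun j hj => ?_⟩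
          · have := (h 0 (by omega)).2
            simp only [mul_zero, add_zero, pow_zero, Nat.div_one] at this
            rw [this]
            rcases Nat.mod_two_eq_zero_or_one v with h | h <;> simp [h]
          · have := h (j + 1) (by omega)
            rw [pow_succ', ← Nat.div_div_eq_div_mul] at this
            rwa [show p + 1 + 1 + 2 * j = p + 2 * (j + 1) by ring]
        · rintro ⟨⟨h1, h2⟩, h3⟩ j hj
          cases j with
          | zero =>
            refine ⟨h1, ?_⟩
            simp only [mul_zero, add_zero, pow_zero, Nat.div_one]
            rw [h2]
            rcases Nat.mod_two_eq_zero_or_one v with h | h <;> simp [h]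
          | succ j =>
            have := h3 j (by omega)
            rw [pow_succ', ← Nat.div_div_eq_div_mul]
            rwa [show p + 1 + 1 + 2 * j = p + 2 * (j + 1) by ring] at this
      · rw [show p + 1 + 1 + 2 * (v / 2).size = p + 2 * ((v / 2).size + 1) by ring]

theorem encUnary_zero : encUnary 0 = [false] := rfl

theorem encUnary_succ (u : ℕ) : encUnary (u + 1) = true :: encUnary u := by
  simp [encUnary, encList, List.replicate_succ]

theorem length_encUnary (u : ℕ) : (encUnary u).length = u + 1 := by
  induction u with
  | zero => rfl
  | succ u ih => rw [encUnary_succ, List.length_cons, ih]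

theorem unAt_iff (u : ℕ) : ∀ p, unAt x p u ↔ At x p (encUnary u) := by
  induction u with
  | zero => intro p; simp [unAt, encUnary_zero, at_singleton]
  | succ u ih =>
    intro p
    rw [encUnary_succ, at_cons, ← ih, unAt, unAt, ← and_assoc]
    refine and_congr ?_ (by rw [show p + 1 + u = p + (u + 1) by ring])
    constructor
    · intro h
      refine ⟨h 0 (by omega), fun j hj => ?_⟩
      rw [show p + 1 + j = p + (j + 1) by ring]
      exact h (j + 1) (by omega)
    · rintro ⟨h1, h2⟩ j hj
      cases j with
      | zero => exact h1
      | succ j =>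
        rw [show p + (j + 1) = p + 1 + j by ring]
        exact h2 j (by omega)

theorem encBinary_ne_nil (v : ℕ) : encBinary v ≠ [] := by
  intro h; have := length_encBinary v; rw [h] at this; simp at this

theorem encUnary_ne_nil (v : ℕ) : encUnary v ≠ [] := by
  intro h; have := length_encUnary v; rw [h] at this; simp at this

theorem at_binVal {p : ℕ} (h : binVal x p ≤ x.length) : At x p (encBinary (binVal x p)) :=
  (binAt_iff _ _).1 ((bsearch_spec _ _).2.2 (Nat.lt_succ_of_le h))

/-- A binary code may denote a number outside the range of the search, hence the hypothesis `hv`.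
Entries of tuples satisfy it, as they are below the size of the universe, which is written in unary.
-/
theorem At.binVal_eq {p v : ℕ} (h : At x p (encBinary v)) (hv : v ≤ x.length) :
    binVal x p = v :=
  bsearch_eq (by omega) (fun _ => (binAt_iff _ _).2 h) fun j hj hj' =>
    hj.ne (At.unique uniqueRead_encBinary ((binAt_iff _ _).1 hj') h)

theorem At.binEnd_eq {p v : ℕ} (h : At x p (encBinary v)) (hv : v ≤ x.length) :
    binEnd x p = p + (encBinary v).length := by
  have := h.le (encBinary_ne_nil v)
  rw [binEnd, h.binVal_eq hv, length_encBinary] at *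
  omega

theorem at_unVal {p : ℕ} (h : unVal x p ≤ x.length) : At x p (encUnary (unVal x p)) :=
  (unAt_iff _ _).1 ((bsearch_spec _ _).2.2 (Nat.lt_succ_of_le h))

theorem At.unVal_eq {p v : ℕ} (h : At x p (encUnary v)) : unVal x p = v := by
  have hv : v ≤ x.length := by
    have := h.le (encUnary_ne_nil v)
    rw [length_encUnary] at this
    omega
  exact bsearch_eq (by omega) (fun _ => (unAt_iff _ _).2 h) fun j hj hj' =>
    hj.ne (At.unique uniqueRead_encUnary ((unAt_iff _ _).1 hj') h)

theorem At.unEnd_eq {p v : ℕ} (h : At x p (encUnary v)) :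
    unEnd x p = p + (encUnary v).length := by
  have := h.le (encUnary_ne_nil v)
  rw [unEnd, h.unVal_eq, length_encUnary] at *
  omega

/-! ### Sequences of words -/

/-- Length of the first `j` words. -/
def lenTake {α : Type} (e : α → List Bool) (L : List α) (j : ℕ) : ℕ := ((L.take j).flatMap e).length

variable {α : Type} {e : α → List Bool} {p : ℕ}

theorem lenTake_succ (L : List α) {j : ℕ} (hj : j < L.length) :
    lenTake e L (j + 1) = lenTake e L j + (e L[j]).length := by
  rw [lenTake, lenTake, List.take_succ_eq_append_getElem hj, List.flatMap_append,
    List.length_append, List.flatMap_singleton]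

theorem lenTake_length (L : List α) : lenTake e L L.length = (L.flatMap e).length := by
  rw [lenTake, List.take_length]

theorem at_flatMap (L : List α) :
    At x p (L.flatMap e) ↔ ∀ j (hj : j < L.length), At x (p + lenTake e L j) (e L[j]) := by
  induction L generalizing p with
  | nil => simp [at_nil]
  | cons a L ih =>
    rw [List.flatMap_cons, at_append, ih]
    constructor
    · rintro ⟨h1, h2⟩ j hj
      cases j with
      | zero => simpa [lenTake] using h1
      | succ j =>
        have := h2 j (by simpa using hj)
        simpa [lenTake, add_assoc] using this
    · intro h
      refine ⟨h 0 (by simp), fun j hj => ?_⟩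
      have := h (j + 1) (by simpa using hj)
      simpa [lenTake, add_assoc] using this

/-- This is the common pattern of the parsing functions: if `t` skips one word whenever that word is
present, its iterates skip initial segments of the sequence of words. -/
theorem At.iterRec_eq {L : List α} {t : ℕ → ℕ → ℕ} (h : At x p (L.flatMap e))
    (ht : ∀ j (hj : j < L.length) q, At x q (e L[j]) → t j q = q + (e L[j]).length) {j : ℕ}
    (hj : j ≤ L.length) : iterRec p t j = p + lenTake e L j := by
  induction j with
  | zero => simp [iterRec, lenTake]
  | succ j ih =>
    rw [iterRec, ih (by omega), ht j hj _ ((at_flatMap L).1 h j hj), lenTake_succ L hj, add_assoc]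

theorem At.at_iterRec {L : List α} {t : ℕ → ℕ → ℕ} (h : At x p (L.flatMap e))
    (ht : ∀ j (hj : j < L.length) q, At x q (e L[j]) → t j q = q + (e L[j]).length) {j : ℕ}
    (hj : j < L.length) : At x (iterRec p t j) (e L[j]) := by
  rw [h.iterRec_eq ht hj.le]
  exact (at_flatMap L).1 h j hj

/-- Words that are found one after the other. -/
theorem at_of_iterRec {L : List α} {t : ℕ → ℕ → ℕ}
    (h : ∀ j (hj : j < L.length), At x (iterRec p t j) (e L[j]) ∧
      (At x (iterRec p t j) (e L[j]) → t j (iterRec p t j) = iterRec p t j + (e L[j]).length)) :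
    At x p (L.flatMap e) ∧ iterRec p t L.length = p + (L.flatMap e).length := by
  have key : ∀ j ≤ L.length, iterRec p t j = p + lenTake e L j := by
    intro j hj
    induction j with
    | zero => simp [iterRec, lenTake]
    | succ j ih =>
      have h1 := (h j hj).2 (h j hj).1
      rw [iterRec, h1, ih (by omega), lenTake_succ L hj, add_assoc]
  refine ⟨(at_flatMap L).2 fun j hj => ?_, by rw [key _ le_rfl, lenTake_length]⟩
  rw [← key j hj.le]
  exact (h j hj).1

/-! ### Tuples and lists of tuples -/

theorem encTuple_eq {r n : ℕ} (t : Fin r → Fin n) :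
    encTuple t = (List.ofFn fun j => (t j : ℕ)).flatMap encBinary := rfl

theorem At.entry_eq {r n : ℕ} {t : Fin r → Fin n} (h : At x p (encTuple t)) (hn : n ≤ x.length) :
    entryPos x p r = p + (encTuple t).length ∧ ∀ l : Fin r, binVal x (entryPos x p l) = t l := by
  rw [encTuple_eq] at h
  have ht : ∀ j (hj : j < (List.ofFn fun j => (t j : ℕ)).length) q,
      At x q (encBinary (List.ofFn fun j => (t j : ℕ))[j]) →
      binEnd x q = q + (encBinary (List.ofFn fun j => (t j : ℕ))[j]).length := by
    intro j hj q hq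
    refine hq.binEnd_eq ?_
    simp only [List.getElem_ofFn]
    omega
  constructor
  · have := h.iterRec_eq (t := fun _ s => binEnd x s) ht le_rfl
    rw [lenTake_length, List.length_ofFn] at this
    exact this
  · intro l
    have := h.at_iterRec (t := fun _ s => binEnd x s) ht (j := l) (by simp)
    have h2 := this.binVal_eq (by simp only [List.getElem_ofFn]; omega)
    rw [List.getElem_ofFn] at h2
    exact h2

theorem at_encTuple {r n : ℕ} (hn : n ≤ x.length) (t : Fin r → Fin n)
    (ht : ∀ l : Fin r, binVal x (entryPos x p l) = t l) : At x p (encTuple t) := by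
  rw [encTuple_eq]
  refine (at_of_iterRec (t := fun _ s => binEnd x s) fun j hj => ?_).1
  have hj' : j < r := by simpa using hj
  rw [List.getElem_ofFn]
  have h1 := ht ⟨j, hj'⟩
  have h2 : At x (entryPos x p j) (encBinary (t ⟨j, hj'⟩)) := by
    rw [← h1]
    exact at_binVal (by simp only at h1; rw [h1]; omega)
  exact ⟨h2, fun h => h.binEnd_eq (by omega)⟩

theorem bitAt_at_encList {L : List α} (h : At x p (encList e L)) :
    (∀ j (_ : j < L.length), bitAt x (p + lenTake (fun a => true :: e a) L j) = 2) ∧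
      bitAt x (p + lenTake (fun a => true :: e a) L L.length) = 1 := by
  rw [encList, at_append, at_singleton] at h
  refine ⟨fun j hj => ?_, by rw [lenTake_length]; exact h.2⟩
  exact (at_cons.1 ((at_flatMap L).1 h.1 j hj)).1

theorem At.length_le_of_encList {L : List α} (h : At x p (encList e L)) : L.length < x.length := by
  have h1 := h.le (by simp [encList])
  have h2 : L.length ≤ (L.flatMap fun a => true :: e a).length := by
    rw [List.length_flatMap]
    calc L.length = (L.map fun _ => 1).sum := by simp
      _ ≤ _ := List.sum_le_sum fun a _ => by simp
  simp only [encList, List.length_append, List.length_singleton] at h1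
  omega

theorem At.list_eq {r n : ℕ} {L : List (Fin r → Fin n)} (h : At x p (encList encTuple L))
    (hn : n ≤ x.length) :
    listLen x r p = L.length ∧ listEnd x r p = p + (encList encTuple L).length ∧
      bitAt x (tuplePos x r p L.length) = 1 ∧
      ∀ q (hq : q < L.length) (l : Fin r),
        binVal x (entryPos x (tuplePos x r p q + 1) l) = L[q] l := by
  have h1 := bitAt_at_encList h
  have h2 := h.length_le_of_encList
  have h3 := h.le (by simp [encList])
  rw [encList, at_append] at h
  have ht : ∀ j (hj : j < L.length) q, At x q (true :: encTuple L[j]) →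
      entryPos x (q + 1) r = q + (true :: encTuple L[j]).length := by
    intro j hj q hq
    rw [((at_cons.1 hq).2.entry_eq hn).1, List.length_cons]
    omega
  have hpos : ∀ j ≤ L.length, tuplePos x r p j = p + lenTake (fun a => true :: encTuple a) L j :=
    fun j hj => h.1.iterRec_eq (t := fun _ s => entryPos x (s + 1) r) ht hj
  have hlen : listLen x r p = L.length := by
    refine bsearch_eq (by omega) (fun _ => ?_) fun j hj => ?_
    · rw [hpos _ le_rfl, h1.2]; omega
    · rw [hpos _ hj.le, h1.1 j hj]; simp
  refine ⟨hlen, ?_, by rw [hpos _ le_rfl, h1.2], fun q hq l => ?_⟩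
  · rw [listEnd, hlen, hpos _ le_rfl, lenTake_length]
    simp only [encList, List.length_append, List.length_singleton] at h3 ⊢
    omega
  · have := h.1.at_iterRec (t := fun _ s => entryPos x (s + 1) r) ht hq
    exact ((at_cons.1 this).2.entry_eq hn).2 l

/-- This is the converse direction to `At.list_eq`: on an arbitrary string that passes the tests,
the numbers delivered by the parser are assembled to tuples, and their code is what stands at `p`.
-/
theorem at_tuples {r n : ℕ} (hn : n ≤ x.length) (hend : bitAt x (tuplePos x r p (listLen x r p)) = 1)
    (h : ∀ q < listLen x r p, ∀ l < r, binVal x (entryPos x (tuplePos x r p q + 1) l) < n) :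
    ∃ L : List (Fin r → Fin n), L.length = listLen x r p ∧ At x p (encList encTuple L) := by
  let L : List (Fin r → Fin n) := List.ofFn fun q : Fin (listLen x r p) => fun l : Fin r =>
    ⟨binVal x (entryPos x (tuplePos x r p q + 1) l), h q q.2 l l.2⟩
  have hL : L.length = listLen x r p := by simp [L]
  refine ⟨L, hL, ?_⟩
  have key := at_of_iterRec (x := x) (p := p) (e := fun t => true :: encTuple t) (L := L)
    (t := fun _ s => entryPos x (s + 1) r) fun j hj => ?_
  · rw [encList, at_append, at_singleton, ← key.2, hL]
    exact ⟨key.1, hend⟩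
  · have hj' : j < listLen x r p := by rwa [hL] at hj
    have ha : At x (tuplePos x r p j + 1) (encTuple L[j]) :=
      at_encTuple hn _ fun l => by simp [L]
    refine ⟨at_cons.2 ⟨?_, ha⟩, fun h => ?_⟩
    · have := (bsearch_spec (x.length + 1) fun q => bitAt x (tuplePos x r p q) ≠ 2).2.1 j hj'
      exact not_not.1 this
    · change entryPos x (tuplePos x r p j + 1) r = tuplePos x r p j + _
      rw [List.length_cons, (ha.entry_eq hn).1]
      omega

end ParamLog

namespace ParamLog

variable {x : List Bool} {τ : Vocabulary} {s : ℕ}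

/-! ### Recognizing encodings of pairs of structures -/

def VocOK (x : List Bool) : Prop :=
  bitAt x (vocPos x (vocLen x)) = 1 ∧ ∀ j < vocLen x, vocAr x j ≤ x.length

/-- The code of a structure starts at position `s`. -/
def BodyOK (x : List Bool) (s : ℕ) : Prop :=
  0 < unVal x s ∧ unVal x s ≤ x.length ∧ ∀ i < vocLen x,
    bitAt x (tuplePos x (vocAr x i) (relPos x s i) (relLen x s i)) = 1 ∧
    (∀ q < relLen x s i, ∀ l < vocAr x i, entry x s i q l < unVal x s) ∧
    ∀ q < relLen x s i, ∀ q' < q, ∃ l < vocAr x i, entry x s i q l ≠ entry x s i q' l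

/-- Start of the code of the second structure. -/
noncomputable def sndPos (x : List Bool) : ℕ := bodyEnd x (vocEnd x)

def Valid (x : List Bool) : Prop :=
  VocOK x ∧ BodyOK x (vocEnd x) ∧ BodyOK x (sndPos x) ∧ bodyEnd x (sndPos x) = x.length

theorem At.voc_eq (h : At x 0 (encVocabulary τ)) :
    vocLen x = τ.m ∧ vocEnd x = (encVocabulary τ).length ∧ (∀ i : Fin τ.m, vocAr x i = τ.ar i) ∧
      VocOK x := by
  set L := List.ofFn τ.ar with hL
  have hLm : L.length = τ.m := by simp [hL]
  rw [encVocabulary, ← hL] at h ⊢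
  have h1 := bitAt_at_encList h
  have h2 := h.length_le_of_encList
  have h3 := h.le (by simp [encList])
  rw [encList, at_append] at h
  have ht : ∀ j (hj : j < L.length) q, At x q (true :: encUnary L[j]) →
      unEnd x (q + 1) = q + (true :: encUnary L[j]).length := by
    intro j hj q hq
    rw [(at_cons.1 hq).2.unEnd_eq, List.length_cons]
    omega
  have hpos : ∀ j ≤ L.length, vocPos x j = 0 + lenTake (fun a => true :: encUnary a) L j :=
    fun j hj => h.1.iterRec_eq (t := fun _ s => unEnd x (s + 1)) ht hj
  have hlen : vocLen x = L.length := by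
    refine bsearch_eq (by omega) (fun _ => ?_) fun j hj => ?_
    · rw [hpos _ le_rfl, h1.2]; omega
    · rw [hpos _ hj.le, h1.1 j hj]; simp
  have har : ∀ i (hi : i < L.length), vocAr x i = L[i] := fun i hi =>
    (at_cons.1 (h.1.at_iterRec (t := fun _ s => unEnd x (s + 1)) ht hi)).2.unVal_eq
  refine ⟨by rw [hlen, hLm], ?_, fun i => ?_, ?_, fun j hj => ?_⟩
  · rw [vocEnd, hlen, hpos _ le_rfl, lenTake_length]
    simp only [encList, List.length_append, List.length_singleton] at h3 ⊢
    omega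
  · rw [har i (by rw [hLm]; exact i.2)]
    simp [hL]
  · rw [hlen, hpos _ le_rfl, h1.2]
  · rw [hlen] at hj
    have := (at_cons.1 (h.1.at_iterRec (t := fun _ s => unEnd x (s + 1)) ht hj)).2.le
      (encUnary_ne_nil _)
    rw [length_encUnary] at this
    rw [har j hj]
    omega

theorem at_voc (h : VocOK x) : ∃ τ, At x 0 (encVocabulary τ) := by
  obtain ⟨hend, h⟩ := h
  refine ⟨⟨vocLen x, fun i => vocAr x i⟩, ?_⟩
  set L := List.ofFn fun i : Fin (vocLen x) => vocAr x i with hL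
  have hLm : L.length = vocLen x := by simp [hL]
  have key := at_of_iterRec (x := x) (p := 0) (e := fun t => true :: encUnary t) (L := L)
    (t := fun _ s => unEnd x (s + 1)) fun j hj => ?_
  · rw [encVocabulary, encList, at_append, at_singleton, ← hL, ← key.2, hLm]
    exact ⟨key.1, hend⟩
  · have hj' : j < vocLen x := by rwa [hLm] at hj
    have ha : At x (vocPos x j + 1) (encUnary L[j]) := by
      have := at_unVal (h j hj')
      simp only [hL, List.getElem_ofFn]
      exact this
    refine ⟨at_cons.2 ⟨?_, ha⟩, fun h => ?_⟩
    · have := (bsearch_spec (x.length + 1) fun q => bitAt x (vocPos x q) ≠ 2).2.1 j hj'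
      exact not_not.1 this
    · change unEnd x (vocPos x j + 1) = vocPos x j + _
      rw [List.length_cons, ha.unEnd_eq]
      omega

/-- The code of a structure with given lists of tuples. -/
def encBody (A : Str τ) (L : (i : Fin τ.m) → List (Fin (τ.ar i) → Fin A.n)) : List Bool :=
  encUnary A.n ++ (List.finRange τ.m).flatMap fun i => encList encTuple (L i)

theorem At.body_eq {A : Str τ} {L : (i : Fin τ.m) → List (Fin (τ.ar i) → Fin A.n)}
    (hv : At x 0 (encVocabulary τ)) (h : At x s (encBody A L)) :
    unVal x s = A.n ∧ A.n ≤ x.length ∧ bodyEnd x s = s + (encBody A L).length ∧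
      ∀ i : Fin τ.m, relLen x s i = (L i).length ∧
        bitAt x (tuplePos x (vocAr x i) (relPos x s i) (relLen x s i)) = 1 ∧
        ∀ q (hq : q < (L i).length) (l : Fin (τ.ar i)), entry x s i q l = (L i)[q] l := by
  obtain ⟨hm, -, har, -⟩ := hv.voc_eq
  rw [encBody, at_append] at h
  have hn : A.n ≤ x.length := by
    have := h.1.le (encUnary_ne_nil _)
    rw [length_encUnary] at this
    omega
  have ht : ∀ j (hj : j < (List.finRange τ.m).length) q,
      At x q (encList encTuple (L (List.finRange τ.m)[j])) →
      listEnd x (vocAr x j) q = q + (encList encTuple (L (List.finRange τ.m)[j])).length := by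
    intro j hj q hq
    have hj' : j < τ.m := by simpa using hj
    have h1 := har ⟨j, hj'⟩
    simp only at h1
    rw [h1]
    rw [List.getElem_finRange] at hq ⊢
    exact (hq.list_eq hn).2.1
  rw [← h.1.unEnd_eq] at h
  refine ⟨h.1.unVal_eq, hn, ?_, fun i => ?_⟩
  · have := h.2.iterRec_eq (t := fun j p => listEnd x (vocAr x j) p) ht le_rfl
    rw [lenTake_length, List.length_finRange, h.1.unEnd_eq] at this
    rw [bodyEnd, relPos, hm, h.1.unEnd_eq, this, encBody, List.length_append]
    omega
  · have := h.2.at_iterRec (t := fun j p => listEnd x (vocAr x j) p) ht (j := i) (by simp)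
    rw [List.getElem_finRange] at this
    obtain ⟨h1, -, h2, h3⟩ := this.list_eq hn
    have hr : relLen x s i = (L i).length := by
      rw [relLen, har i]
      exact h1
    refine ⟨hr, ?_, fun q hq l => ?_⟩
    · rw [har i, hr]
      exact h2
    · rw [entry, har i]
      exact h3 q hq l

theorem At.bodyOK {A : Str τ} {L : (i : Fin τ.m) → List (Fin (τ.ar i) → Fin A.n)}
    (hv : At x 0 (encVocabulary τ)) (h : At x s (encBody A L)) (hL : ∀ i, (L i).Nodup) :
    BodyOK x s := by
  obtain ⟨hm, -, har, -⟩ := hv.voc_eq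
  obtain ⟨h1, h2, h3, h4⟩ := At.body_eq hv h
  rw [BodyOK, h1]
  refine ⟨A.pos, h2, fun i hi => ?_⟩
  rw [hm] at hi
  obtain ⟨a1, a2, a3⟩ := h4 ⟨i, hi⟩
  have har' := har ⟨i, hi⟩
  simp only at a1 a2 a3 har'
  refine ⟨a2, fun q hq l hl => ?_, fun q hq q' hq' => ?_⟩
  · rw [har'] at hl
    rw [a1] at hq
    rw [a3 q hq ⟨l, hl⟩]
    exact Fin.is_lt _
  · rw [a1] at hq
    by_contra hcon
    push Not at hcon
    have : (L ⟨i, hi⟩)[q] = (L ⟨i, hi⟩)[q'] := by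
      funext l
      have := hcon l (by rw [har']; exact l.2)
      rw [a3 q hq l, a3 q' (by omega) l] at this
      exact Fin.ext this
    exact hq'.ne' ((hL ⟨i, hi⟩).getElem_inj_iff.1 this)

/-- The structure is assembled from the numbers that the parser returns. That the lists have no
repetitions follows from the last clause of `BodyOK`, after `At.body_eq` has identified the entries.
-/
theorem BodyOK.at_body (hv : At x 0 (encVocabulary τ)) (h : BodyOK x s) :
    ∃ (A : Str τ) (L : (i : Fin τ.m) → List (Fin (τ.ar i) → Fin A.n)), (∀ i, (L i).Nodup) ∧
      (∀ i t, t ∈ L i ↔ t ∈ A.rel i) ∧ At x s (encBody A L) := by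
  classical
  obtain ⟨hm, -, har, -⟩ := hv.voc_eq
  obtain ⟨hpos, hn, hrel⟩ := h
  have hex : ∀ i : Fin τ.m, ∃ L : List (Fin (τ.ar i) → Fin (unVal x s)),
      L.length = relLen x s i ∧ At x (relPos x s i) (encList encTuple L) := by
    intro i
    obtain ⟨h1, h2, -⟩ := hrel i (by rw [hm]; exact i.2)
    rw [relLen, har i] at h1
    obtain ⟨L, hL1, hL2⟩ := at_tuples hn h1 (fun q hq l hl => by
      have := h2 q (by rw [relLen, har i]; exact hq) l (by rw [har i]; exact hl)
      rwa [entry, har i] at this)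
    exact ⟨L, by rw [hL1, relLen, har i], hL2⟩
  choose L hL1 hL2 using hex
  let A : Str τ := ⟨unVal x s, hpos, fun i => (L i).toFinset⟩
  have hat : At x s (encBody A L) := by
    have hu := at_unVal hn
    rw [encBody, at_append, ← hu.unEnd_eq]
    refine ⟨hu, (at_of_iterRec (t := fun j p => listEnd x (vocAr x j) p) fun j hj => ?_).1⟩
    have hj' : j < τ.m := by simpa using hj
    have h1 := har ⟨j, hj'⟩
    simp only at h1
    rw [List.getElem_finRange, h1]
    exact ⟨hL2 ⟨j, hj'⟩, fun h => (h.list_eq hn).2.1⟩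
  refine ⟨A, L, fun i => ?_, fun i t => by simp [A], hat⟩
  obtain ⟨-, -, -, h4⟩ := At.body_eq hv hat
  obtain ⟨-, -, h6⟩ := hrel i (by rw [hm]; exact i.2)
  obtain ⟨a1, -, a3⟩ := h4 i
  rw [List.nodup_iff_injective_getElem]
  have key : ∀ q q' : Fin (L i).length, (q' : ℕ) < q → (L i)[(q : ℕ)] ≠ (L i)[(q' : ℕ)] := by
    intro q q' hq heq
    obtain ⟨l, hl, hne⟩ := h6 q (by rw [a1]; exact q.2) q' hq
    rw [har i] at hl
    refine hne ?_
    have e1 := a3 q q.2 ⟨l, hl⟩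
    have e2 := a3 q' q'.2 ⟨l, hl⟩
    rw [heq] at e1
    exact e1.trans e2.symm
  intro q q' hqq
  rcases lt_trichotomy (q : ℕ) q' with h | h | h
  · exact absurd hqq.symm (key _ _ h)
  · exact Fin.ext h
  · exact absurd hqq (key _ _ h)

/-- The functions for parsing return the data of the structure `A`. -/
structure Reads (x : List Bool) (s : ℕ) (A : Str τ) : Prop where
  univ : unVal x s = A.n
  len : ∀ i : Fin τ.m, relLen x s i = (A.rel i).card
  mem : ∀ (i : Fin τ.m) (t : Fin (τ.ar i) → Fin A.n), t ∈ A.rel i ↔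
    ∃ q < relLen x s i, ∀ l : Fin (τ.ar i), entry x s i q l = t l
  read : ∀ (i : Fin τ.m), ∀ q < relLen x s i, ∃ t ∈ A.rel i, ∀ l : Fin (τ.ar i),
    entry x s i q l = t l

theorem At.reads {A : Str τ} {L : (i : Fin τ.m) → List (Fin (τ.ar i) → Fin A.n)}
    (hv : At x 0 (encVocabulary τ)) (h : At x s (encBody A L))
    (hL : ∀ i, (L i).Nodup ∧ ∀ t, t ∈ L i ↔ t ∈ A.rel i) : Reads x s A := by
  classical
  obtain ⟨h1, h2, h3, h4⟩ := At.body_eq hv h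
  refine ⟨h1, fun i => ?_, fun i t => ?_, fun i q hq => ?_⟩
  · have : A.rel i = (L i).toFinset := by ext t; simp [(hL i).2]
    rw [(h4 i).1, this, List.toFinset_card_of_nodup (hL i).1]
  · rw [← (hL i).2, List.mem_iff_getElem, (h4 i).1]
    constructor
    · rintro ⟨q, hq, rfl⟩
      exact ⟨q, hq, fun l => (h4 i).2.2 q hq l⟩
    · rintro ⟨q, hq, h⟩
      exact ⟨q, hq, funext fun l => Fin.ext (by rw [← (h4 i).2.2 q hq l, h l])⟩
  · rw [(h4 i).1] at hq
    exact ⟨(L i)[q], ((hL i).2 _).1 (List.getElem_mem _), fun l => (h4 i).2.2 q hq l⟩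

theorem at_zero_iff {w : List Bool} : At x 0 w ↔ w <+: x := by rw [At, List.drop_zero]

theorem EncodesPair.facts {A B : Str τ} (h : EncodesPair x A B) :
    Valid x ∧ At x 0 (encVocabulary τ) ∧ Reads x (vocEnd x) A ∧ Reads x (sndPos x) B ∧
      Encodes (x.take (sndPos x)) A ∧ sndPos x ≤ x.length := by
  obtain ⟨y, z, ⟨L, hL, hy⟩, ⟨L', hL', hz⟩, hx⟩ := h
  have hy' : y = encBody A L := hy
  have hz' : z = encBody B L' := hz
  have hall : At x 0 (encVocabulary τ ++ encBody A L ++ encBody B L') := by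
    rw [at_zero_iff, ← hy', ← hz', ← hx]
  obtain ⟨h12, h3⟩ := at_append.1 hall
  obtain ⟨h1, h2⟩ := at_append.1 h12
  obtain ⟨hm, he, har, hok⟩ := h1.voc_eq
  rw [zero_add, ← he] at h2
  have hb := (At.body_eq h1 h2).2.2.1
  have hs : sndPos x = (encVocabulary τ ++ encBody A L).length := by
    rw [sndPos, hb, he, List.length_append]
  rw [zero_add, ← hs] at h3
  have hb' := (At.body_eq h1 h3).2.2.1
  refine ⟨⟨hok, At.bodyOK h1 h2 fun i => (hL i).1, At.bodyOK h1 h3 fun i => (hL' i).1, ?_⟩, h1,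
    h1.reads h2 hL, h1.reads h3 hL', ⟨y, ⟨L, hL, hy⟩, ?_⟩, ?_⟩
  · rw [hb', hs, hx, hy', hz']
    simp only [List.length_append]
  · rw [hs, hx, ← hy', List.take_left]
  · rw [hs, hx, ← hy']
    simp only [List.length_append]
    omega

theorem Valid.encodes (h : Valid x) : ∃ τ, ∃ A B : Str τ, EncodesPair x A B := by
  obtain ⟨hv, hA, hB, hend⟩ := h
  obtain ⟨τ, h1⟩ := at_voc hv
  obtain ⟨A, L, hL1, hL2, h2⟩ := hA.at_body h1
  obtain ⟨B, L', hL1', hL2', h3⟩ := hB.at_body h1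
  obtain ⟨hm, he, har, hok⟩ := h1.voc_eq
  have hb := (At.body_eq h1 h2).2.2.1
  have hb' := (At.body_eq h1 h3).2.2.1
  have hs : sndPos x = (encVocabulary τ ++ encBody A L).length := by
    rw [sndPos, hb, he, List.length_append]
  have hall : At x 0 (encVocabulary τ ++ encBody A L ++ encBody B L') := by
    rw [at_append, at_append, zero_add, zero_add, ← he, ← hs]
    exact ⟨⟨h1, h2⟩, h3⟩
  refine ⟨τ, A, B, encBody A L, encBody B L', ⟨L, fun i => ⟨hL1 i, hL2 i⟩, rfl⟩,
    ⟨L', fun i => ⟨hL1' i, hL2' i⟩, rfl⟩, ?_⟩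
  refine ((at_zero_iff.1 hall).eq_of_length ?_).symm
  rw [← hend, hb', hs]
  simp only [List.length_append]

/-- The size of the first structure. -/
noncomputable def sizeVal (x : List Bool) : ℕ :=
  vocLen x + unVal x (vocEnd x) +
    ∑ i ∈ Finset.range (vocLen x), relLen x (vocEnd x) i * vocAr x i

theorem EncodesPair.sizeVal_eq {A B : Str τ} (h : EncodesPair x A B) : sizeVal x = A.size := by
  obtain ⟨-, h1, h2, -⟩ := h.facts
  obtain ⟨hm, -, har, -⟩ := h1.voc_eq
  rw [sizeVal, Str.size, hm, h2.univ, ← Fin.sum_univ_eq_sum_range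
    (fun i => relLen x (vocEnd x) i * vocAr x i)]
  congr 1
  exact Finset.sum_congr rfl fun i _ => by rw [h2.len, har]

open Classical in
-- This replaces the choice in the definition of the parameter by functions that counter programs
-- compute on every string.
theorem embParam_eq_ite : embParam x = if Valid x then sizeVal x else 0 := by
  split
  · next h =>
    obtain ⟨τ, A, B, h⟩ := h.encodes
    rw [embParam_eq h, h.sizeVal_eq]
  · next h =>
    rw [embParam, dif_neg]
    rintro ⟨k, τ, A, B, h', -⟩
    exact h h'.facts.1

variable {n : ℕ} {f : List Bool → (Fin n → ℕ) → ℕ}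

theorem pd_vocOK : PD (n := n) fun x _ => VocOK x :=
  (PD.eq (pc_vocPos pc_vocLen).bitAt (.const 1)).and
    (PD.ball (p := fun x _ j => vocAr x j ≤ x.length) pc_vocLen
      (PD.le (pc_vocAr (PC.var 0)) PC.len))

theorem pd_bodyOK (hf : PC f) : PD fun x v => BodyOK x (f x v) := by
  refine PD.comp1 (P := fun x v => BodyOK x (v 0)) ?_ hf
  refine PD.and (PD.lt (.const 0) (pc_unVal (PC.var 0))) (PD.and (PD.le (pc_unVal (PC.var 0)) .len)
    (PD.ball (p := fun x v i => bitAt x (tuplePos x (vocAr x i) (relPos x (v 0) i)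
      (relLen x (v 0) i)) = 1 ∧ (∀ q < relLen x (v 0) i, ∀ l < vocAr x i,
        entry x (v 0) i q l < unVal x (v 0)) ∧ ∀ q < relLen x (v 0) i, ∀ q' < q,
          ∃ l < vocAr x i, entry x (v 0) i q l ≠ entry x (v 0) i q' l) pc_vocLen
      (PD.and ?_ (PD.and ?_ ?_))))
  · exact PD.eq (pc_tuplePos (pc_vocAr (PC.var 0)) (pc_relPos (PC.var 1) (PC.var 0))
      (pc_relLen (PC.var 1) (PC.var 0))).bitAt (.const 1)
  · refine PD.ball (p := fun x v q => ∀ l < vocAr x (v 0),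
        entry x (v 1) (v 0) q l < unVal x (v 1)) (pc_relLen (PC.var 1) (PC.var 0))
      (PD.ball (p := fun x v l => entry x (v 2) (v 1) (v 0) l < unVal x (v 2))
        (pc_vocAr (PC.var 1)) (PD.lt (pc_entry (PC.var 3) (PC.var 2) (PC.var 1) (PC.var 0))
          (pc_unVal (PC.var 3))))
  · refine PD.ball (p := fun x v q => ∀ q' < q, ∃ l < vocAr x (v 0),
        entry x (v 1) (v 0) q l ≠ entry x (v 1) (v 0) q' l) (pc_relLen (PC.var 1) (PC.var 0))
      (PD.ball (p := fun x v q' => ∃ l < vocAr x (v 1),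
        entry x (v 2) (v 1) (v 0) l ≠ entry x (v 2) (v 1) q' l) (PC.var 0)
        (PD.bex (p := fun x v l => entry x (v 3) (v 2) (v 1) l ≠ entry x (v 3) (v 2) (v 0) l)
          (pc_vocAr (PC.var 2)) (PD.not (PD.eq
            (pc_entry (PC.var 4) (PC.var 3) (PC.var 2) (PC.var 0))
            (pc_entry (PC.var 4) (PC.var 3) (PC.var 1) (PC.var 0))))))

theorem pc_sndPos : PC (n := n) fun x _ => sndPos x := pc_bodyEnd pc_vocEnd

theorem pd_valid : PD (n := n) fun x _ => Valid x :=
  pd_vocOK.and ((pd_bodyOK pc_vocEnd).and ((pd_bodyOK pc_sndPos).and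
    (PD.eq (pc_bodyEnd pc_sndPos) PC.len)))

theorem pc_sizeVal : PC (n := n) fun x _ => sizeVal x :=
  (pc_vocLen.add (pc_unVal pc_vocEnd)).add
    (PC.sum (g := fun x _ i => relLen x (vocEnd x) i * vocAr x i) pc_vocLen
      ((pc_relLen pc_vocEnd (PC.var 0)).mul (pc_vocAr (PC.var 0))))

theorem pc_embParam : PC (n := n) fun x _ => embParam x := by
  classical
  exact (PC.ite pd_valid pc_sizeVal (.const 0)).of_eq fun x v => by
    rw [embParam_eq_ite]

end ParamLog

namespace ParamLog

/-! ## The parameter is computable in logarithmic space -/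

/-- The value is computed into a fresh register first, so in contrast to `Sem` the target may be one
of the arguments. -/
theorem Sem.assign {n : ℕ} {D : List Bool → (Fin n → ℕ) → ℕ → ℕ → Prop} (hD : Sem D)
    (ins : Fin n → ℕ) (out base : ℕ) (h1 : ∀ i, ins i < base) (h2 : out < base) :
    ∃ P : Prog, ∀ x V y σ, D x (fun i => σ.reg (ins i)) y V → y ≤ V → ∃ σ', Ev x V P σ [] σ' ∧
      (∀ r < base, σ'.reg r = Function.update σ.reg out y r) ∧ σ'.out = σ.out := by
  obtain ⟨P, hP⟩ := hD
  refine ⟨.seq (P ins base (base + 1)) (.copy base out (base + 1)), fun x V y σ hy hV => ?_⟩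
  obtain ⟨σ1, e1, a1, a2, a3⟩ := hP ins base (base + 1) (fun i => (h1 i).trans (by omega))
    (by omega) (fun i => (h1 i).ne) x y V σ hy
  obtain ⟨σ2, e2, b1, b2, b3⟩ := ev_copy (x := x) (V := V) (src := base) (dst := out)
    (tmp := base + 1) (by omega) (by omega) (by omega) σ1 (by rw [a1]; exact hV)
  refine ⟨σ2, .seq' e1 e2, fun r hr => ?_, b3.trans a3⟩
  by_cases hro : r = out
  · subst hro
    rw [Function.update_self, b1, a1]
  · rw [Function.update_of_ne hro, b2 r hro (by omega), a2 r (by omega) (by omega)]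

/-- An assignment of a function value to a register. -/
theorem PC.assign {n : ℕ} {f : List Bool → (Fin n → ℕ) → ℕ} (hf : PC f) (ins : Fin n → ℕ)
    (out base : ℕ) (h1 : ∀ i, ins i < base) (h2 : out < base) :
    ∃ c, ∃ P : Prog, ∀ x V B σ, Big x (fun i => σ.reg (ins i)) B → B ^ c ≤ V →
      ∃ σ', Ev x V P σ [] σ' ∧
        (∀ r < base, σ'.reg r = Function.update σ.reg out (f x fun i => σ.reg (ins i)) r) ∧
        σ'.out = σ.out := by
  obtain ⟨c, hc, hf⟩ := hf
  obtain ⟨P, hP⟩ := hf.assign ins out base h1 h2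
  exact ⟨c, P, fun x V B σ hB hV => hP x V _ σ ⟨rfl, B, hB, hV⟩ ((hc _ _ _ hB).trans hV)⟩

/-- This turns bounds on counters into bounds on space: a number that is polynomial in `2 ^ s` has a
binary length linear in `s`. -/
theorem size_pow_le {b s : ℕ} (c : ℕ) (h : b ≤ 2 ^ s) : (b ^ c).size ≤ s * c + 1 := by
  rw [Nat.size_le, pow_succ, pow_mul]
  have := Nat.pow_le_pow_left h c
  have : 0 < (2 ^ s) ^ c := by positivity
  omega

theorem length_le_pow (x : List Bool) : x.length + 2 ≤ 2 ^ (Nat.log 2 x.length + 2) := by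
  have := Nat.lt_pow_succ_log_self (b := 2) (by omega) x.length
  have h2 : 2 ^ (Nat.log 2 x.length + 2) = 2 * 2 ^ (Nat.log 2 x.length).succ := by
    rw [← pow_succ']
  have : 1 ≤ 2 ^ Nat.log 2 x.length := Nat.one_le_two_pow
  rw [Nat.succ_eq_add_one, pow_succ] at *
  omega

theorem TuringMachine.RunsInSpace.mono {M : TuringMachine} {x : List Bool} {s t : ℕ}
    (h : M.RunsInSpace x s) (hst : s ≤ t) : M.RunsInSpace x t :=
  fun l hl c hc i => (h l hl c hc i).trans_le hst

/-- The value is computed into register `0`, and its bits are emitted by repeated division by two.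
No coin is tossed, so the guess budget is zero. -/
theorem logSpaceComputable_of_pc {κ : List Bool → ℕ} (hκ : PC (n := 0) fun x _ => κ x) :
    LogSpaceComputable κ := by
  obtain ⟨c0, h0⟩ := hκ.bound
  obtain ⟨c1, P1, h1⟩ := hκ.assign (fun i => i.elim0) 0 2 (fun i => i.elim0) (by omega)
  obtain ⟨c2, P2, h2⟩ := ((PC.var 0).mod (.const 2) : PC (n := 1) fun _ v => v 0 % 2).assign
    (fun _ => 0) 1 2 (fun i => by omega) (by omega)
  obtain ⟨c3, P3, h3⟩ := ((PC.var 0).div (.const 2) : PC (n := 1) fun _ v => v 0 / 2).assign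
    (fun _ => 0) 0 2 (fun i => by omega) (by omega)
  set body : Prog := .seq P2 (.seq (.ite (.reg 1) (.emit true) (.emit false)) P3) with hbody
  obtain ⟨M, hM⟩ := exists_machine (.seq P1 (.loop (.reg 0) body)) 0
  -- Inside the loop register `0` may be as large as `B ^ c0`, so that `B ^ (c0 + 1)` takes the role
  -- of `B`; this multiplies the exponents of the programs of the loop.
  set C := (c0 + 1) * (c1 + c2 + c3) with hC
  refine ⟨M, 2 * C + 3, fun x => ?_⟩
  set B := x.length + 2 with hB
  set V := B ^ C with hV
  have hBB : ∀ i j, i ≤ j → B ^ i ≤ B ^ j := fun i j h => Nat.pow_le_pow_right (by omega) h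
  have hbig0 : Big x (fun i : Fin 0 => Mem.init.reg (i.elim0)) B :=
    ⟨by omega, by omega, fun i => i.elim0⟩
  have hloop : ∀ m, m ≤ B ^ c0 → ∀ σ : Mem, σ.reg 0 = m → ∃ σ',
      Ev x V (.loop (.reg 0) body) σ [] σ' ∧ σ'.out = σ.out ++ Nat.bits m := by
    intro m
    induction m using Nat.strong_induction_on with
    | _ m ih =>
      intro hm σ hσ
      have ht := TestEv.reg (x := x) (σ := σ) 0
      by_cases hm0 : m = 0
      · subst hm0
        exact ⟨σ, .loop_false (by simpa [hσ] using ht), by simp⟩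
      have hbig : ∀ τ : Mem, τ.reg 0 = m → Big x (fun _ : Fin 1 => τ.reg 0) (B ^ (c0 + 1)) := by
        intro τ hτ
        have h1 : B ≤ B ^ (c0 + 1) := by simpa using hBB 1 (c0 + 1) (by omega)
        exact ⟨by omega, by omega, fun i => by
          have := hBB c0 (c0 + 1) (by omega)
          dsimp only
          omega⟩
      have hVle : ∀ i, i ≤ c1 + c2 + c3 → (B ^ (c0 + 1)) ^ i ≤ V := fun i hi => by
        rw [← pow_mul]
        exact hBB _ _ (Nat.mul_le_mul_left _ hi)
      obtain ⟨σ1, e1, a1, a2⟩ := h2 x V _ σ (hbig σ hσ) (hVle _ (by omega))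
      have b0 : σ1.reg 0 = m := by rw [a1 0 (by omega)]; simpa using hσ
      have b1 : σ1.reg 1 = m % 2 := by rw [a1 1 (by omega)]; simp [hσ]
      have ht1 := TestEv.reg (x := x) (σ := σ1) 1
      rw [b1] at ht1
      have e2 : Ev x V (.ite (.reg 1) (.emit true) (.emit false)) σ1 []
          { σ1 with out := σ1.out ++ [decide (m % 2 = 1)] } := by
        refine .ite (g := []) ht1 ?_
        rcases Nat.mod_two_eq_zero_or_one m with h | h <;> simp only [h]
        · exact .emit _ _
        · exact .emit _ _
      obtain ⟨σ3, e3, d1, d2⟩ := h3 x V _ { σ1 with out := σ1.out ++ [decide (m % 2 = 1)] }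
        (hbig _ b0) (hVle _ (by omega))
      have d0 : σ3.reg 0 = m / 2 := by rw [d1 0 (by omega)]; simp [b0]
      obtain ⟨σ4, e4, f1⟩ := ih (m / 2) (by omega) (by omega) σ3 d0
      refine ⟨σ4, .loop_true (g := []) (g' := []) (by simpa [hσ, hm0] using ht)
        (.seq' e1 (.seq' e2 e3)) e4, ?_⟩
      rw [f1, d2, a2, bits_of_ne hm0]
      simp
  obtain ⟨σ1, e1, a1, a2⟩ := h1 x V B Mem.init ⟨by omega, by omega, fun i => i.elim0⟩
    (hBB _ _ (by rw [hC]; nlinarith))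
  have b0 : σ1.reg 0 = κ x := by rw [a1 0 (by omega)]; simp
  obtain ⟨σ2, e2, f1⟩ := hloop (κ x) (h0 x _ B hbig0) σ1 b0
  have hall : ∀ g : List Bool, g.length = 0 → ∃ σ', Ev x V (.seq P1 (.loop (.reg 0) body))
      Mem.init g σ' := by
    intro g hg
    rw [List.length_eq_zero_iff.1 hg]
    exact ⟨σ2, .seq' e1 e2⟩
  obtain ⟨r1, r2, -, r3⟩ := hM x V 0 hall
  refine ⟨r2, r1.mono ?_, ?_⟩
  · have := size_pow_le C (length_le_pow x)
    rw [hV]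
    nlinarith
  · have := r3 [] σ2 rfl (.seq' e1 e2)
    rwa [f1, a2] at this

theorem logSpaceComputable_embParam : LogSpaceComputable embParam :=
  logSpaceComputable_of_pc pc_embParam

end ParamLog

namespace ParamLog

/-! ## General recursive functions -/

/-- This is unbounded search. Register `base` holds the candidate, `base + 1` the value of the test,
and `base + 2` a flag that keeps the loop running; `1 ≤ V` is needed for the flag. -/
theorem Sem.find {n : ℕ} {E : List Bool → (Fin (n + 1) → ℕ) → ℕ → ℕ → Prop} (hE : Sem E) :
    Sem (n := n) fun x v y V => (∀ k < y, E x (Fin.cons k v) 0 V) ∧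
      (∃ z ≠ 0, E x (Fin.cons y v) z V) ∧ y ≤ V ∧ 1 ≤ V := by
  obtain ⟨Q, hQ⟩ := hE
  refine ⟨fun ins out base => .seq (.clear (base + 2)) (.seq (.inc (base + 2)) (.seq (.clear base)
    (.seq (.loop (.reg (base + 2)) (.seq (Q (Fin.cons base ins) (base + 1) (base + 3))
      (.ite (.reg (base + 1)) (.clear (base + 2)) (.inc base)))) (.copy base out (base + 3))))),
    fun ins out base h1 h2 h3 x y V σ ⟨h4, ⟨z, hz, h5⟩, h6, h7⟩ => ?_⟩
  have hv : ∀ (τ : Mem) k, τ.reg base = k → (∀ r < base, τ.reg r = σ.reg r) →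
      (fun i => τ.reg ((Fin.cons base ins : Fin (n + 1) → ℕ) i)) =
        Fin.cons k fun i => σ.reg (ins i) := by
    intro τ k hk hτ
    funext i
    refine Fin.cases ?_ (fun i => ?_) i
    · simpa using hk
    · simpa using hτ _ (h1 i)
  have hins : ∀ i, (Fin.cons base ins : Fin (n + 1) → ℕ) i < base + 3 := fun i =>
    Fin.cases (by simp) (fun i => by have := h1 i; simp only [Fin.cons_succ]; omega) i
  have hins' : ∀ i, (Fin.cons base ins : Fin (n + 1) → ℕ) i ≠ base + 1 := fun i =>
    Fin.cases (by simp) (fun i => by have := h1 i; simp only [Fin.cons_succ]; omega) i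
  have key : ∀ d k (τ : Mem), k + d = y → τ.reg base = k → τ.reg (base + 2) = 1 →
      (∀ r < base, τ.reg r = σ.reg r) → ∃ τ', Ev x V (.loop (.reg (base + 2))
        (.seq (Q (Fin.cons base ins) (base + 1) (base + 3))
        (.ite (.reg (base + 1)) (.clear (base + 2)) (.inc base)))) τ [] τ' ∧ τ'.reg base = y ∧
        (∀ r < base, τ'.reg r = σ.reg r) ∧ τ'.out = τ.out := by
    intro d
    induction d with
    | zero =>
      intro k τ hk a1 a2 a3
      obtain rfl : k = y := hk
      have ht := TestEv.reg (x := x) (σ := τ) (base + 2)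
      rw [a2] at ht
      obtain ⟨τ1, e1, b1, b2, b3⟩ := hQ (Fin.cons base ins) (base + 1) (base + 3) hins (by omega)
        hins' x z V τ (by rw [hv τ _ a1 a3]; exact h5)
      have ht1 := TestEv.reg (x := x) (σ := τ1) (base + 1)
      rw [b1] at ht1
      simp only [hz, ne_eq, not_false_eq_true, decide_true] at ht1
      refine ⟨τ1.set (base + 2) 0, .loop_true (g := []) (g' := []) (by simpa using ht)
        (.seq' e1 (.ite (g := []) ht1 (ev_clear _ _))) (.loop_false ?_), ?_, fun r hr => ?_, b3⟩
      · simpa using TestEv.reg (x := x) (σ := τ1.set (base + 2) 0) (base + 2)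
      · rw [Mem.set_reg_of_ne _ _ (by omega), b2 _ (by omega) (by omega), a1]
      · rw [Mem.set_reg_of_ne _ _ (by omega), b2 _ (by omega) (by omega), a3 r hr]
    | succ d ih =>
      intro k τ hk a1 a2 a3
      have ht := TestEv.reg (x := x) (σ := τ) (base + 2)
      rw [a2] at ht
      obtain ⟨τ1, e1, b1, b2, b3⟩ := hQ (Fin.cons base ins) (base + 1) (base + 3) hins (by omega)
        hins' x 0 V τ (by rw [hv τ _ a1 a3]; exact h4 k (by omega))
      have ht1 := TestEv.reg (x := x) (σ := τ1) (base + 1)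
      rw [b1] at ht1
      simp only [ne_eq, not_true_eq_false, decide_false] at ht1
      have hb := b2 base (by omega) (by omega)
      obtain ⟨τ2, e2, c1, c2, c3⟩ := ih (k + 1) (τ1.set base (τ1.reg base + 1)) (by omega)
        (by rw [Mem.set_reg_self, hb, a1]) (by
          rw [Mem.set_reg_of_ne _ _ (by omega), b2 _ (by omega) (by omega), a2]) fun r hr => by
          rw [Mem.set_reg_of_ne _ _ (by omega), b2 _ (by omega) (by omega), a3 r hr]
      exact ⟨τ2, .loop_true (g := []) (g' := []) (by simpa using ht)
        (.seq' e1 (.ite (g := []) ht1 (.inc _ _ (by omega)))) e2, c1, c2, by rw [c3, Mem.set_out, b3]⟩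
  obtain ⟨τ, e, a1, a2, a3⟩ := key y 0 (((σ.set (base + 2) 0).set (base + 2) 1).set base 0)
    (by omega) (by simp) (by rw [Mem.set_reg_of_ne _ _ (by omega)]; simp) fun r hr => by
      rw [Mem.set_reg_of_ne _ _ (by omega), Mem.set_reg_of_ne _ _ (by omega),
        Mem.set_reg_of_ne _ _ (by omega)]
  obtain ⟨τ', e', b1, b2, b3⟩ := ev_copy (x := x) (V := V) (src := base) (dst := out)
    (tmp := base + 3) (by omega) (by omega) (by omega) τ (by omega)
  have hinc := Ev.inc (x := x) (V := V) (base + 2) (σ.set (base + 2) 0) (by simpa using h7)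
  rw [Mem.set_reg_self] at hinc
  exact ⟨τ', .seq' (ev_clear _ _) (.seq' hinc (.seq' (ev_clear _ _) (.seq' e e'))), by rw [b1, a1],
    fun r hr hr' => by rw [b2 r hr' (by omega), a2 r hr], by rw [b3, a3]; rfl⟩

theorem primrec_fin_sum {α : Type*} [Primcodable α] {m : ℕ} {f : Fin m → α → ℕ}
    (hf : ∀ i, Primrec (f i)) : Primrec fun a => ∑ i, f i a := by
  induction m with
  | zero => simpa using Primrec.const 0
  | succ m ih =>
    simp only [Fin.sum_univ_succ]
    exact Primrec.nat_add.comp (hf 0) (ih fun i => hf i.succ)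

theorem ofFn_cons {n : ℕ} (a : ℕ) (v : Fin n → ℕ) :
    List.Vector.ofFn (Fin.cons a v : Fin (n + 1) → ℕ) = a ::ᵥ List.Vector.ofFn v := by
  simp [List.Vector.ofFn]

/-- Primitive recursive functions have counter programs with primitive recursive bounds. -/
theorem sem_of_primrec' {n : ℕ} {f : List.Vector ℕ n → ℕ} (hf : Nat.Primrec' f) :
    ∃ b : List.Vector ℕ n → ℕ, Primrec b ∧ Sem fun _ v y V =>
      y = f (.ofFn v) ∧ b (.ofFn v) ≤ V := by
  induction hf with
  | zero => exact ⟨fun _ => 0, Primrec.const 0, sem_zero.mono fun x v y V h => ⟨V, le_rfl, h.1⟩⟩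
  | succ =>
    refine ⟨fun v => v.head + 1, Primrec.succ.comp Primrec.vector_head, sem_succ.mono ?_⟩
    rintro x v y V ⟨h1, h2⟩
    dsimp only at h1 h2
    have : (List.Vector.ofFn v).head = v 0 := by
      rw [← List.Vector.get_zero, List.Vector.get_ofFn]
    rw [this] at h1 h2
    exact ⟨V, le_rfl, h1, h2⟩
  | get i =>
    refine ⟨fun v => v.get i, Primrec.vector_get.comp Primrec.id (Primrec.const i),
      (sem_proj i).mono ?_⟩
    rintro x v y V ⟨h1, h2⟩
    dsimp only at h1 h2
    rw [List.Vector.get_ofFn] at h1 h2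
    exact ⟨V, le_rfl, h1, h2⟩
  | @comp m n f g hf hg ihf ihg =>
    obtain ⟨b, hb, hf'⟩ := ihf
    choose c hc hg' using ihg
    refine ⟨fun v => b (.ofFn fun i => g i v) + ∑ i, c i v, ?_, (Sem.comp hf' hg').mono ?_⟩
    · exact Primrec.nat_add.comp (hb.comp (Primrec.vector_ofFn fun i => (hg i).to_prim))
        (primrec_fin_sum hc)
    · rintro x v y V ⟨h1, h2⟩
      dsimp only at h1 h2
      refine ⟨V, le_rfl, fun i => g i (.ofFn v), fun i => ⟨rfl, ?_⟩, h1, by omega⟩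
      have := Finset.single_le_sum (f := fun i => c i (.ofFn v)) (fun _ _ => Nat.zero_le _)
        (Finset.mem_univ i)
      omega
  | @prec n f g hf hg ihf ihg =>
    obtain ⟨b, hb, hf'⟩ := ihf
    obtain ⟨c, hc, hg'⟩ := ihg
    let s : List.Vector ℕ (n + 1) → ℕ → ℕ := fun v k =>
      Nat.rec (f v.tail) (fun y IH => g (y ::ᵥ IH ::ᵥ v.tail)) k
    have hs : Primrec₂ s := by
      have h0 : Primrec fun v : List.Vector ℕ (n + 1) => f v.tail :=
        hf.to_prim.comp Primrec.vector_tail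
      have h1 : Primrec₂ fun (v : List.Vector ℕ (n + 1)) (p : ℕ × ℕ) =>
          g (p.1 ::ᵥ p.2 ::ᵥ v.tail) := ?_
      · exact Primrec.nat_rec h0 h1
      exact hg.to_prim.comp (Primrec.vector_cons.comp (Primrec.fst.comp Primrec.snd)
        (Primrec.vector_cons.comp (Primrec.snd.comp Primrec.snd)
          (Primrec.vector_tail.comp Primrec.fst)))
    -- `t v k` dominates the values `s v j` and the bounds of the single steps up to stage `k`.
    -- Adding them up makes it monotone in `k`, and it stays primitive recursive.
    let t : List.Vector ℕ (n + 1) → ℕ → ℕ := fun v k =>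
      Nat.rec (s v 0) (fun y acc => acc + (c (y ::ᵥ s v y ::ᵥ v.tail) + s v (y + 1))) k
    have ht : Primrec₂ t := by
      have h0 : Primrec fun v : List.Vector ℕ (n + 1) => s v 0 :=
        hs.comp Primrec.id (Primrec.const 0)
      have h1 : Primrec₂ fun (v : List.Vector ℕ (n + 1)) (p : ℕ × ℕ) =>
          p.2 + (c (p.1 ::ᵥ s v p.1 ::ᵥ v.tail) + s v (p.1 + 1)) := ?_
      · exact Primrec.nat_rec h0 h1
      refine Primrec.nat_add.comp (Primrec.snd.comp Primrec.snd) (Primrec.nat_add.comp ?_ ?_)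
      · exact hc.comp (Primrec.vector_cons.comp (Primrec.fst.comp Primrec.snd)
          (Primrec.vector_cons.comp (hs.comp Primrec.fst (Primrec.fst.comp Primrec.snd))
            (Primrec.vector_tail.comp Primrec.fst)))
      · exact hs.comp Primrec.fst (Primrec.succ.comp (Primrec.fst.comp Primrec.snd))
    have hmono : ∀ v, Monotone (t v) := fun v => monotone_nat_of_le_succ fun k => Nat.le_add_right _ _
    have hst : ∀ v k, s v k ≤ t v k := by
      intro v k
      cases k with
      | zero => exact le_rfl
      | succ k =>
        change _ ≤ t v k + (_ + s v (k + 1))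
        omega
    refine ⟨fun v => v.head + (b v.tail + t v v.head), ?_, (Sem.prec hf' hg').mono ?_⟩
    · exact Primrec.nat_add.comp Primrec.vector_head (Primrec.nat_add.comp
        (hb.comp Primrec.vector_tail) (ht.comp Primrec.id Primrec.vector_head))
    · rintro x v y V ⟨h1, h2⟩
      dsimp only at h1 h2
      set w := List.Vector.ofFn v with hw
      have hh : w.head = v 0 := by rw [← List.Vector.get_zero, hw, List.Vector.get_ofFn]
      have htl : w.tail = List.Vector.ofFn (Fin.tail v) := by
        rw [hw, List.Vector.tail_ofFn]; rfl
      rw [hh] at h1 h2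
      refine ⟨V, le_rfl, s w, h1.symm, ⟨?_, ?_⟩, fun j hj => ⟨?_, ?_⟩, by omega, fun j hj => ?_⟩
      · rw [← htl]; rfl
      · rw [← htl]; omega
      · rw [ofFn_cons, ofFn_cons, ← htl]
      · rw [ofFn_cons, ofFn_cons, ← htl]
        have := hmono w (show j + 1 ≤ v 0 from hj)
        change t w j + (_ + _) ≤ _ at this
        omega
      · have := hmono w hj
        have := hst w j
        omega

theorem sem_of_primrec₂ {f : ℕ → ℕ → ℕ} (hf : Primrec₂ f) :
    ∃ b : ℕ → ℕ → ℕ, Primrec₂ b ∧ Sem (n := 2) fun _ v y V =>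
      y = f (v 0) (v 1) ∧ b (v 0) (v 1) ≤ V := by
  have hf' : Primrec fun v : List.Vector ℕ 2 => f (v.get 0) (v.get 1) :=
    hf.comp (Primrec.vector_get.comp Primrec.id (Primrec.const 0))
      (Primrec.vector_get.comp Primrec.id (Primrec.const 1))
  obtain ⟨b, hb, hs⟩ := sem_of_primrec' (Nat.Primrec'.of_prim hf')
  refine ⟨fun k a => b (k ::ᵥ a ::ᵥ .nil), ?_, hs.mono ?_⟩
  · exact hb.comp (Primrec.vector_cons.comp Primrec.fst
      (Primrec.vector_cons.comp Primrec.snd (Primrec.const _)))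
  · rintro x v y V ⟨h1, h2⟩
    refine ⟨V, le_rfl, ?_, h2⟩
    rw [List.Vector.get_ofFn, List.Vector.get_ofFn]
    exact h1

/-- Computable functions have counter programs with computable bounds. -/
theorem sem_of_computable {F : ℕ → ℕ} (hF : Computable F) :
    ∃ b : ℕ → ℕ, Computable b ∧ Sem (n := 1) fun _ v y V => y = F (v 0) ∧ b (v 0) ≤ V := by
  -- Normal form: search for the least `k` at which the evaluation `evaln k c a` is defined, then
  -- read off its value. The test and the value are primitive recursive in `k` and `a`, and the
  -- search is `Sem.find`.
  obtain ⟨c, hc⟩ := Nat.Partrec.Code.exists_code.1 (Partrec.nat_iff.1 hF.partrec)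
  have hev : Primrec₂ fun k a => Nat.Partrec.Code.evaln k c a :=
    Nat.Partrec.Code.primrec_evaln.comp (Primrec.pair (Primrec.pair Primrec.fst (Primrec.const c))
      Primrec.snd)
  have htest : Primrec₂ fun k a => bif (Nat.Partrec.Code.evaln k c a).isSome then 1 else 0 :=
    Primrec.cond (Primrec.option_isSome.comp hev) (Primrec.const 1) (Primrec.const 0)
  have hval : Primrec₂ fun k a => (Nat.Partrec.Code.evaln k c a).getD 0 :=
    Primrec.option_getD.comp hev (Primrec.const 0)
  obtain ⟨b1, hb1, hs1⟩ := sem_of_primrec₂ htest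
  obtain ⟨b2, hb2, hs2⟩ := sem_of_primrec₂ hval
  have hex : ∀ a, ∃ k, (Nat.Partrec.Code.evaln k c a).isSome := by
    intro a
    have : F a ∈ Nat.Partrec.Code.eval c a := by rw [hc]; simp
    obtain ⟨k, hk⟩ := Nat.Partrec.Code.evaln_complete.1 this
    exact ⟨k, by rw [Option.mem_def.1 hk]; rfl⟩
  let K : ℕ → ℕ := fun a => Nat.find (hex a)
  have hK : Computable K := by
    have : Partrec fun a : ℕ => Nat.rfind fun k =>
        Part.some (Nat.Partrec.Code.evaln k c a).isSome := by
      refine Partrec.rfind ?_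
      exact ((Primrec.option_isSome.comp hev).to_comp.comp
        (Computable.pair Computable.snd Computable.fst)).partrec
    refine this.of_eq_tot fun a => ?_
    refine Nat.mem_rfind.2 ⟨by simpa using (Nat.find_spec (hex a)).symm, fun {m} hm => ?_⟩
    have := Nat.find_min (hex a) hm
    simpa using this
  have hFK : ∀ a, (Nat.Partrec.Code.evaln (K a) c a).getD 0 = F a := by
    intro a
    obtain ⟨y, hy⟩ := Option.isSome_iff_exists.1 (Nat.find_spec (hex a))
    have := Nat.Partrec.Code.evaln_sound (Option.mem_def.2 hy)
    rw [hc] at this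
    have h2 : y = F a := by simpa using this
    change (Nat.Partrec.Code.evaln (Nat.find (hex a)) c a).getD 0 = _
    rw [hy, h2]; rfl
  -- The search performs the test for all `k` up to `K a`. The sum dominates the bounds of all these
  -- tests, although `b1` need not be monotone.
  let S : ℕ → ℕ → ℕ := fun a k => Nat.rec (b1 0 a) (fun j acc => acc + b1 (j + 1) a) k
  have hS : Primrec₂ S := by
    have h0 : Primrec fun a => b1 0 a := hb1.comp (Primrec.const 0) Primrec.id
    have h1 : Primrec₂ fun (a : ℕ) (p : ℕ × ℕ) => p.2 + b1 (p.1 + 1) a := ?_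
    · exact Primrec.nat_rec h0 h1
    exact Primrec.nat_add.comp (Primrec.snd.comp Primrec.snd)
      (hb1.comp (Primrec.succ.comp (Primrec.fst.comp Primrec.snd)) Primrec.fst)
  have hSm : ∀ a, Monotone (S a) := fun a => monotone_nat_of_le_succ fun k => Nat.le_add_right _ _
  have hbS : ∀ a k, b1 k a ≤ S a k := by
    intro a k
    cases k with
    | zero => exact le_rfl
    | succ k =>
      change _ ≤ S a k + b1 (k + 1) a
      omega
  refine ⟨fun a => S a (K a) + (b2 (K a) a + (K a + (a + 1))), ?_, ?_⟩
  · have hadd : Computable₂ fun a b : ℕ => a + b := Primrec.nat_add.to_comp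
    exact hadd.comp (hS.to_comp.comp Computable.id hK) (hadd.comp (hb2.to_comp.comp hK Computable.id)
      (hadd.comp hK Computable.succ))
  · let D1 : List Bool → (Fin 1 → ℕ) → ℕ → ℕ → Prop := fun _ v y V =>
      (∀ k < y, 0 = (bif (Nat.Partrec.Code.evaln k c (v 0)).isSome then 1 else 0) ∧
        b1 k (v 0) ≤ V) ∧
      (∃ z ≠ 0, z = (bif (Nat.Partrec.Code.evaln y c (v 0)).isSome then 1 else 0) ∧
        b1 y (v 0) ≤ V) ∧ y ≤ V ∧ 1 ≤ V
    let D2 : List Bool → (Fin 1 → ℕ) → ℕ → ℕ → Prop := fun _ v y V => y = v 0 ∧ v 0 ≤ V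
    have hD1 : Sem D1 := Sem.find hs1
    have hD2 : Sem D2 := sem_proj 0
    have hE : ∀ i : Fin 2, Sem ((![D1, D2] : Fin 2 → _) i) := Fin.forall_fin_two.2 ⟨hD1, hD2⟩
    refine (Sem.comp hs2 hE).mono ?_
    rintro x v y V ⟨h1, h2⟩
    dsimp only at h1 h2
    set a := v 0 with ha
    refine ⟨V, le_rfl, ![K a, a], fun i => ?_, ?_⟩
    · fin_cases i
      · refine ⟨fun k hk => ⟨?_, ?_⟩, ⟨1, one_ne_zero, ?_, ?_⟩, ?_, ?_⟩
        · have := Nat.find_min (hex a) hk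
          simp only [Bool.not_eq_true] at this
          rw [this]; rfl
        · have h3 := hbS a k
          have h4 := hSm a (le_of_lt hk)
          change S a k ≤ S a (K a) at h4
          change b1 k a ≤ V
          omega
        · have h3 := Nat.find_spec (hex a)
          change 1 = bif (Nat.Partrec.Code.evaln (Nat.find (hex a)) c a).isSome then 1 else 0
          rw [h3]; rfl
        · have h3 := hbS a (K a)
          change b1 (K a) a ≤ V
          omega
        · change K a ≤ V
          omega
        · omega
      · refine ⟨rfl, ?_⟩
        change a ≤ V
        omega
    · refine ⟨by rw [h1, ← hFK]; rfl, ?_⟩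
      change b2 (K a) a ≤ V
      omega

end ParamLog

namespace ParamLog

variable {x : List Bool} {V : ℕ}

/-! ## Machines that guess a number and then guess numbers in rounds -/

theorem TestEv.unique {σ : Mem} {t : Test} {g g' r r' : List Bool} {b b' : Bool}
    (h : TestEv x σ t g b) (h' : TestEv x σ t g' b') (e : g ++ r = g' ++ r') :
    g = g' ∧ b = b' ∧ r = r' := by
  cases h <;> cases h' <;> simp_all

/-- The guess words of terminating executions from a fixed memory form a prefix-free set. The
remainders `r` and `r'` let the induction pass through sequences and loops, where the splitting of
the word is not known beforehand. -/
theorem Ev.unique {p : Prog} {σ τ τ' : Mem} {g g' r r' : List Bool} (h : Ev x V p σ g τ)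
    (h' : Ev x V p σ g' τ') (e : g ++ r = g' ++ r') : g = g' ∧ τ = τ' ∧ r = r' := by
  induction h generalizing g' τ' r r' with
  | inc r σ h => cases h'; simpa using e
  | dec r σ h => cases h'; simpa using e
  | move m σ => cases h'; simpa using e
  | emit b σ => cases h'; simpa using e
  | seq h1 h2 ih1 ih2 =>
    cases h' with
    | seq k1 k2 =>
      simp only [List.append_assoc] at e
      obtain ⟨rfl, rfl, e⟩ := ih1 k1 e
      obtain ⟨rfl, rfl, e⟩ := ih2 k2 e
      exact ⟨rfl, rfl, e⟩
  | ite h1 h2 ih =>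
    cases h' with
    | ite k1 k2 =>
      simp only [List.append_assoc] at e
      obtain ⟨rfl, rfl, e⟩ := h1.unique k1 e
      obtain ⟨rfl, rfl, e⟩ := ih k2 e
      exact ⟨rfl, rfl, e⟩
  | loop_false h1 =>
    cases h' with
    | loop_false k1 =>
      obtain ⟨rfl, -, e⟩ := h1.unique k1 e
      exact ⟨rfl, rfl, e⟩
    | loop_true k1 k2 k3 =>
      rw [List.append_assoc] at e
      exact absurd (h1.unique k1 e).2.1 (by simp)
  | loop_true h1 h2 h3 ih2 ih3 =>
    cases h' with
    | loop_false k1 =>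
      rw [List.append_assoc] at e
      exact absurd (h1.unique k1 e).2.1 (by simp)
    | loop_true k1 k2 k3 =>
      simp only [List.append_assoc] at e
      obtain ⟨rfl, -, e⟩ := h1.unique k1 e
      obtain ⟨rfl, rfl, e⟩ := ih2 k2 e
      obtain ⟨rfl, rfl, e⟩ := ih3 k3 e
      exact ⟨rfl, rfl, e⟩

/-- The number with the given binary digits, most significant digit first. -/
def numOf (g : List Bool) : ℕ := g.foldl (fun a b => 2 * a + b.toNat) 0

theorem numOf_append_singleton (g : List Bool) (b : Bool) :
    numOf (g ++ [b]) = 2 * numOf g + b.toNat := by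
  simp [numOf]

theorem numOf_lt (g : List Bool) : numOf g < 2 ^ g.length := by
  induction g using List.reverseRecOn with
  | nil => simp [numOf]
  | append_singleton g b ih =>
    rw [numOf_append_singleton, List.length_append, List.length_singleton, pow_succ]
    have := Bool.toNat_le b
    omega

theorem exists_numOf {c N : ℕ} (h : N < 2 ^ c) : ∃ g : List Bool, g.length = c ∧ numOf g = N := by
  induction c generalizing N with
  | zero => exact ⟨[], rfl, by rw [pow_zero] at h; simp [numOf]; omega⟩
  | succ c ih =>
    rw [pow_succ] at h
    obtain ⟨g, h1, h2⟩ := ih (N := N / 2) (by omega)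
    refine ⟨g ++ [decide (N % 2 = 1)], by simp [h1], ?_⟩
    rw [numOf_append_singleton, h2]
    rcases Nat.mod_two_eq_zero_or_one N with h | h <;> simp [h] <;> omega

theorem flatten_map_singleton (g : List Bool) : (g.map fun b => [b]).flatten = g := by
  induction g with
  | nil => rfl
  | cons a g ih => simp [ih]

/-- Guess a number digit by digit, the number of digits being given by a register. -/
theorem exists_guess_prog (out cnt base : ℕ) (h1 : out < base) (h2 : cnt < base)
    (h3 : out ≠ cnt) : ∃ c, ∃ P : Prog, ∀ (x : List Bool) (V B : ℕ) (σ : Mem) (g : List Bool),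
      x.length + 2 ≤ B → 2 ^ g.length ≤ B → B ^ c ≤ V → σ.reg cnt = g.length →
      ∃ σ', Ev x V P σ g σ' ∧ σ'.reg out = numOf g ∧ σ'.reg cnt = 0 ∧
        ∀ r < base, r ≠ out → r ≠ cnt → σ'.reg r = σ.reg r := by
  obtain ⟨c, P, hP⟩ := ((PC.const 2).mul (PC.var 0) : PC (n := 1) fun _ v => 2 * v 0).assign
    (fun _ => out) out base (fun _ => h1) h1
  refine ⟨c + 1, .seq (.clear out) (.for cnt (.seq P (.ite .coin (.inc out) .skip))),
    fun x V B σ g hB hg hV hσ => ?_⟩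
  have hBc : B ^ c ≤ V := (Nat.pow_le_pow_right (by omega) (by omega)).trans hV
  have hBV : B ≤ V := by
    have : B ^ 1 ≤ B ^ (c + 1) := Nat.pow_le_pow_right (by omega) (by omega)
    rw [pow_one] at this
    omega
  obtain ⟨σ', e, ⟨gs, f1, f2, f3, f4⟩, -, f5⟩ := ev_for_guess (x := x) (V := V) (r := cnt)
    (p := .seq P (.ite .coin (.inc out) .skip))
    (fun gs τ => (∃ pre, pre ++ gs.flatten = g ∧ τ.reg out = numOf pre ∧
      τ.reg cnt = gs.length ∧ ∀ r < base, r ≠ out → r ≠ cnt → τ.reg r = σ.reg r) ∧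
      (∀ l ∈ gs, l.length = 1) ∧ τ.reg cnt = gs.length) (fun gs τ h => h.2.2)
    (fun l gs τ ⟨⟨pre, a1, a2, a3, a4⟩, a5, a6⟩ => by
      obtain ⟨b, rfl⟩ := List.length_eq_one_iff.1 (a5 l (by simp))
      have hlen : (pre ++ [b]).length ≤ g.length := by
        rw [← a1]; simp
      have hnum : numOf (pre ++ [b]) < B := (numOf_lt _).trans_le
        ((Nat.pow_le_pow_right (by omega) hlen).trans hg)
      rw [numOf_append_singleton] at hnum
      obtain ⟨τ1, e1, b1, b2⟩ := hP x V B (τ.set cnt gs.length) ⟨by omega, by omega, fun _ => by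
        rw [Mem.set_reg_of_ne _ _ h3, a2]; dsimp only; omega⟩ hBc
      have c1 : τ1.reg out = 2 * numOf pre := by
        rw [b1 _ h1, Function.update_self, Mem.set_reg_of_ne _ _ h3, a2]
      have c2 : τ1.reg cnt = gs.length := by
        rw [b1 _ h2, Function.update_of_ne h3.symm, Mem.set_reg_self]
      have c3 : ∀ r < base, r ≠ out → r ≠ cnt → τ1.reg r = σ.reg r := fun r k1 k2 k3 => by
        rw [b1 _ k1, Function.update_of_ne k2, Mem.set_reg_of_ne _ _ k3, a4 r k1 k2 k3]
      have e2 : ∃ τ2, Ev x V (.ite .coin (.inc out) .skip) τ1 [b] τ2 ∧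
          τ2.reg out = numOf (pre ++ [b]) ∧ τ2.reg cnt = gs.length ∧
          ∀ r < base, r ≠ out → r ≠ cnt → τ2.reg r = σ.reg r := by
        rw [numOf_append_singleton]
        cases b with
        | true =>
          refine ⟨_, .ite (g := [true]) (g' := []) (.coin true) (.inc out τ1 (by
            rw [c1]; simp at hnum; omega)), ?_, ?_, fun r k1 k2 k3 => ?_⟩
          · rw [Mem.set_reg_self, c1]; rfl
          · rw [Mem.set_reg_of_ne _ _ h3.symm, c2]
          · rw [Mem.set_reg_of_ne _ _ k2, c3 r k1 k2 k3]
        | false =>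
          exact ⟨_, .ite (g := [false]) (g' := []) (.coin false) (ev_skip τ1), by simpa using c1,
            c2, c3⟩
      obtain ⟨τ2, e2, d1, d2, d3⟩ := e2
      refine ⟨τ2, .seq (g := []) e1 e2, ⟨pre ++ [b], ?_, d1, d2, d3⟩,
        fun l hl => a5 l (by simp [hl]), d2⟩
      simpa using a1)
    (g.map fun b => [b]) (σ.set out 0) ⟨⟨[], flatten_map_singleton g, by simp [numOf], by
      rw [Mem.set_reg_of_ne _ _ h3.symm, hσ]; simp, fun r _ k2 _ => Mem.set_reg_of_ne _ _ k2⟩,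
      fun l hl => by
        obtain ⟨b, -, rfl⟩ := List.mem_map.1 hl
        rfl, by rw [Mem.set_reg_of_ne _ _ h3.symm, hσ]; simp⟩
  rw [flatten_map_singleton] at e
  simp only [List.flatten_nil, List.append_nil, List.length_nil] at f1 f3
  rw [f1] at f2
  refine ⟨σ', .seq' (ev_clear _ _) e, f2, f3, f4⟩

end ParamLog

/-! ### A certificate followed by rounds of guesses. -/

namespace ParamLog

/-- The first seven registers of the memory have the given contents. -/
def Mem.Holds (σ : Mem) (s : ℕ → ℕ) : Prop := ∀ r < 7, σ.reg r = s r

theorem PC.assign_holds {n : ℕ} {f : List Bool → (Fin n → ℕ) → ℕ} (hf : PC f) (ins : Fin n → ℕ)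
    (out : ℕ) (h1 : ∀ i, ins i < 7) (h2 : out < 7) :
    ∃ c, ∃ P : Prog, ∀ (x : List Bool) (V B : ℕ) (σ : Mem) (s : ℕ → ℕ), σ.Holds s →
      x.length + 2 ≤ B → (∀ i, s (ins i) ≤ B) → B ^ c ≤ V →
      ∃ σ', Ev x V P σ [] σ' ∧ σ'.Holds (Function.update s out (f x fun i => s (ins i))) := by
  obtain ⟨c, P, h⟩ := hf.assign ins out 7 h1 h2
  refine ⟨c, P, fun x V B σ s hs hB hi hV => ?_⟩
  have e : (fun i => σ.reg (ins i)) = fun i => s (ins i) := funext fun i => hs _ (h1 i)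
  obtain ⟨σ', e1, e2, -⟩ := h x V B σ ⟨by omega, by omega, fun i => by rw [e]; exact hi i⟩ hV
  refine ⟨σ', e1, fun r hr => ?_⟩
  rw [e2 r hr, e]
  by_cases h : r = out
  · subst h; simp
  · rw [Function.update_of_ne h, Function.update_of_ne h, hs r hr]

theorem exists_guess_prog_holds (out cnt : ℕ) (h1 : out < 7) (h2 : cnt < 7) (h3 : out ≠ cnt) :
    ∃ c, ∃ P : Prog, ∀ (x : List Bool) (V B : ℕ) (σ : Mem) (s : ℕ → ℕ) (g : List Bool), σ.Holds s →
      x.length + 2 ≤ B → 2 ^ g.length ≤ B → B ^ c ≤ V → s cnt = g.length →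
      ∃ σ', Ev x V P σ g σ' ∧
        σ'.Holds (Function.update (Function.update s cnt 0) out (numOf g)) := by
  obtain ⟨c, P, h⟩ := exists_guess_prog out cnt 7 h1 h2 h3
  refine ⟨c, P, fun x V B σ s g hs hB hg hV hc => ?_⟩
  obtain ⟨σ', e1, e2, e3, e4⟩ := h x V B σ g hB hg hV (by rw [hs _ h2, hc])
  refine ⟨σ', e1, fun r hr => ?_⟩
  by_cases k1 : r = out
  · subst k1; simpa using e2
  · rw [Function.update_of_ne k1]
    by_cases k2 : r = cnt
    · subst k2; simpa using e3
    · rw [Function.update_of_ne k2, e4 r hr k1 k2, hs r hr]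

theorem exists_flatten {c : ℕ} (n : ℕ) {g : List Bool} (h : g.length = n * c) :
    ∃ gs : List (List Bool), gs.flatten = g ∧ gs.length = n ∧ ∀ l ∈ gs, l.length = c := by
  induction n generalizing g with
  | zero =>
    rw [zero_mul] at h
    exact ⟨[], by simpa using (List.length_eq_zero_iff.1 h).symm, rfl, by simp⟩
  | succ n ih =>
    rw [add_mul, one_mul] at h
    obtain ⟨gs, h1, h2, h3⟩ := ih (g := g.drop c) (by rw [List.length_drop]; omega)
    refine ⟨g.take c :: gs, by rw [List.flatten_cons, h1, List.take_append_drop], by simp [h2],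
      fun l hl => ?_⟩
    rcases List.mem_cons.1 hl with rfl | hl
    · rw [List.length_take]; omega
    · exact h3 l hl

/-- The numbers guessed in the rounds, preceded by zero. -/
def guessSeq (gs : List (List Bool)) : ℕ → ℕ
  | 0 => 0
  | j + 1 => numOf (gs.getD j [])

/-- Register `0` holds the verdict so far, `1` the certificate, `2` and `3` the guesses of the
current and of the previous round, `4` the index of the round, `5` the number of remaining rounds
and `6` the number of bits to be guessed. Only two rounds are stored at any time. -/
theorem exists_rounds_prog {n0 c0 c1 : List Bool → ℕ} {S : List Bool → ℕ → Prop}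
    {R : List Bool → ℕ → ℕ → ℕ → ℕ → Prop} (hn0 : PC (n := 0) fun x _ => n0 x)
    (hc0 : PC (n := 0) fun x _ => c0 x) (hc1 : PC (n := 0) fun x _ => c1 x)
    (hS : PD (n := 1) fun x v => S x (v 0))
    (hR : PD (n := 4) fun x v => R x (v 0) (v 1) (v 2) (v 3)) :
    ∃ c, ∃ P : Prog, ∀ (x : List Bool) (V B : ℕ) (σ : Mem) (s : ℕ → ℕ) (g0 : List Bool)
      (gs : List (List Bool)), σ.Holds s → x.length + 2 ≤ B → 2 ^ c0 x ≤ B → 2 ^ c1 x ≤ B →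
      n0 x ≤ B → B ^ c ≤ V → s 3 = 0 → s 4 = 0 → g0.length = c0 x → gs.length = n0 x →
      (∀ l ∈ gs, l.length = c1 x) → ∃ σ', Ev x V P σ (g0 ++ gs.flatten) σ' ∧
        (σ'.reg 0 ≠ 0 ↔ S x (numOf g0) ∧
          ∀ j < n0 x, R x (numOf g0) j (guessSeq gs (j + 1)) (guessSeq gs j)) := by
  classical
  -- A failed check only sets the verdict to zero and the run continues, so that the number of
  -- guesses does not depend on the outcome of the checks.
  have hR' : PC (n := 5) fun x v => if v 0 ≠ 0 ∧ R x (v 1) (v 2) (v 3) (v 4) then 1 else 0 :=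
    ((PD.eq_zero (PC.var 0)).not.and
      (PC.comp4 hR (PC.var 1) (PC.var 2) (PC.var 3) (PC.var 4) : PD _)).of_eq fun x v => by
        congr
  have hS' : PC (n := 1) fun x v => if S x (v 0) then 1 else 0 := hS.of_eq fun x v => by congr
  obtain ⟨d1, P1, h1⟩ := hc0.assign_holds (fun i => i.elim0) 6 (fun i => i.elim0) (by omega)
  obtain ⟨d2, P2, h2⟩ := exists_guess_prog_holds 1 6 (by omega) (by omega) (by omega)
  obtain ⟨d3, P3, h3⟩ := hS'.assign_holds ![1] 0 (by intro i; fin_cases i; simp) (by omega)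
  obtain ⟨d4, P4, h4⟩ := hn0.assign_holds (fun i => i.elim0) 5 (fun i => i.elim0) (by omega)
  obtain ⟨d5, P5, h5⟩ := hc1.assign_holds (fun i => i.elim0) 6 (fun i => i.elim0) (by omega)
  obtain ⟨d6, P6, h6⟩ := exists_guess_prog_holds 2 6 (by omega) (by omega) (by omega)
  obtain ⟨d7, P7, h7⟩ := hR'.assign_holds ![0, 1, 4, 2, 3] 0
    (by intro i; fin_cases i <;> simp) (by omega)
  obtain ⟨d8, P8, h8⟩ := (PC.var 0 : PC (n := 1) fun _ v => v 0).assign_holds ![2] 3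
    (by intro i; fin_cases i; simp) (by omega)
  obtain ⟨d9, P9, h9⟩ := ((PC.var 0).succ : PC (n := 1) fun _ v => v 0 + 1).assign_holds ![4] 4
    (by intro i; fin_cases i; simp) (by omega)
  refine ⟨d1 + d2 + d3 + d4 + d5 + d6 + d7 + d8 + d9, .seq P1 (.seq P2 (.seq P3 (.seq P4
    (.for 5 (.seq P5 (.seq P6 (.seq P7 (.seq P8 P9)))))))),
    fun x V B σ s g0 gs hs hB hb0 hb1 hbn hV hs3 hs4 hg0 hgs hl => ?_⟩
  have hVd : ∀ d, d ≤ d1 + d2 + d3 + d4 + d5 + d6 + d7 + d8 + d9 → B ^ d ≤ V := fun d hd =>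
    (Nat.pow_le_pow_right (by omega) hd).trans hV
  have hN : numOf g0 ≤ B := by
    have := numOf_lt g0
    rw [hg0] at this
    omega
  have hH : ∀ j, guessSeq gs j ≤ B := by
    intro j
    cases j with
    | zero => exact Nat.zero_le _
    | succ j =>
      rw [guessSeq]
      by_cases hj : j < gs.length
      · rw [List.getD_eq_getElem _ _ hj]
        have := numOf_lt gs[j]
        rw [hl _ (List.getElem_mem hj)] at this
        omega
      · rw [List.getD_eq_default _ _ (by omega)]
        simp [numOf]
  obtain ⟨σ1, e1, i1⟩ := h1 x V B σ s hs hB (fun i => i.elim0) (hVd _ (by omega))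
  obtain ⟨σ2, e2, i2⟩ := h2 x V B σ1 _ g0 i1 hB (by rwa [hg0]) (hVd _ (by omega)) (by simp [hg0])
  obtain ⟨σ3, e3, i3⟩ := h3 x V B σ2 _ i2 hB (by intro i; fin_cases i; simpa using hN)
    (hVd _ (by omega))
  obtain ⟨σ4, e4, i4⟩ := h4 x V B σ3 _ i3 hB (fun i => i.elim0) (hVd _ (by omega))
  obtain ⟨σ5, e5, j, k1, k2, k3, t, k4, k5, k6, k7, k8, k9⟩ := ev_for_guess (x := x) (V := V)
    (r := 5) (p := .seq P5 (.seq P6 (.seq P7 (.seq P8 P9))))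
    (fun l τ => ∃ j, j + l.length = n0 x ∧ l = gs.drop j ∧ τ.reg 5 = l.length ∧ ∃ t, τ.Holds t ∧
      t 1 = numOf g0 ∧ t 3 = guessSeq gs j ∧ t 4 = j ∧ t 0 ≤ 1 ∧ (t 0 ≠ 0 ↔ S x (numOf g0) ∧
          ∀ i < j, R x (numOf g0) i (guessSeq gs (i + 1)) (guessSeq gs i)))
    (fun l τ ⟨_, _, _, h, _⟩ => h)
    (fun a l τ ⟨j, k1, k2, k3, t, k4, k5, k6, k7, k8, k9⟩ => by
      have hj : j < gs.length := by rw [hgs, ← k1]; simp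
      have ha : a = gs[j] := by
        rw [List.drop_eq_getElem_cons hj] at k2
        exact (List.cons.inj k2).1
      have hl' : l = gs.drop (j + 1) := by
        rw [List.drop_eq_getElem_cons hj] at k2
        exact (List.cons.inj k2).2
      have halen : a.length = c1 x := by rw [ha]; exact hl _ (List.getElem_mem hj)
      have hnum : numOf a = guessSeq gs (j + 1) := by
        rw [guessSeq, List.getD_eq_getElem _ _ hj, ha]
      have q0 : (τ.set 5 l.length).Holds (Function.update t 5 l.length) := by
        intro r hr
        by_cases h : r = 5
        · subst h; simp
        · rw [Mem.set_reg_of_ne _ _ h, Function.update_of_ne h, k4 r hr]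
      obtain ⟨τ1, f1, q1⟩ := h5 x V B _ _ q0 hB (fun i => i.elim0) (hVd _ (by omega))
      obtain ⟨τ2, f2, q2⟩ := h6 x V B τ1 _ a q1 hB (by rwa [halen]) (hVd _ (by omega))
        (by simp [halen])
      obtain ⟨τ3, f3, q3⟩ := h7 x V B τ2 _ q2 hB (by
        have := hH (j + 1)
        have := hH j
        intro i
        fin_cases i <;> simp [k5, k6, k7, hnum] <;> omega) (hVd _ (by omega))
      obtain ⟨τ4, f4, q4⟩ := h8 x V B τ3 _ q3 hB (by
        have := hH (j + 1)
        intro i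
        fin_cases i
        simpa [hnum] using this) (hVd _ (by omega))
      obtain ⟨τ5, f5, q5⟩ := h9 x V B τ4 _ q4 hB (by
        intro i
        fin_cases i
        simp [k7]
        omega) (hVd _ (by omega))
      refine ⟨τ5, .seq' f1 (by simpa using Ev.seq f2 (.seq' f3 (.seq' f4 f5))), j + 1, ?_, hl', ?_,
        _, q5, ?_, ?_, ?_, ?_, ?_⟩
      · rw [← k1, List.length_cons]; omega
      · rw [q5 5 (by omega)]; simp
      · simp [k5]
      · simp [hnum]
      · simp [k7]
      · simp; split <;> omega
      · simp [k5, k6, k7, hnum, k9]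
        refine fun _ => ⟨fun ⟨a2, a3⟩ i hi => ?_, fun a2 => ⟨fun i hi => a2 i hi.le, a2 j le_rfl⟩⟩
        rcases lt_or_eq_of_le hi with h | rfl
        · exact a2 i h
        · exact a3)
    gs σ4 ⟨0, by omega, by simp, by rw [i4 5 (by omega)]; simp [hgs], _, i4, by simp, by
      simp [hs3, guessSeq], by simp [hs4], by simp; split <;> omega, by simp⟩
  obtain rfl : j = n0 x := by simpa using k1
  refine ⟨σ5, .seq' e1 (.seq e2 (.seq' e3 (.seq' e4 e5))), ?_⟩
  rw [k4 0 (by omega), k9]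

/-- The test `ok` and then the property `d`, decided by the program for `D`, come before all
guesses; if one of them fails, nothing is guessed. The number `B` serves the polynomially bounded
programs, whereas `V` must also suffice for `D`, whose counters may be much larger. -/
theorem exists_rounds_machine {ok : List Bool → Prop} {n0 c0 c1 : List Bool → ℕ}
    {S : List Bool → ℕ → Prop} {R : List Bool → ℕ → ℕ → ℕ → ℕ → Prop}
    {D : List Bool → (Fin 0 → ℕ) → ℕ → ℕ → Prop} (hok : PD (n := 0) fun x _ => ok x) (hD : Sem D)
    (hn0 : PC (n := 0) fun x _ => n0 x) (hc0 : PC (n := 0) fun x _ => c0 x)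
    (hc1 : PC (n := 0) fun x _ => c1 x) (hS : PD (n := 1) fun x v => S x (v 0))
    (hR : PD (n := 4) fun x v => R x (v 0) (v 1) (v 2) (v 3)) :
    ∃ M : TuringMachine, ∃ c, ∀ (x : List Bool) (V B : ℕ) (d : Prop), x.length + 2 ≤ B →
      B ^ c ≤ V →
      (ok x → 2 ^ c0 x ≤ B ∧ 2 ^ c1 x ≤ B ∧ n0 x ≤ B ∧
        ∃ y ≤ 1, (∀ v, D x v y V) ∧ (y ≠ 0 ↔ d)) →
      M.RunsInSpace x (V.size + 2) ∧
      (∀ T, (ok x → c0 x + n0 x * c1 x ≤ T) → M.UsesNondetBits x T) ∧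
      (M.Accepts x ↔ ok x ∧ d ∧ ∃ N < 2 ^ c0 x, S x N ∧ ∃ H : ℕ → ℕ, H 0 = 0 ∧
        (∀ j, H j < 2 ^ c1 x) ∧ ∀ j < n0 x, R x N j (H (j + 1)) (H j)) := by
  classical
  have hok' : PC (n := 0) fun x _ => if ok x then 1 else 0 := hok.of_eq fun x v => by congr
  obtain ⟨d1, P1, h1⟩ := hok'.assign_holds (fun i => i.elim0) 0 (fun i => i.elim0) (by omega)
  obtain ⟨P2, h2⟩ := hD.assign (fun i => i.elim0) 0 7 (fun i => i.elim0) (by omega)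
  obtain ⟨d3, P3, h3⟩ := exists_rounds_prog hn0 hc0 hc1 hS hR
  set p : Prog := .seq P1 (.ite (.reg 0) (.seq P2 (.ite (.reg 0) P3 .skip)) .skip) with hp
  obtain ⟨M, hM⟩ := exists_machine p 0
  refine ⟨M, d1 + d3 + 1, fun x V B d hB hV hx => ?_⟩
  have hVd : ∀ e, e ≤ d1 + d3 + 1 → B ^ e ≤ V := fun e he =>
    (Nat.pow_le_pow_right (by omega) he).trans hV
  have hBV : B ≤ V := by simpa using hVd 1 (by omega)
  obtain ⟨σ1, e1, i1⟩ := h1 x V B Mem.init (fun _ => 0) (fun _ _ => rfl) hB (fun i => i.elim0)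
    (hVd _ (by omega))
  have r1 : σ1.reg 0 = if ok x then 1 else 0 := by rw [i1 0 (by omega)]; simp
  have t1 := TestEv.reg (x := x) (σ := σ1) 0
  rw [r1] at t1
  by_cases hokx : ok x
  swap
  · have key : Ev x V p Mem.init [] { σ1 with head := min σ1.head (x.length + 1) } := by
      refine .seq' e1 (.ite (g := []) t1 ?_)
      simp only [hokx, if_false]
      exact ev_skip _
    obtain ⟨m1, m2, m3, -⟩ := hM x V 0 fun g hg => by
      rw [List.length_eq_zero_iff.1 hg]
      exact ⟨_, key⟩
    refine ⟨m1, fun T _ => fun l hl => (m2 l hl).trans (Nat.zero_le _), ?_⟩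
    rw [m3]
    refine iff_of_false ?_ fun h => hokx h.1
    rintro ⟨g, σ', hg, hE, h0⟩
    rw [List.length_eq_zero_iff.1 hg] at hE
    obtain rfl := (hE.unique key (r := []) (r' := []) rfl).2.1
    simp [r1, hokx] at h0
  obtain ⟨hb0, hb1, hbn, y, hy1, hy, hyd⟩ := hx hokx
  obtain ⟨σ2, e2, i2, -⟩ := h2 x V y σ1 (hy _) (by omega)
  have r2 : σ2.reg 0 = y := by rw [i2 0 (by omega)]; simp
  have s2 : ∀ r < 7, r ≠ 0 → σ2.reg r = 0 := fun r hr h0 => by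
    rw [i2 r hr, Function.update_of_ne h0, i1 r hr, Function.update_of_ne h0]
  have t2 := TestEv.reg (x := x) (σ := σ2) 0
  rw [r2] at t2
  have hpre : ∀ g σ', Ev x V (.ite (.reg 0) P3 .skip) σ2 g σ' → Ev x V p Mem.init g σ' := by
    intro g σ' h
    refine .seq' e1 (.ite (g := []) t1 ?_)
    simp only [hokx, if_true]
    exact .seq' e2 h
  by_cases hy0 : y = 0
  · have key : Ev x V p Mem.init [] { σ2 with head := min σ2.head (x.length + 1) } := by
      refine hpre _ _ (.ite (g := []) t2 ?_)
      simp only [hy0]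
      exact ev_skip _
    obtain ⟨m1, m2, m3, -⟩ := hM x V 0 fun g hg => by
      rw [List.length_eq_zero_iff.1 hg]
      exact ⟨_, key⟩
    refine ⟨m1, fun T _ => fun l hl => (m2 l hl).trans (Nat.zero_le _), ?_⟩
    rw [m3]
    refine iff_of_false ?_ fun h => hyd.2 h.2.1 hy0
    rintro ⟨g, σ', hg, hE, h0⟩
    rw [List.length_eq_zero_iff.1 hg] at hE
    obtain rfl := (hE.unique key (r := []) (r' := []) rfl).2.1
    simp [r2, hy0] at h0
  have hd : d := hyd.1 hy0
  have run : ∀ (g0 : List Bool) (gs : List (List Bool)), g0.length = c0 x → gs.length = n0 x →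
      (∀ l ∈ gs, l.length = c1 x) → ∃ σ', Ev x V p Mem.init (g0 ++ gs.flatten) σ' ∧
        (σ'.reg 0 ≠ 0 ↔ S x (numOf g0) ∧
          ∀ j < n0 x, R x (numOf g0) j (guessSeq gs (j + 1)) (guessSeq gs j)) := by
    intro g0 gs a1 a2 a3
    obtain ⟨σ3, e3, i3⟩ := h3 x V B σ2 σ2.reg g0 gs (fun _ _ => rfl) hB hb0 hb1 hbn
      (hVd _ (by omega)) (s2 3 (by omega) (by omega)) (s2 4 (by omega) (by omega)) a1 a2 a3
    refine ⟨σ3, hpre _ _ (.ite (g := []) t2 ?_), i3⟩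
    simpa [hy0] using e3
  have hsplit : ∀ g : List Bool, g.length = c0 x + n0 x * c1 x → ∃ (g0 : List Bool)
      (gs : List (List Bool)), g = g0 ++ gs.flatten ∧
      g0.length = c0 x ∧ gs.length = n0 x ∧ ∀ l ∈ gs, l.length = c1 x := by
    intro g hg
    obtain ⟨gs, a1, a2, a3⟩ := exists_flatten (c := c1 x) (n0 x) (g := g.drop (c0 x))
      (by rw [List.length_drop]; omega)
    exact ⟨g.take (c0 x), gs, by rw [a1, List.take_append_drop],
      by rw [List.length_take]; omega, a2, a3⟩
  obtain ⟨m1, m2, m3, -⟩ := hM x V (c0 x + n0 x * c1 x) fun g hg => by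
    obtain ⟨g0, gs, rfl, a1, a2, a3⟩ := hsplit g hg
    obtain ⟨σ', e, -⟩ := run g0 gs a1 a2 a3
    exact ⟨σ', e⟩
  refine ⟨m1, fun T hT => fun l hl => (m2 l hl).trans (hT hokx), ?_⟩
  rw [m3]
  constructor
  · rintro ⟨g, σ', hg, hE, h0⟩
    obtain ⟨g0, gs, rfl, a1, a2, a3⟩ := hsplit g hg
    obtain ⟨σ'', e, he⟩ := run g0 gs a1 a2 a3
    obtain rfl := (hE.unique e (r := []) (r' := []) rfl).2.1
    obtain ⟨b1, b2⟩ := he.1 h0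
    refine ⟨hokx, hd, numOf g0, a1 ▸ numOf_lt g0, b1, guessSeq gs, rfl, fun j => ?_, b2⟩
    cases j with
    | zero => exact Nat.two_pow_pos _
    | succ j =>
      rw [guessSeq]
      by_cases hj : j < gs.length
      · rw [List.getD_eq_getElem _ _ hj, ← a3 _ (List.getElem_mem hj)]
        exact numOf_lt _
      · rw [List.getD_eq_default _ _ (by omega)]
        simp [numOf]
  · rintro ⟨-, -, N, hN, hSN, H, hH0, hH, hRH⟩
    obtain ⟨g0, a1, rfl⟩ := exists_numOf hN
    choose G hG1 hG2 using fun j => exists_numOf (hH j)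
    -- Round `j` guesses `H (j + 1)`, while `H 0` is the initial content of register `3`.
    set gs := (List.range (n0 x)).map fun j => G (j + 1) with hgs
    have hlen : gs.length = n0 x := by simp [hgs]
    have hseq : ∀ j ≤ n0 x, guessSeq gs j = H j := by
      intro j hj
      cases j with
      | zero => exact hH0.symm
      | succ j =>
        rw [guessSeq, List.getD_eq_getElem _ _ (by omega)]
        simp [hgs, hG2]
    obtain ⟨σ', e, he⟩ := run g0 gs a1 hlen fun l hl => by
      obtain ⟨j, -, rfl⟩ := List.mem_map.1 hl
      exact hG1 _
    refine ⟨_, σ', ?_, e, he.2 ⟨hSN, fun j hj => ?_⟩⟩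
    · have hc : ∀ l ∈ gs, l.length = c1 x := fun l hl => by
        obtain ⟨j, -, rfl⟩ := List.mem_map.1 hl
        exact hG1 _
      rw [List.length_append, a1, List.length_flatten, List.map_congr_left hc]
      simp [hlen]
    · rw [hseq _ hj, hseq _ hj.le]
      exact hRH j hj

end ParamLog

namespace ParamLog

/-! ## Embeddings and local data along a path-decomposition -/

variable {τ : Vocabulary}

/-- Partial homomorphisms on the bags of a path-decomposition that agree on consecutive bags and are
compatible with an injective colouring define an embedding. -/
theorem embeds_of_local {A B : Str τ} (X : ℕ → ℕ → Prop) (val : ℕ → ℕ → ℕ) (col : ℕ → ℕ) (p : ℕ)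
    (cover : ∀ a < A.n, ∃ j < A.n, X j a)
    (between : ∀ a < A.n, ∀ j₂ < A.n, ∀ j < j₂, ∀ j₁ < j, X j₁ a → X j₂ a → X j a)
    (tuple : ∀ i, ∀ t ∈ A.rel i, ∃ j < A.n, ∀ l, X j (t l))
    (inj : ∀ a < A.n, ∀ b < A.n, col a = col b → a = b)
    (lt : ∀ j < A.n, ∀ a < A.n, X j a → val j a < B.n)
    (color : ∀ j < A.n, ∀ a < A.n, X j a → val j a % p = col a)
    (agree : ∀ j, j + 1 < A.n → ∀ a < A.n, X j a → X (j + 1) a → val (j + 1) a = val j a)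
    (hom : ∀ j < A.n, ∀ i, ∀ t ∈ A.rel i, (∀ l, X j (t l)) →
      ∃ t' ∈ B.rel i, ∀ l, (t' l : ℕ) = val j (t l)) : A.Embeds B := by
  choose J hJ hX using fun a : Fin A.n => cover a a.2
  -- Agreement on consecutive bags spreads to any two bags that contain `a`, since `a` occurs in all
  -- bags between them. The value is thus independent of the chosen bag `J a`.
  have h1 : ∀ d, ∀ j, j + d < A.n → ∀ a < A.n, X j a → X (j + d) a → val (j + d) a = val j a := by
    intro d
    induction d with
    | zero => intros; rfl
    | succ d ih =>
      intro j hj a ha h0 h2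
      have h3 : X (j + d) a := by
        rcases Nat.eq_zero_or_pos d with rfl | hd
        · exact h0
        · exact between a ha (j + (d + 1)) hj (j + d) (by omega) j (by omega) h0 h2
      rw [← ih j (by omega) a ha h0 h3]
      exact agree (j + d) hj a ha h3 h2
  have h2 : ∀ j < A.n, ∀ a : Fin A.n, X j a → val (J a) a = val j a := by
    intro j hj a ha
    rcases le_total j (J a) with h | h
    · obtain ⟨d, hd⟩ := Nat.exists_eq_add_of_le h
      rw [hd]
      exact h1 d j (hd ▸ hJ a) a a.2 ha (hd ▸ hX a)
    · obtain ⟨d, rfl⟩ := Nat.exists_eq_add_of_le h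
      exact (h1 d (J a) hj a a.2 (hX a) ha).symm
  refine ⟨fun a => ⟨val (J a) a, lt _ (hJ a) a a.2 (hX a)⟩, fun i t ht => ?_, fun a b hab => ?_⟩
  · obtain ⟨j, hj, hjt⟩ := tuple i t ht
    obtain ⟨t', ht', e⟩ := hom j hj i t ht hjt
    convert ht' using 1
    funext l
    exact Fin.ext ((h2 j hj (t l) (hjt l)).trans (e l).symm)
  -- Equal images have equal residues, hence equal colours, and colours are injective.
  · have h3 : val (J a) a = val (J b) b := congrArg Fin.val hab
    refine Fin.ext (inj a a.2 b b.2 ?_)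
    rw [← color _ (hJ a) a a.2 (hX a), ← color _ (hJ b) b b.2 (hX b), h3]

/-- A path-decomposition can be reorganized such that it has as many bags as there are vertices. -/
theorem PathDecomposition.exists_bags {A : Str τ} (D : PathDecomposition A.gaifman) :
    ∃ X : ℕ → Finset (Fin A.n), (∀ j, ∃ i, X j ⊆ D.bag i) ∧ (∀ a, ∃ j < A.n, a ∈ X j) ∧
      (∀ a j₁ j j₂, j₁ < j → j < j₂ → j₂ < A.n → a ∈ X j₁ → a ∈ X j₂ → a ∈ X j) ∧
      ∀ i, ∀ t ∈ A.rel i, ∃ j < A.n, ∀ l, t l ∈ X j := by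
  classical
  have hne : ∀ a, (Finset.univ.filter fun i => a ∈ D.bag i).Nonempty := fun a => by
    obtain ⟨i, hi⟩ := D.cover a
    exact ⟨i, by simpa using hi⟩
  -- For each element the first bag that contains it is kept, and these bags are listed in their
  -- order along the path. This gives one bag for each element, possibly with repetitions.
  let first : Fin A.n → Fin D.k := fun a => (Finset.univ.filter fun i => a ∈ D.bag i).min' (hne a)
  have first_mem : ∀ a, a ∈ D.bag (first a) := fun a => by
    have := Finset.min'_mem _ (hne a)
    simpa using this
  have first_le : ∀ a i, a ∈ D.bag i → first a ≤ i := fun a i h =>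
    Finset.min'_le _ _ (by simpa using h)
  set σ := Tuple.sort first with hσ
  have hmono : Monotone (first ∘ σ) := Tuple.monotone_sort first
  let X : ℕ → Finset (Fin A.n) := fun j => if h : j < A.n then D.bag (first (σ ⟨j, h⟩)) else ∅
  have hX : ∀ j (h : j < A.n), X j = D.bag (first (σ ⟨j, h⟩)) := fun j h => dif_pos h
  have hXa : ∀ a, X (σ.symm a) = D.bag (first a) := fun a => by
    rw [hX _ (σ.symm a).2]; simp
  refine ⟨X, fun j => ?_, fun a => ⟨σ.symm a, (σ.symm a).2, ?_⟩, ?_, fun i t ht => ?_⟩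
  · by_cases h : j < A.n
    · exact ⟨_, (hX j h).subset⟩
    · exact ⟨first ⟨0, A.pos⟩, by simp [X, h]⟩
  · rw [hXa]; exact first_mem a
  · intro a j₁ j j₂ h1 h2 h3 m1 m2
    rw [hX _ (by omega)] at m1 m2 ⊢
    exact D.between _ _ _ (hmono (show (⟨j₁, _⟩ : Fin A.n) ≤ ⟨j, _⟩ from h1.le))
      (hmono (show (⟨j, _⟩ : Fin A.n) ≤ ⟨j₂, h3⟩ from h2.le)) a m1 m2
  · by_cases hl : Nonempty (Fin (τ.ar i))
    -- Take the entry that appears last. In its first bag every other entry of the tuple has already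
    -- appeared, and it has not yet disappeared because it shares some bag with `t l₀`.
    · obtain ⟨l₀, hl₀⟩ := Finite.exists_max fun l => first (t l)
      refine ⟨σ.symm (t l₀), (σ.symm _).2, fun l => ?_⟩
      rw [hXa]
      by_cases he : t l = t l₀
      · rw [he]; exact first_mem _
      · obtain ⟨b, hb1, hb2⟩ := D.edge (t l) (t l₀) ⟨he, i, t, ht, ⟨l, rfl⟩, ⟨l₀, rfl⟩⟩
        exact D.between _ _ b (hl₀ l) (first_le _ _ hb2) _ (first_mem _) hb1
    · exact ⟨0, A.pos, fun l => absurd ⟨l⟩ hl⟩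

theorem exists_decomposition {V : Type} [Fintype V] (G : SimpleGraph V) {w : ℕ}
    (h : pathwidth G ≤ w) : ∃ D : PathDecomposition G, ∀ i, (D.bag i).card ≤ w + 1 := by
  have hne : {w | ∃ D : PathDecomposition G, D.width = w}.Nonempty :=
    ⟨_, ⟨1, fun _ => Finset.univ, fun v => ⟨0, Finset.mem_univ v⟩,
      fun u v _ => ⟨0, Finset.mem_univ u, Finset.mem_univ v⟩,
      fun _ _ _ _ _ v _ _ => Finset.mem_univ v⟩, rfl⟩
  obtain ⟨D, hD⟩ := Nat.sInf_mem hne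
  refine ⟨D, fun i => ?_⟩
  have h1 : (D.bag i).card ≤ Finset.univ.sup fun i => (D.bag i).card :=
    Finset.le_sup (f := fun i => (D.bag i).card) (Finset.mem_univ i)
  change D.width = pathwidth G at hD
  rw [PathDecomposition.width] at hD
  omega

/-! ### Small moduli that separate numbers -/

/-- If all positive `q ≤ 2 * m` divide `d`, then so does the central binomial coefficient of `m`,
because the prime powers that divide it are at most `2 * m`. But this coefficient is at least `4 ^ m
/ (2 * m)`, hence at least `2 ^ m`, which exceeds `d`. -/
theorem exists_not_dvd {m d : ℕ} (hd : 0 < d) (h : d < 2 ^ m) : ∃ q ≤ 2 * m, 0 < q ∧ ¬ q ∣ d := by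
  by_contra! hall
  have hm : 0 < m := Nat.pos_of_ne_zero fun h0 => by subst h0; simp at h; omega
  have h1 : m.centralBinom ∣ d := by
    rw [Nat.dvd_iff_prime_pow_dvd_dvd]
    intro p k hp hk
    refine hall _ ?_ (by have := hp.pos; positivity)
    have hk' := (hp.pow_dvd_iff_le_factorization (Nat.centralBinom_ne_zero m)).1 hk
    exact (Nat.pow_le_pow_right hp.pos hk').trans 
      (Nat.pow_factorization_choose_le (by omega))
  have h2 := Nat.le_of_dvd hd h1
  have h3 := Nat.four_pow_le_two_mul_self_mul_centralBinom m hm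
  have h4 : 2 * m ≤ 2 ^ m := by
    obtain ⟨k, rfl⟩ := Nat.exists_eq_succ_of_ne_zero hm.ne'
    have : k < 2 ^ k := Nat.lt_two_pow_self
    rw [Nat.succ_eq_add_one, pow_succ]
    omega
  have h5 : (4 : ℕ) ^ m = 2 ^ m * 2 ^ m := by
    rw [← mul_pow]; norm_num
  have h6 : 2 * m * m.centralBinom < 2 ^ m * 2 ^ m := by
    calc 2 * m * m.centralBinom ≤ 2 ^ m * m.centralBinom := Nat.mul_le_mul_right _ h4
      _ < 2 ^ m * 2 ^ m := Nat.mul_lt_mul_of_pos_left (by omega) (by positivity)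
  omega

/-- The lemma `exists_not_dvd` is applied to the product of the distances between the values of `h`,
over all pairs of indices. A number that does not divide the product divides no factor, so it
separates all pairs. -/
theorem exists_separating_modulus {n b : ℕ} (hn : 0 < n) (h : Fin n → Fin b)
    (hh : Function.Injective h) : ∃ p ≤ 2 * (n * n * b.size), 0 < p ∧
      ∀ i j, (h i : ℕ) % p = (h j : ℕ) % p → i = j := by
  classical
  -- The diagonal pairs contribute the factor one, which keeps the product positive.
  let f : Fin n × Fin n → ℕ := fun q => if q.1 = q.2 then 1 else Nat.dist (h q.1) (h q.2)
  have hb : 0 < b := (h ⟨0, hn⟩).pos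
  have hf0 : ∀ q, 0 < f q := by
    intro q
    by_cases hq : q.1 = q.2
    · simp [f, hq]
    · simp only [f, hq, if_false]
      exact Nat.dist_pos_of_ne fun e => hq (hh (Fin.ext e))
  have hf1 : ∀ q, f q < 2 ^ b.size := by
    intro q
    have h1 := Nat.lt_size_self b
    by_cases hq : q.1 = q.2
    · simp only [f, hq, if_true]; omega
    · simp only [f, hq, if_false, Nat.dist]
      have := (h q.1).2
      have := (h q.2).2
      omega
  have hprod : ∏ q, f q < 2 ^ (n * n * b.size) := by
    calc ∏ q, f q < ∏ _q : Fin n × Fin n, 2 ^ b.size :=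
          Finset.prod_lt_prod_of_nonempty (fun q _ => hf0 q) (fun q _ => hf1 q)
            ⟨(⟨0, hn⟩, ⟨0, hn⟩), Finset.mem_univ _⟩
      _ = 2 ^ (n * n * b.size) := by
          rw [Finset.prod_const, Finset.card_univ, Fintype.card_prod, Fintype.card_fin, ← pow_mul,
            mul_comm]
  obtain ⟨p, hp, hp0, hpd⟩ := exists_not_dvd (Finset.prod_pos fun q _ => hf0 q) hprod
  refine ⟨p, hp, hp0, fun i j hij => ?_⟩
  by_contra hne
  refine hpd (dvd_trans ?_ (Finset.dvd_prod_of_mem f (Finset.mem_univ (i, j))))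
  simp only [f, hne, if_false, Nat.dist]
  rcases le_total (h i : ℕ) (h j) with hle | hle
  · rw [Nat.sub_eq_zero_of_le hle, zero_add]
    exact (Nat.modEq_iff_dvd' hle).1 hij
  · rw [Nat.sub_eq_zero_of_le hle, add_zero]
    exact (Nat.modEq_iff_dvd' hle).1 hij.symm

/-! ### Numbers with prescribed digits -/

theorem exists_digits {b : ℕ} (n : ℕ) {f : ℕ → ℕ} (hf : ∀ i < n, f i < b) :
    ∃ C < b ^ n, ∀ i < n, digit b C i = f i := by
  induction n generalizing f with
  | zero => exact ⟨0, by simp, by simp⟩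
  | succ n ih =>
    obtain ⟨C, h1, h2⟩ := ih (f := fun i => f (i + 1)) fun i hi => hf _ (by omega)
    have h0 := hf 0 (by omega)
    refine ⟨f 0 + b * C, ?_, fun i hi => ?_⟩
    · calc f 0 + b * C < b + b * C := by omega
        _ = b * (C + 1) := by ring
        _ ≤ b * b ^ n := Nat.mul_le_mul_left _ h1
        _ = b ^ (n + 1) := by ring
    · cases i with
      | zero => rw [digit, pow_zero, Nat.div_one, Nat.add_mul_mod_self_left, Nat.mod_eq_of_lt h0]
      | succ i =>
        rw [← h2 i (by omega), digit, digit, pow_succ', ← Nat.div_div_eq_div_mul,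
          Nat.add_mul_div_left _ _ (by omega), Nat.div_eq_of_lt h0, zero_add]

end ParamLog

namespace ParamLog

/-! ## Certificates for embeddings -/

/-- The bags are given by the binary digits of `Λ`. -/
def InBag (n Λ j a : ℕ) : Prop := digit 2 Λ (j * n + a) = 1

/-- The number of elements of a bag that are smaller than `a`. -/
def bagRank (n Λ j a : ℕ) : ℕ := ∑ b ∈ Finset.range a, digit 2 Λ (j * n + b)

/-- The map on the bag is given by the digits of `H`. -/
def bagValue (n m Λ H j a : ℕ) : ℕ := digit m H (bagRank n Λ j a)

/-- A certificate packs three numbers by pairing: the bags in the coding of `InBag`, the modulus,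
and the colours as digits in the base given by the modulus. -/
def certBags (N : ℕ) : ℕ := N.unpair.1

def certModulus (N : ℕ) : ℕ := N.unpair.2.unpair.1

def certColors (N : ℕ) : ℕ := N.unpair.2.unpair.2

/-- The sizes of the universes of the two structures. -/
noncomputable def univFst (x : List Bool) : ℕ := unVal x (vocEnd x)

noncomputable def univSnd (x : List Bool) : ℕ := unVal x (sndPos x)

/-- These conditions concern only the first structure and the certificate, and they are checked
once. That colours are distinct makes the residue checks of `RoundOK` yield injectivity. The sizes
of the bags are not tested. -/
def CertOK (x : List Bool) (N : ℕ) : Prop :=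
  (∀ a < univFst x, ∃ j < univFst x, InBag (univFst x) (certBags N) j a) ∧
  (∀ a < univFst x, ∀ j₂ < univFst x, ∀ j < j₂, ∀ j₁ < j, InBag (univFst x) (certBags N) j₁ a →
    InBag (univFst x) (certBags N) j₂ a → InBag (univFst x) (certBags N) j a) ∧
  (∀ i < vocLen x, ∀ q < relLen x (vocEnd x) i, ∃ j < univFst x, ∀ l < vocAr x i,
    InBag (univFst x) (certBags N) j (entry x (vocEnd x) i q l)) ∧
  ∀ a < univFst x, ∀ b < univFst x, digit (certModulus N) (certColors N) a =
    digit (certModulus N) (certColors N) b → a = b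

/-- Comparing residues with colours replaces the comparison with images that have been forgotten. In
round `0` the previous guess `H'` is not consulted. -/
def RoundOK (x : List Bool) (N j H H' : ℕ) : Prop :=
  (∀ a < univFst x, InBag (univFst x) (certBags N) j a →
    bagValue (univFst x) (univSnd x) (certBags N) H j a % certModulus N =
      digit (certModulus N) (certColors N) a ∧
    (0 < j → InBag (univFst x) (certBags N) (j - 1) a →
      bagValue (univFst x) (univSnd x) (certBags N) H j a =
        bagValue (univFst x) (univSnd x) (certBags N) H' (j - 1) a)) ∧
  ∀ i < vocLen x, ∀ q < relLen x (vocEnd x) i,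
    (∀ l < vocAr x i, InBag (univFst x) (certBags N) j (entry x (vocEnd x) i q l)) →
    ∃ q' < relLen x (sndPos x) i, ∀ l < vocAr x i, entry x (sndPos x) i q' l =
      bagValue (univFst x) (univSnd x) (certBags N) H j (entry x (vocEnd x) i q l)

/-- Number of binary digits of the modulus and of the colours. -/
noncomputable def modulusBits (x : List Bool) : ℕ :=
  (2 * (univFst x * univFst x * (univSnd x).size)).size

/-- By `pair_lt_two_pow` a pair costs twice a common bound for the bits of its components, hence the
two factors `2`. The bags take the square of the universe size; the other term suffices for the
modulus and for a colour below it for each element. -/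
noncomputable def certBits (x : List Bool) : ℕ :=
  2 * (univFst x * univFst x + 2 * ((univFst x + 1) * modulusBits x))

noncomputable def roundBits (W : ℕ) (x : List Bool) : ℕ := W * (univSnd x).size

theorem pair_lt_two_pow {a b k : ℕ} (ha : a < 2 ^ k) (hb : b < 2 ^ k) :
    Nat.pair a b < 2 ^ (2 * k) := by
  refine (Nat.pair_lt_max_add_one_sq a b).trans_le ?_
  rw [mul_comm 2 k, pow_mul]
  exact Nat.pow_le_pow_left (by have := max_lt ha hb; omega) 2

theorem bagRank_lt_bagRank {n Λ j a b : ℕ} (hab : a < b) (ha : InBag n Λ j a) :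
    bagRank n Λ j a < bagRank n Λ j b := by
  have h1 : bagRank n Λ j (a + 1) = bagRank n Λ j a + 1 := by
    rw [bagRank, Finset.sum_range_succ, ha, bagRank]
  have h2 : bagRank n Λ j (a + 1) ≤ bagRank n Λ j b :=
    Finset.sum_le_sum_of_subset (Finset.range_subset_range.2 hab)
  omega

theorem bagRank_injective {n Λ j a b : ℕ} (ha : InBag n Λ j a) (hb : InBag n Λ j b)
    (h : bagRank n Λ j a = bagRank n Λ j b) : a = b := by
  rcases lt_trichotomy a b with hab | hab | hab
  · have := bagRank_lt_bagRank hab ha; omega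
  · exact hab
  · have := bagRank_lt_bagRank hab hb; omega

theorem exists_bags_number {n : ℕ} (X : ℕ → Finset (Fin n)) : ∃ Λ < 2 ^ (n * n),
    (∀ j < n, ∀ a : Fin n, InBag n Λ j a ↔ a ∈ X j) ∧
    ∀ j < n, bagRank n Λ j n = (X j).card := by
  classical
  obtain ⟨Λ, h1, h2⟩ := exists_digits (b := 2) (n * n)
    (f := fun k => if ∃ a : Fin n, k % n = a ∧ a ∈ X (k / n) then 1 else 0)
    (fun i _ => by split <;> omega)
  have h3 : ∀ j < n, ∀ a : Fin n, digit 2 Λ (j * n + a) = if a ∈ X j then 1 else 0 := by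
    intro j hj a
    have ha := a.2
    rw [h2 _ (by nlinarith)]
    have e1 : (j * n + a) / n = j := by
      rw [mul_comm, Nat.mul_add_div (by omega), Nat.div_eq_of_lt ha, add_zero]
    have e2 : (j * n + a) % n = a := by
      rw [mul_comm, Nat.mul_add_mod, Nat.mod_eq_of_lt ha]
    simp only [e1, e2]
    congr 1
    refine propext ⟨?_, fun h => ⟨a, rfl, h⟩⟩
    rintro ⟨b, hb, h⟩
    rwa [Fin.ext hb]
  refine ⟨Λ, h1, fun j hj a => ?_, fun j hj => ?_⟩
  · rw [InBag, h3 j hj]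
    split <;> simp_all
  · rw [bagRank, ← Fin.sum_univ_eq_sum_range (fun b => digit 2 Λ (j * n + b))]
    simp only [h3 j hj]
    simp

/-- An element of the bag is addressed by its rank within the bag, so the map is stored with at most
`W` digits in base `m`, however large `n` is. -/
theorem exists_values_number {n m W Λ j : ℕ} (h : Fin n → Fin m) (hW : bagRank n Λ j n ≤ W)
    (hm : 0 < m) : ∃ H < 2 ^ (W * m.size), ∀ a : Fin n, InBag n Λ j a →
      bagValue n m Λ H j a = h a := by
  classical
  let f : ℕ → ℕ := fun r => if e : ∃ a : Fin n, InBag n Λ j a ∧ bagRank n Λ j a = r then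
    h e.choose else 0
  obtain ⟨H, h1, h2⟩ := exists_digits (b := m) W (f := f) fun i _ => by
    dsimp only [f]; split
    · exact Fin.isLt _
    · exact hm
  refine ⟨H, h1.trans_le ?_, fun a ha => ?_⟩
  · rw [mul_comm, pow_mul]
    exact Nat.pow_le_pow_left (Nat.lt_size_self m).le W
  · have hr : bagRank n Λ j a < W := (bagRank_lt_bagRank a.2 ha).trans_le hW
    have e : ∃ b : Fin n, InBag n Λ j b ∧ bagRank n Λ j b = bagRank n Λ j a := ⟨a, ha, rfl⟩
    rw [bagValue, h2 _ hr]
    dsimp only [f]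
    rw [dif_pos e]
    have := bagRank_injective e.choose_spec.1 ha e.choose_spec.2
    rw [Fin.ext this]

variable {τ : Vocabulary} {A B : Str τ} {x : List Bool}

theorem EncodesPair.certOK_iff (h : EncodesPair x A B) (N : ℕ) : CertOK x N ↔
    (∀ a < A.n, ∃ j < A.n, InBag A.n (certBags N) j a) ∧
    (∀ a < A.n, ∀ j₂ < A.n, ∀ j < j₂, ∀ j₁ < j, InBag A.n (certBags N) j₁ a →
      InBag A.n (certBags N) j₂ a → InBag A.n (certBags N) j a) ∧
    (∀ i, ∀ t ∈ A.rel i, ∃ j < A.n, ∀ l, InBag A.n (certBags N) j (t l)) ∧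
    ∀ a < A.n, ∀ b < A.n, digit (certModulus N) (certColors N) a =
      digit (certModulus N) (certColors N) b → a = b := by
  obtain ⟨-, hv, hA, hB, -⟩ := h.facts
  obtain ⟨hm, -, har, -⟩ := hv.voc_eq
  have hn : univFst x = A.n := hA.univ
  rw [CertOK, hn]
  refine and_congr_right fun _ => and_congr_right fun _ => and_congr_left fun _ => ?_
  constructor
  · intro h i t ht
    obtain ⟨q, hq, e⟩ := (hA.mem i t).1 ht
    obtain ⟨j, hj, hl⟩ := h i (by rw [hm]; exact i.2) q hq
    refine ⟨j, hj, fun l => ?_⟩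
    rw [← e l]
    exact hl l (by rw [har]; exact l.2)
  · intro h i hi q hq
    rw [hm] at hi
    obtain ⟨t, ht, e⟩ := hA.read ⟨i, hi⟩ q hq
    obtain ⟨j, hj, hl⟩ := h _ t ht
    refine ⟨j, hj, fun l hl' => ?_⟩
    have h4 := har ⟨i, hi⟩
    dsimp only at h4
    rw [h4] at hl'
    have := e ⟨l, hl'⟩
    dsimp only at this
    rw [this]
    exact hl _

theorem EncodesPair.roundOK_iff (h : EncodesPair x A B) (N j H H' : ℕ) : RoundOK x N j H H' ↔
    (∀ a < A.n, InBag A.n (certBags N) j a →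
      bagValue A.n B.n (certBags N) H j a % certModulus N =
        digit (certModulus N) (certColors N) a ∧
      (0 < j → InBag A.n (certBags N) (j - 1) a →
        bagValue A.n B.n (certBags N) H j a = bagValue A.n B.n (certBags N) H' (j - 1) a)) ∧
    ∀ i, ∀ t ∈ A.rel i, (∀ l, InBag A.n (certBags N) j (t l)) →
      ∃ t' ∈ B.rel i, ∀ l, (t' l : ℕ) = bagValue A.n B.n (certBags N) H j (t l) := by
  obtain ⟨-, hv, hA, hB, -⟩ := h.facts
  obtain ⟨hm, -, har, -⟩ := hv.voc_eq
  have hn : univFst x = A.n := hA.univ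
  have hn' : univSnd x = B.n := hB.univ
  rw [RoundOK, hn, hn']
  refine and_congr_right fun _ => ?_
  constructor
  · intro h i t ht hl
    obtain ⟨q, hq, e⟩ := (hA.mem i t).1 ht
    obtain ⟨q', hq', e'⟩ := h i (by rw [hm]; exact i.2) q hq fun l hl' => by
      rw [har] at hl'
      have := e ⟨l, hl'⟩
      dsimp only at this
      rw [this]
      exact hl _
    obtain ⟨t', ht', e''⟩ := hB.read i q' hq'
    exact ⟨t', ht', fun l => by rw [← e'', e' l (by rw [har]; exact l.2), e]⟩
  · intro h i hi q hq hl
    rw [hm] at hi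
    have h4 := har ⟨i, hi⟩
    dsimp only at h4
    obtain ⟨t, ht, e⟩ := hA.read ⟨i, hi⟩ q hq
    obtain ⟨t', ht', e'⟩ := h _ t ht fun l => by
      rw [← e l]
      exact hl l (by rw [h4]; exact l.2)
    obtain ⟨q', hq', e''⟩ := (hB.mem _ t').1 ht'
    refine ⟨q', hq', fun l hl' => ?_⟩
    rw [h4] at hl'
    have h5 := e ⟨l, hl'⟩
    have h6 := e'' ⟨l, hl'⟩
    dsimp only at h5 h6
    rw [h5, h6, e' ⟨l, hl'⟩]

/-- An embedding yields the certificate and the guesses: the bags of a decomposition of small width,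
a modulus that separates the images, their residues as colours, and the restrictions of the
embedding to the bags. Conversely `embeds_of_local` glues the guesses together. -/
theorem EncodesPair.embeds_iff (h : EncodesPair x A B) {w : ℕ} (hw : pathwidth A.gaifman ≤ w) :
    A.Embeds B ↔ ∃ N < 2 ^ certBits x, CertOK x N ∧ ∃ H : ℕ → ℕ, H 0 = 0 ∧
      (∀ j, H j < 2 ^ roundBits (w + 1) x) ∧
      ∀ j < univFst x, RoundOK x N j (H (j + 1)) (H j) := by
  simp only [h.certOK_iff, h.roundOK_iff, certBits, roundBits, modulusBits]
  obtain ⟨-, hv, hA, hB, -⟩ := h.facts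
  have hn : univFst x = A.n := hA.univ
  have hn' : univSnd x = B.n := hB.univ
  rw [hn, hn']
  constructor
  · rintro ⟨f, hf, hinj⟩
    obtain ⟨D, hD⟩ := exists_decomposition _ hw
    obtain ⟨X, hX1, hX2, hX3, hX4⟩ := D.exists_bags
    obtain ⟨Λ, hΛ, hΛ1, hΛ2⟩ := exists_bags_number X
    obtain ⟨p, hp, hp0, hpi⟩ := exists_separating_modulus A.pos f hinj
    have hp' : p < 2 ^ (2 * (A.n * A.n * B.n.size)).size := hp.trans_lt (Nat.lt_size_self _)
    set s := (2 * (A.n * A.n * B.n.size)).size with hs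
    obtain ⟨C, hC, hC1⟩ := exists_digits (b := p) A.n
      (f := fun a => if h : a < A.n then (f ⟨a, h⟩ : ℕ) % p else 0) fun i hi => by
        rw [dif_pos hi]; exact Nat.mod_lt _ hp0
    have hC2 : ∀ a : Fin A.n, digit p C a = (f a : ℕ) % p := fun a => by
      rw [hC1 a a.2, dif_pos a.2]
    have hC' : C < 2 ^ (A.n * s) := hC.trans_le (by
      rw [mul_comm, pow_mul]; exact Nat.pow_le_pow_left hp'.le _)
    have hW : ∀ j < A.n, bagRank A.n Λ j A.n ≤ w + 1 := fun j hj => by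
      obtain ⟨i, hi⟩ := hX1 j
      rw [hΛ2 j hj]
      exact (Finset.card_le_card hi).trans (hD i)
    have hH : ∀ j, ∃ H < 2 ^ ((w + 1) * B.n.size), j < A.n → ∀ a : Fin A.n, InBag A.n Λ j a →
        bagValue A.n B.n Λ H j a = f a := by
      intro j
      by_cases hj : j < A.n
      · obtain ⟨H, h1, h2⟩ := exists_values_number f (hW j hj) B.pos
        exact ⟨H, h1, fun _ => h2⟩
      · exact ⟨0, by positivity, fun h => absurd h hj⟩
    choose H hH1 hH2 using hH
    have hle : ∀ {k l}, k ≤ l → 2 ^ k ≤ 2 ^ l := fun h => Nat.pow_le_pow_right (by omega) h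
    have e1 : certBags (Nat.pair Λ (Nat.pair p C)) = Λ := by simp [certBags]
    have e2 : certModulus (Nat.pair Λ (Nat.pair p C)) = p := by simp [certModulus]
    have e3 : certColors (Nat.pair Λ (Nat.pair p C)) = C := by simp [certColors]
    refine ⟨Nat.pair Λ (Nat.pair p C), ?_, ?_⟩
    · refine pair_lt_two_pow (hΛ.trans_le (hle (Nat.le_add_right _ _)))
        ((pair_lt_two_pow (k := (A.n + 1) * s) ?_ ?_).trans_le (hle (Nat.le_add_left _ _)))
      · exact hp'.trans_le (hle (by nlinarith))
      · exact hC'.trans_le (hle (by nlinarith))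
    rw [e1, e2, e3]
    -- The guess of round `j` is entry `j + 1` of the sequence, and entry `0` is a dummy previous
    -- guess; this explains the shift of `H`.
    refine ⟨⟨fun a ha => ?_, fun a ha j₂ hj₂ j hj j₁ hj₁ => ?_, fun i t ht => ?_,
      fun a ha b hb hab => ?_⟩, fun j => if j = 0 then 0 else H (j - 1), rfl, fun j => ?_,
      fun j hj => ⟨fun a ha hab => ⟨?_, fun hj0 hab' => ?_⟩, fun i t ht hl => ?_⟩⟩
    · obtain ⟨j, hj, hjX⟩ := hX2 ⟨a, ha⟩
      exact ⟨j, hj, (hΛ1 j hj ⟨a, ha⟩).2 hjX⟩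
    · have k1 := hΛ1 j₁ (by omega) ⟨a, ha⟩
      have k2 := hΛ1 j (by omega) ⟨a, ha⟩
      have k3 := hΛ1 j₂ hj₂ ⟨a, ha⟩
      dsimp only at k1 k2 k3
      rw [k1, k2, k3]
      exact hX3 _ _ _ _ hj₁ hj hj₂
    · obtain ⟨j, hj, hl⟩ := hX4 i t ht
      exact ⟨j, hj, fun l => (hΛ1 j hj _).2 (hl l)⟩
    · have k1 := hC2 ⟨a, ha⟩
      have k2 := hC2 ⟨b, hb⟩
      dsimp only at k1 k2
      rw [k1, k2] at hab
      exact congrArg Fin.val (hpi _ _ hab)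
    · dsimp only
      split
      · positivity
      · exact hH1 _
    · have k1 := hC2 ⟨a, ha⟩
      have k2 := hH2 j hj ⟨a, ha⟩ hab
      dsimp only at k1 k2
      simp only [Nat.add_sub_cancel, Nat.add_eq_zero_iff, one_ne_zero, and_false, if_false]
      rw [k1, k2]
    · have k1 := hH2 j hj ⟨a, ha⟩ hab
      have k2 := hH2 (j - 1) (by omega) ⟨a, ha⟩ hab'
      dsimp only at k1 k2
      simp only [Nat.add_sub_cancel, Nat.add_eq_zero_iff, one_ne_zero, and_false, if_false,
        hj0.ne', k1, k2]
    · refine ⟨f ∘ t, hf i t ht, fun l => ?_⟩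
      simp only [Nat.add_sub_cancel, Nat.add_eq_zero_iff, one_ne_zero, and_false, if_false]
      exact (hH2 j hj (t l) (hl l)).symm
  -- Soundness does not need small bags: whatever was guessed, `bagValue` is a digit in base `B.n`
  -- and so denotes an element of `B`.
  · rintro ⟨N, -, ⟨h1, h2, h3, h4⟩, H, -, -, hR⟩
    refine embeds_of_local (InBag A.n (certBags N))
      (fun j a => bagValue A.n B.n (certBags N) (H (j + 1)) j a) _ (certModulus N) h1 h2 h3 h4
      (fun j hj a ha hX => Nat.mod_lt _ B.pos) (fun j hj a ha hX => ((hR j hj).1 a ha hX).1)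
      (fun j hj a ha hX hX' => ?_) fun j hj => (hR j hj).2
    exact ((hR (j + 1) hj).1 a ha hX').2 (by omega) hX

end ParamLog

/-! ### Checking certificates and rounds with polynomially bounded counters. -/

namespace ParamLog

variable {n : ℕ} {f g h k l : List Bool → (Fin n → ℕ) → ℕ}

theorem PC.sqrt (hf : PC f) : PC fun x v => (f x v).sqrt := by
  have h1 : PC (n := 1) fun _ v => (v 0).sqrt := by
    refine (PC.bsearch (n := 1) (f := fun _ v => v 0) (p := fun _ v q => v 0 < (q + 1) * (q + 1))
      (PC.var 0) (PD.lt (PC.var 1) ((PC.var 0).succ.mul (PC.var 0).succ))).of_eq fun x v => ?_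
    refine bsearch_eq (Nat.sqrt_le_self _) (fun _ => Nat.lt_succ_sqrt _) fun j hj => ?_
    rw [not_lt]
    exact (Nat.mul_le_mul hj hj).trans (Nat.sqrt_le _)
  exact h1.comp1 hf

theorem PC.unpair_fst (hf : PC f) : PC fun x v => (f x v).unpair.1 := by
  classical
  refine (PC.ite (PD.lt (hf.sub (hf.sqrt.mul hf.sqrt)) hf.sqrt) (hf.sub (hf.sqrt.mul hf.sqrt))
    hf.sqrt).of_eq fun x v => ?_
  rw [Nat.unpair]
  split <;> rfl

theorem PC.unpair_snd (hf : PC f) : PC fun x v => (f x v).unpair.2 := by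
  classical
  refine (PC.ite (PD.lt (hf.sub (hf.sqrt.mul hf.sqrt)) hf.sqrt) hf.sqrt
    ((hf.sub (hf.sqrt.mul hf.sqrt)).sub hf.sqrt)).of_eq fun x v => ?_
  rw [Nat.unpair]
  split <;> rfl

theorem PC.pair (hf : PC f) (hg : PC g) : PC fun x v => Nat.pair (f x v) (g x v) := by
  classical
  exact PC.ite (PD.lt hf hg) ((hg.mul hg).add hf) (((hf.mul hf).add hf).add hg)

theorem pc_univFst : PC (n := n) fun x _ => univFst x := pc_unVal pc_vocEnd

theorem pc_univSnd : PC (n := n) fun x _ => univSnd x := pc_unVal pc_sndPos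

theorem pc_certBags (hf : PC f) : PC fun x v => certBags (f x v) := hf.unpair_fst

theorem pc_certModulus (hf : PC f) : PC fun x v => certModulus (f x v) := hf.unpair_snd.unpair_fst

theorem pc_certColors (hf : PC f) : PC fun x v => certColors (f x v) := hf.unpair_snd.unpair_snd

theorem pd_inBag (hf : PC f) (hg : PC g) (hh : PC h) :
    PD fun x v => InBag (univFst x) (certBags (f x v)) (g x v) (h x v) :=
  PD.eq (PC.digit (.const 2) (pc_certBags hf) ((hg.mul pc_univFst).add hh)) (.const 1)

theorem pc_bagValue (hf : PC f) (hg : PC g) (hh : PC h) (hk : PC k) :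
    PC fun x v => bagValue (univFst x) (univSnd x) (certBags (f x v)) (g x v) (h x v) (k x v) :=
  (PC.digit pc_univSnd (PC.var 1) (PC.sum (g := fun x v b =>
      ParamLog.digit 2 (certBags (v 0)) (v 2 * univFst x + b)) (PC.var 3)
      (PC.digit (.const 2) (pc_certBags (PC.var 1)) (((PC.var 3).mul pc_univFst).add (PC.var 0)))) :
    PC (n := 4) fun x v => bagValue (univFst x) (univSnd x) (certBags (v 0)) (v 1) (v 2)
      (v 3)).comp4 hf hg hh hk

theorem pd_certOK : PD (n := 1) fun x v => CertOK x (v 0) := by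
  refine PD.and ?_ (PD.and ?_ (PD.and ?_ ?_))
  · exact PD.ball (p := fun x v a => ∃ j < univFst x, InBag (univFst x) (certBags (v 0)) j a)
      pc_univFst (PD.bex (p := fun x w j => InBag (univFst x) (certBags (w 1)) j (w 0)) pc_univFst
        (pd_inBag (PC.var 2) (PC.var 0) (PC.var 1)))
  · refine PD.ball (p := fun x v a => ∀ j₂ < univFst x, ∀ j < j₂, ∀ j₁ < j,
      InBag (univFst x) (certBags (v 0)) j₁ a → InBag (univFst x) (certBags (v 0)) j₂ a →
      InBag (univFst x) (certBags (v 0)) j a) pc_univFst ?_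
    refine PD.ball (p := fun x w j₂ => ∀ j < j₂, ∀ j₁ < j,
      InBag (univFst x) (certBags (w 1)) j₁ (w 0) → InBag (univFst x) (certBags (w 1)) j₂ (w 0) →
      InBag (univFst x) (certBags (w 1)) j (w 0)) pc_univFst ?_
    refine PD.ball (p := fun x w j => ∀ j₁ < j,
      InBag (univFst x) (certBags (w 2)) j₁ (w 1) → InBag (univFst x) (certBags (w 2)) (w 0) (w 1) →
      InBag (univFst x) (certBags (w 2)) j (w 1)) (PC.var 0) ?_
    refine PD.ball (p := fun x w j₁ =>
      InBag (univFst x) (certBags (w 3)) j₁ (w 2) → InBag (univFst x) (certBags (w 3)) (w 1) (w 2) →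
      InBag (univFst x) (certBags (w 3)) (w 0) (w 2)) (PC.var 0) ?_
    exact PD.imp (pd_inBag (PC.var 4) (PC.var 0) (PC.var 3))
      (PD.imp (pd_inBag (PC.var 4) (PC.var 2) (PC.var 3))
        (pd_inBag (PC.var 4) (PC.var 1) (PC.var 3)))
  · refine PD.ball (p := fun x v i => ∀ q < relLen x (vocEnd x) i, ∃ j < univFst x,
      ∀ l < vocAr x i, InBag (univFst x) (certBags (v 0)) j (entry x (vocEnd x) i q l)) pc_vocLen ?_
    refine PD.ball (p := fun x w q => ∃ j < univFst x, ∀ l < vocAr x (w 0),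
      InBag (univFst x) (certBags (w 1)) j (entry x (vocEnd x) (w 0) q l))
      (pc_relLen pc_vocEnd (PC.var 0)) ?_
    refine PD.bex (p := fun x w j => ∀ l < vocAr x (w 1),
      InBag (univFst x) (certBags (w 2)) j (entry x (vocEnd x) (w 1) (w 0) l)) pc_univFst ?_
    refine PD.ball (p := fun x w l =>
      InBag (univFst x) (certBags (w 3)) (w 0) (entry x (vocEnd x) (w 2) (w 1) l))
      (pc_vocAr (PC.var 2)) ?_
    exact pd_inBag (PC.var 4) (PC.var 1) (pc_entry pc_vocEnd (PC.var 3) (PC.var 2) (PC.var 0))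
  · refine PD.ball (p := fun x v a => ∀ b < univFst x, digit (certModulus (v 0)) (certColors (v 0))
      a = digit (certModulus (v 0)) (certColors (v 0)) b → a = b) pc_univFst ?_
    refine PD.ball (p := fun x w b => digit (certModulus (w 1)) (certColors (w 1)) (w 0) =
      digit (certModulus (w 1)) (certColors (w 1)) b → w 0 = b) pc_univFst ?_
    exact PD.imp (PD.eq
      (PC.digit (pc_certModulus (PC.var 2)) (pc_certColors (PC.var 2)) (PC.var 1))
      (PC.digit (pc_certModulus (PC.var 2)) (pc_certColors (PC.var 2)) (PC.var 0)))
      (PD.eq (PC.var 1) (PC.var 0))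

theorem pd_roundOK : PD (n := 4) fun x v => RoundOK x (v 0) (v 1) (v 2) (v 3) := by
  refine PD.and ?_ ?_
  · refine PD.ball (p := fun x v a => InBag (univFst x) (certBags (v 0)) (v 1) a →
      bagValue (univFst x) (univSnd x) (certBags (v 0)) (v 2) (v 1) a % certModulus (v 0) =
        digit (certModulus (v 0)) (certColors (v 0)) a ∧
      (0 < v 1 → InBag (univFst x) (certBags (v 0)) (v 1 - 1) a →
        bagValue (univFst x) (univSnd x) (certBags (v 0)) (v 2) (v 1) a =
          bagValue (univFst x) (univSnd x) (certBags (v 0)) (v 3) (v 1 - 1) a)) pc_univFst ?_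
    refine PD.imp (pd_inBag (PC.var 1) (PC.var 2) (PC.var 0)) (PD.and (PD.eq (PC.mod
      (pc_bagValue (PC.var 1) (PC.var 3) (PC.var 2) (PC.var 0)) (pc_certModulus (PC.var 1)))
      (PC.digit (pc_certModulus (PC.var 1)) (pc_certColors (PC.var 1)) (PC.var 0))) ?_)
    exact PD.imp (PD.lt (.const 0) (PC.var 2)) (PD.imp
      (pd_inBag (PC.var 1) (PC.var 2).pred (PC.var 0)) (PD.eq
        (pc_bagValue (PC.var 1) (PC.var 3) (PC.var 2) (PC.var 0))
        (pc_bagValue (PC.var 1) (PC.var 4) (PC.var 2).pred (PC.var 0))))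
  · refine PD.ball (p := fun x v i => ∀ q < relLen x (vocEnd x) i,
      (∀ l < vocAr x i, InBag (univFst x) (certBags (v 0)) (v 1) (entry x (vocEnd x) i q l)) →
      ∃ q' < relLen x (sndPos x) i, ∀ l < vocAr x i, entry x (sndPos x) i q' l =
        bagValue (univFst x) (univSnd x) (certBags (v 0)) (v 2) (v 1)
          (entry x (vocEnd x) i q l)) pc_vocLen ?_
    refine PD.ball (p := fun x w q => (∀ l < vocAr x (w 0), InBag (univFst x) (certBags (w 1)) (w 2)
        (entry x (vocEnd x) (w 0) q l)) →
      ∃ q' < relLen x (sndPos x) (w 0), ∀ l < vocAr x (w 0), entry x (sndPos x) (w 0) q' l =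
        bagValue (univFst x) (univSnd x) (certBags (w 1)) (w 3) (w 2)
          (entry x (vocEnd x) (w 0) q l)) (pc_relLen pc_vocEnd (PC.var 0)) ?_
    refine PD.imp ?_ ?_
    · refine PD.ball (p := fun x w l => InBag (univFst x) (certBags (w 2)) (w 3)
        (entry x (vocEnd x) (w 1) (w 0) l)) (pc_vocAr (PC.var 1)) ?_
      exact pd_inBag (PC.var 3) (PC.var 4) (pc_entry pc_vocEnd (PC.var 2) (PC.var 1) (PC.var 0))
    · refine PD.bex (p := fun x w q' => ∀ l < vocAr x (w 1), entry x (sndPos x) (w 1) q' l =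
        bagValue (univFst x) (univSnd x) (certBags (w 2)) (w 4) (w 3)
          (entry x (vocEnd x) (w 1) (w 0) l)) (pc_relLen pc_sndPos (PC.var 1)) ?_
      refine PD.ball (p := fun x w l => entry x (sndPos x) (w 2) (w 0) l =
        bagValue (univFst x) (univSnd x) (certBags (w 3)) (w 5) (w 4)
          (entry x (vocEnd x) (w 2) (w 1) l)) (pc_vocAr (PC.var 2)) ?_
      exact PD.eq (pc_entry pc_sndPos (PC.var 3) (PC.var 1) (PC.var 0))
        (pc_bagValue (PC.var 4) (PC.var 6) (PC.var 5)
          (pc_entry pc_vocEnd (PC.var 3) (PC.var 2) (PC.var 0)))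

theorem pc_modulusBits : PC (n := n) fun x _ => modulusBits x :=
  ((PC.const 2).mul ((pc_univFst.mul pc_univFst).mul pc_univSnd.size)).size

theorem pc_certBits : PC (n := n) fun x _ => certBits x :=
  (PC.const 2).mul ((pc_univFst.mul pc_univFst).add
    ((PC.const 2).mul (pc_univFst.succ.mul pc_modulusBits)))

theorem pc_roundBits (W : ℕ) : PC (n := n) fun x _ => roundBits W x :=
  (PC.const W).mul pc_univSnd.size

end ParamLog

namespace ParamLog

/-! ## Membership in a decidable class -/

theorem encode_drop_le (l : List Bool) (i : ℕ) :
    Encodable.encode (l.drop i) ≤ Encodable.encode l := by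
  induction l generalizing i with
  | nil => simp
  | cons b l ih =>
    cases i with
    | zero => exact le_rfl
    | succ i =>
      rw [List.drop_succ_cons, Encodable.encode_list_cons]
      exact ((ih i).trans (Nat.right_le_pair _ _)).trans (Nat.le_succ _)

/-- The code of the part of `x` that encodes the vocabulary and the first structure. -/
noncomputable def fstCode (x : List Bool) : ℕ := Encodable.encode (x.take (sndPos x))

/-- The code of a bit list is an iterated pairing, computed by recursion from the last bit to the
first. It is not polynomially bounded in the length of `x`, so its value enters the bound on the
counters and the function is treated by `Sem` directly. -/
theorem sem_fstCode : ∃ c, Sem (n := 0) fun x _ y V => sndPos x ≤ x.length ∧ y = fstCode x ∧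
    (x.length + 2 + fstCode x) ^ c ≤ V := by
  have hE : PC (n := 2) fun x v => Nat.pair (bitAt x (sndPos x - 1 - v 0) - 1) (v 1) + 1 :=
    (((pc_sndPos.sub (.const 1)).sub (PC.var 0)).bitAt.pred.pair (PC.var 1)).succ
  obtain ⟨c, -, hE⟩ := hE
  obtain ⟨c', -, hp⟩ := (pc_sndPos : PC (n := 0) _)
  have hprec := Sem.prec (n := 0) (sem_zero (n := 0)) hE
  refine ⟨c + c' + 1, (Sem.comp hprec (E := fun _ => _) fun _ => hp).mono ?_⟩
  rintro x v y V ⟨h1, rfl, h2⟩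
  set B := x.length + 2 + fstCode x with hB
  have hV : ∀ i ≤ c + c' + 1, B ^ i ≤ V := fun i hi =>
    (Nat.pow_le_pow_right (by omega) hi).trans h2
  have hBV : B ≤ V := by simpa using hV 1 (by omega)
  set p := sndPos x with hpp
  set L := x.take p with hL
  have hLl : L.length = p := by rw [hL, List.length_take]; omega
  have hs : ∀ i, Encodable.encode (L.drop i) ≤ fstCode x := encode_drop_le L
  refine ⟨V, le_rfl, fun _ => p, fun _ => ⟨rfl, B, ⟨by omega, by omega, fun i => i.elim0⟩,
    hV _ (by omega)⟩, fun j => Encodable.encode (L.drop (p - j)), by simp [fstCode, hL, hpp], ?_,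
    fun j hj => ⟨?_, B, ⟨by omega, by omega, ?_⟩, hV _ (by omega)⟩, by
      dsimp only; omega, fun j hj => ?_⟩
  · simp [← hLl]
  · dsimp only at hj
    have hi : p - (j + 1) < L.length := by omega
    have hx : p - (j + 1) < x.length := by omega
    change Encodable.encode (L.drop (p - (j + 1))) =
      Nat.pair (bitAt x (p - 1 - j) - 1) (Encodable.encode (L.drop (p - j))) + 1
    rw [List.drop_eq_getElem_cons hi, Encodable.encode_list_cons,
      show p - (j + 1) + 1 = p - j by omega]
    have hb : Encodable.encode L[p - (j + 1)] = bitAt x (p - 1 - j) - 1 := by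
      have e : L[p - (j + 1)] = x[p - (j + 1)] := by simp [hL]
      rw [e, show p - 1 - j = p - (j + 1) by omega, bitAt, List.getElem?_eq_getElem hx]
      cases x[p - (j + 1)] <;> rfl
    rw [hb]
  · dsimp only at hj
    intro i
    refine Fin.cases ?_ (fun i => ?_) i
    · change j ≤ B
      omega
    · refine Fin.cases ?_ (fun i => i.elim0) i
      exact (hs _).trans (by omega)
  · exact (hs _).trans (by omega)

/-- A decidable property of strings becomes a computable function `F` of their codes, to which
`sem_of_computable` applies. The additional counters are bounded in terms of the code of the first
structure alone. -/
theorem exists_sem_mem {p : List Bool → Prop} (hp : ComputablePred p) : ∃ c, ∃ b : ℕ → ℕ,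
    Computable b ∧ Sem (n := 0) fun x _ y V => sndPos x ≤ x.length ∧
      (y ≤ 1 ∧ (y ≠ 0 ↔ p (x.take (sndPos x)))) ∧ (x.length + 2 + fstCode x) ^ c ≤ V ∧
      b (fstCode x) ≤ V := by
  obtain ⟨hd, hp⟩ := hp
  let F : ℕ → ℕ := fun k => bif ((Encodable.decode (α := List Bool) k).map fun l =>
    decide (p l)).getD false then 1 else 0
  have hF : Computable F := by
    refine Computable.cond (Computable.option_getD ?_ (Computable.const false))
      (Computable.const 1) (Computable.const 0)
    exact Computable.option_map Computable.decode (hp.comp Computable.snd)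
  obtain ⟨b, hb, hS⟩ := sem_of_computable hF
  obtain ⟨c, hc⟩ := sem_fstCode
  refine ⟨c + 1, b, hb, (Sem.comp hS (E := fun _ => _) fun _ => hc).mono ?_⟩
  rintro x v y V ⟨h1, ⟨hy1, hy⟩, h2, h3⟩
  refine ⟨V, le_rfl, fun _ => fstCode x, fun _ => ⟨h1, rfl, ?_⟩, ?_, h3⟩
  · exact (Nat.pow_le_pow_right (by omega) (by omega)).trans h2
  · have e : F (fstCode x) = if p (x.take (sndPos x)) then 1 else 0 := by
      simp only [F, fstCode, Encodable.encodek, Option.map_some, Option.getD_some]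
      by_cases h : p (x.take (sndPos x)) <;> simp [h]
    rw [e]
    by_cases h : p (x.take (sndPos x)) <;> simp only [h, if_true, if_false] <;> simp [h] at hy <;>
      omega

end ParamLog

namespace ParamLog

/-! ## Resource bounds -/

variable {τ : Vocabulary} {A B : Str τ} {x : List Bool}

theorem length_encList_le {α : Type} {e : α → List Bool} {c : ℕ} (l : List α)
    (h : ∀ a ∈ l, (e a).length ≤ c) : (encList e l).length ≤ l.length * (c + 1) + 1 := by
  rw [encList, List.length_append, List.length_singleton]
  refine Nat.add_le_add_right ?_ 1
  induction l with
  | nil => simp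
  | cons a l ih =>
    rw [List.flatMap_cons, List.length_append, List.length_cons, List.length_cons, add_mul, one_mul]
    have h1 := ih fun b hb => h b (by simp [hb])
    have h2 := h a (by simp)
    omega

theorem length_flatMap_le {α : Type} {e : α → List Bool} {c : ℕ} (l : List α)
    (h : ∀ a ∈ l, (e a).length ≤ c) : (l.flatMap e).length ≤ l.length * c := by
  induction l with
  | nil => simp
  | cons a l ih =>
    rw [List.flatMap_cons, List.length_append, List.length_cons, add_mul, one_mul]
    have h1 := ih fun b hb => h b (by simp [hb])
    have h2 := h a (by simp)
    omega

theorem nat_size_le (n : ℕ) : n.size ≤ n := Nat.size_le.2 Nat.lt_two_pow_self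

/-- Symbols of arity zero contribute nothing to the sum in the size. Their relations have at most
one tuple, and the universe is nonempty. -/
theorem Str.card_rel_le (A : Str τ) (i : Fin τ.m) : (A.rel i).card ≤ A.size := by
  classical
  have hp := A.pos
  by_cases h : τ.ar i = 0
  · have : IsEmpty (Fin (τ.ar i)) := by rw [h]; infer_instance
    have h1 : (A.rel i).card ≤ 1 := Finset.card_le_one.2 fun a _ b _ => Subsingleton.elim a b
    rw [Str.size]
    omega
  · have h1 := Finset.single_le_sum (f := fun i => (A.rel i).card * τ.ar i)
      (fun _ _ => Nat.zero_le _) (Finset.mem_univ i)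
    have h2 : (A.rel i).card * 1 ≤ (A.rel i).card * τ.ar i :=
      Nat.mul_le_mul_left _ (Nat.one_le_iff_ne_zero.2 h)
    rw [Str.size]
    omega

/-- Bound on the length of the encodings of structures of size `k` and arity at most `r`. -/
def encBound (r k : ℕ) : ℕ :=
  k * (r + 2) + 1 + (k + 1 + k * (k * (r * (2 * k + 1) + 1) + 1))

theorem Encodes.length_le {y : List Bool} (h : Encodes y A) {r : ℕ} (hr : ∀ i, τ.ar i ≤ r) :
    y.length ≤ encBound r A.size := by
  classical
  obtain ⟨z, ⟨L, hL, rfl⟩, rfl⟩ := h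
  have hm : τ.m ≤ A.size := by rw [Str.size]; omega
  have hn : A.n ≤ A.size := by rw [Str.size]; omega
  rw [List.length_append, List.length_append, encBound]
  refine Nat.add_le_add ?_ (Nat.add_le_add ?_ ?_)
  · refine (length_encList_le (c := r + 1) _ fun a ha => ?_).trans ?_
    · obtain ⟨i, rfl⟩ := (List.mem_ofFn' _ _).1 ha
      rw [length_encUnary]
      exact Nat.add_le_add_right (hr i) 1
    · rw [List.length_ofFn]
      exact Nat.add_le_add_right (Nat.mul_le_mul_right _ hm) 1
  · rw [length_encUnary]
    omega
  · refine (length_flatMap_le (c := A.size * (r * (2 * A.size + 1) + 1) + 1) _ fun i _ => ?_).trans ?_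
    · refine (length_encList_le (c := r * (2 * A.size + 1)) _ fun t _ => ?_).trans ?_
      · rw [encTuple]
        refine (length_flatMap_le (c := 2 * A.size + 1) _ fun a ha => ?_).trans ?_
        · obtain ⟨l, rfl⟩ := (List.mem_ofFn' _ _).1 ha
          rw [length_encBinary]
          have := nat_size_le (t l)
          have := (t l).2
          dsimp only
          omega
        · rw [List.length_ofFn]
          exact Nat.mul_le_mul_right _ (hr i)
      · have h1 : A.rel i = (L i).toFinset := by ext t; simp [(hL i).2]
        have h2 := A.card_rel_le i
        rw [h1, List.toFinset_card_of_nodup (hL i).1] at h2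
        exact Nat.add_le_add_right (Nat.mul_le_mul_right _ h2) 1
    · rw [List.length_finRange]
      exact Nat.mul_le_mul_right _ hm

/-- Bound on the codes of lists of a given length. -/
def codeBound : ℕ → ℕ
  | 0 => 0
  | j + 1 => Nat.pair 1 (codeBound j) + 1

theorem codeBound_mono : Monotone codeBound := monotone_nat_of_le_succ fun _ =>
  (Nat.right_le_pair _ _).trans (Nat.le_succ _)

theorem encode_le_codeBound (l : List Bool) : Encodable.encode l ≤ codeBound l.length := by
  induction l with
  | nil => simp
  | cons b l ih =>
    rw [Encodable.encode_list_cons, List.length_cons, codeBound]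
    have hb : Encodable.encode b ≤ 1 := by cases b <;> decide
    refine Nat.succ_le_succ ?_
    rcases hb.lt_or_eq with h | h
    · exact (Nat.pair_lt_pair_left _ h).le.trans (by
        rcases ih.lt_or_eq with h' | h'
        · exact (Nat.pair_lt_pair_right _ h').le
        · rw [h'])
    · rw [h]
      rcases ih.lt_or_eq with h' | h'
      · exact (Nat.pair_lt_pair_right _ h').le
      · rw [h']

theorem primrec_codeBound : Primrec codeBound := by
  have h0 : Primrec₂ fun _ r : ℕ => Nat.pair 1 r + 1 :=
    (Primrec.succ.comp (Primrec₂.natPair.comp (Primrec.const 1) Primrec.snd)).to₂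
  refine (Primrec.nat_rec₁ 0 h0).of_eq fun n => ?_
  induction n with
  | zero => rfl
  | succ n ih => rw [codeBound, ← ih]

/-- It dominates `b` on the whole interval up to `k`. This is needed because `b` may fail to be
monotone, while the parameter gives only an upper bound for the argument of `b`. -/
def natSum (b : ℕ → ℕ) (k : ℕ) : ℕ := ∑ i ∈ Finset.range (k + 1), b i

theorem computable_natSum {b : ℕ → ℕ} (hb : Computable b) : Computable (natSum b) := by
  have hadd : Computable₂ fun a b : ℕ => a + b := Primrec.nat_add.to_comp
  have h1 : Computable₂ fun (_ : ℕ) (p : ℕ × ℕ) => p.2 + b (p.1 + 1) :=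
    hadd.comp (Computable.snd.comp Computable.snd)
      (hb.comp (Computable.succ.comp (Computable.fst.comp Computable.snd)))
  refine (Computable.nat_rec Computable.id (Computable.const (b 0)) h1).of_eq fun n => ?_
  induction n with
  | zero => simp [natSum]
  | succ n ih =>
    rw [natSum, Finset.sum_range_succ]
    exact congrArg (· + b (n + 1)) ih

theorem le_natSum {b : ℕ → ℕ} {i k : ℕ} (h : i ≤ k) : b i ≤ natSum b k :=
  Finset.single_le_sum (f := b) (fun _ _ => Nat.zero_le _) (Finset.mem_range.2 (by omega))

theorem size_mul_le (a b : ℕ) : (a * b).size ≤ a.size + b.size := by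
  rw [Nat.size_le, pow_add]
  exact Nat.mul_lt_mul'' (Nat.lt_size_self a) (Nat.lt_size_self b)

theorem size_sq_le (z : ℕ) : z.size * z.size ≤ 4 * z := by
  have h1 : ∀ s : ℕ, (s + 1) * (s + 1) ≤ 4 * 2 ^ s := by
    intro s
    induction s with
    | zero => norm_num
    | succ s ih =>
      rw [pow_succ]
      have : s < 2 ^ s := Nat.lt_two_pow_self
      nlinarith
  rcases h : z.size with _ | s
  · simp
  · have hs := h
    have : 2 ^ s ≤ z := Nat.lt_size.1 (by omega)
    have := h1 s
    omega

theorem size_le_log (n : ℕ) : n.size ≤ Nat.log 2 n + 1 :=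
  Nat.size_le.2 (Nat.lt_pow_succ_log_self (by omega) n)

/-- The modulus is at most `2 k² log |B|` up to rounding, so its length depends on the second
structure only doubly logarithmically. -/
theorem modulusBits_le {k : ℕ} (hk : univFst x ≤ k) :
    modulusBits x ≤ 2 * (k * k) + (univSnd x).size.size := by
  rw [modulusBits, ← mul_assoc]
  refine (size_mul_le _ _).trans (Nat.add_le_add_right ((nat_size_le _).trans ?_) _)
  exact Nat.mul_le_mul_left _ (Nat.mul_le_mul hk hk)

theorem certBits_le {k : ℕ} (hk : univFst x ≤ k) : certBits x ≤
    2 * (k * k + 2 * ((k + 1) * (2 * (k * k) + (univSnd x).size.size))) := by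
  rw [certBits]
  have h1 := Nat.mul_le_mul hk hk
  have h2 := Nat.mul_le_mul (Nat.succ_le_succ hk) (modulusBits_le hk)
  simp only [Nat.succ_eq_add_one] at h2
  omega

/-- The number of guesses is bounded by this function times the logarithm of the input length. -/
def guessBound (W k : ℕ) : ℕ :=
  2 * (k * k + 2 * ((k + 1) * (2 * (k * k) + 2))) + 2 * (W * k)

/-- The bound has to be a product with the logarithm. The bits that depend only on the first
structure, and the rounding in `Nat.size`, are absorbed by means of `hl`. -/
theorem guesses_le {W k : ℕ} (hk : univFst x ≤ k) (hB : univSnd x ≤ x.length)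
    (hl : 1 ≤ Nat.log 2 x.length) :
    certBits x + univFst x * roundBits W x ≤ guessBound W k * Nat.log 2 x.length := by
  set ℓ := Nat.log 2 x.length with hℓ
  have hz : (univSnd x).size ≤ 2 * ℓ := by
    have := (Nat.size_le_size hB).trans (size_le_log x.length)
    omega
  have hzz := nat_size_le (univSnd x).size
  have h1 := certBits_le hk
  have h2 : 2 * (k * k) + (univSnd x).size.size ≤ (2 * (k * k) + 2) * ℓ := by nlinarith
  have h3 := Nat.mul_le_mul_left (k + 1) h2
  have h4 : univFst x * roundBits W x ≤ k * (W * (2 * ℓ)) :=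
    Nat.mul_le_mul hk (Nat.mul_le_mul_left _ hz)
  have h5 : k * k ≤ k * k * ℓ := Nat.le_mul_of_pos_right _ hl
  rw [guessBound]
  nlinarith

/-- For the space bound the product of `k + 1` with the doubly logarithmic `s` must become a sum: it
is at most `(k + 1)² + s²`, and by `size_sq_le` the square of `s` is only of logarithmic order. -/
theorem certBits_le_add {k : ℕ} (hk : univFst x ≤ k) (hB : univSnd x ≤ x.length) : certBits x ≤
    2 * (k * k) + 8 * ((k + 1) * (k * k)) + 4 * ((k + 1) * (k + 1)) +
      16 * (Nat.log 2 x.length + 1) := by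
  have hz : (univSnd x).size ≤ Nat.log 2 x.length + 1 :=
    (Nat.size_le_size hB).trans (size_le_log x.length)
  have h1 := certBits_le hk
  have h2 := size_sq_le (univSnd x).size
  set s := (univSnd x).size.size
  have h3 : (k + 1) * s ≤ (k + 1) * (k + 1) + s * s := by
    rcases le_total (k + 1) s with h | h
    · exact (Nat.mul_le_mul_right s h).trans (Nat.le_add_left _ _)
    · exact (Nat.mul_le_mul_left _ h).trans (Nat.le_add_right _ _)
  nlinarith

end ParamLog

/-! ### Assembling the machine and its resource bounds. -/

namespace ParamLog

variable {τ : Vocabulary} {A B : Str τ} {x : List Bool}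

theorem size_add_le (a b : ℕ) : (a + b).size ≤ a.size + b.size + 1 := by
  rw [Nat.size_le]
  have h1 : 2 ^ a.size ≤ 2 ^ (a.size + b.size) := Nat.pow_le_pow_right (by omega) (by omega)
  have h2 : 2 ^ b.size ≤ 2 ^ (a.size + b.size) := Nat.pow_le_pow_right (by omega) (by omega)
  have h3 := Nat.lt_size_self a
  have h4 := Nat.lt_size_self b
  rw [pow_succ]
  omega

theorem EncodesPair.univSnd_le (h : EncodesPair x A B) :
    univSnd x ≤ x.length ∧ 1 ≤ Nat.log 2 x.length := by
  have hn : univSnd x = B.n := h.facts.2.2.2.1.univ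
  obtain ⟨y, z, ⟨L, -, hy⟩, ⟨L', -, hz⟩, rfl⟩ := h
  have hA := A.pos
  have h1 : A.n + 1 ≤ y.length := by rw [hy, List.length_append, length_encUnary]; omega
  have h2 : B.n + 1 ≤ z.length := by rw [hz, List.length_append, length_encUnary]; omega
  have h3 : 2 ≤ (encVocabulary τ ++ y ++ z).length := by
    rw [List.length_append, List.length_append]; omega
  refine ⟨?_, Nat.log_pos (by omega) h3⟩
  rw [hn, List.length_append]
  omega

theorem Encodes.unique {τ' : Vocabulary} {A' : Str τ'} (h : Encodes x A) (h' : Encodes x A') :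
    (⟨τ, A⟩ : (τ : Vocabulary) × Str τ) = ⟨τ', A'⟩ := by
  obtain ⟨y, hA, rfl⟩ := h
  obtain ⟨y', hA', e⟩ := h'
  obtain ⟨rfl, e2⟩ := uniqueRead_encVocabulary _ _ _ _ e
  rw [(hA.unique hA' (z := []) (z' := []) (by rw [e2])).1]

/-- The string encodes a pair of structures with arities at most `r`. -/
def PairOK (r : ℕ) (x : List Bool) : Prop := Valid x ∧ ∀ i < vocLen x, vocAr x i ≤ r

theorem pd_pairOK (r : ℕ) : PD (n := 0) fun x _ => PairOK r x :=
  pd_valid.and (PD.ball (p := fun x _ i => vocAr x i ≤ r) pc_vocLen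
    (PD.le (pc_vocAr (PC.var 0)) (.const r)))

theorem pairOK_iff {r : ℕ} : PairOK r x ↔
    ∃ τ, ∃ A B : Str τ, EncodesPair x A B ∧ ∀ i, τ.ar i ≤ r := by
  constructor
  · rintro ⟨hv, h⟩
    obtain ⟨τ, A, B, hAB⟩ := hv.encodes
    obtain ⟨-, h1, -⟩ := hAB.facts
    obtain ⟨hm, -, har, -⟩ := h1.voc_eq
    exact ⟨τ, A, B, hAB, fun i => har i ▸ h i (by rw [hm]; exact i.2)⟩
  · rintro ⟨τ, A, B, hAB, h⟩
    obtain ⟨hv, h1, -⟩ := hAB.facts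
    obtain ⟨hm, -, har, -⟩ := h1.voc_eq
    refine ⟨hv, fun i hi => ?_⟩
    rw [hm] at hi
    exact (har ⟨i, hi⟩).trans_le (h _)

/-- Membership in the class is tested on the prefix of `x` that ends at `sndPos x`. This prefix
encodes the first structure by itself, and `Encodes.unique` identifies the structure. -/
theorem mem_embProblem_iff {𝒜 : StrClass} {r w : ℕ} (hr : ∀ τ, ∀ A ∈ 𝒜 τ, ∀ i, τ.ar i ≤ r)
    (hw : ∀ τ, ∀ A ∈ 𝒜 τ, pathwidth (Str.gaifman A) ≤ w) :
    x ∈ embProblem 𝒜 ↔ PairOK r x ∧ (∃ τ, ∃ A ∈ 𝒜 τ, Encodes (x.take (sndPos x)) A) ∧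
      ∃ N < 2 ^ certBits x, CertOK x N ∧ ∃ H : ℕ → ℕ, H 0 = 0 ∧
        (∀ j, H j < 2 ^ roundBits (w + 1) x) ∧
        ∀ j < univFst x, RoundOK x N j (H (j + 1)) (H j) := by
  constructor
  · rintro ⟨τ, A, hA, B, hAB, hemb⟩
    obtain ⟨-, -, -, -, henc, -⟩ := hAB.facts
    exact ⟨pairOK_iff.2 ⟨τ, A, B, hAB, hr τ A hA⟩, ⟨τ, A, hA, henc⟩,
      (hAB.embeds_iff (hw τ A hA)).1 hemb⟩
  · rintro ⟨hok, ⟨τ', A', hA', henc'⟩, hN⟩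
    obtain ⟨τ, A, B, hAB, -⟩ := pairOK_iff.1 hok
    obtain ⟨-, -, -, -, henc, -⟩ := hAB.facts
    have hA : A ∈ 𝒜 τ := by
      have := henc.unique henc'
      cases this
      exact hA'
    exact ⟨τ, A, hA, B, hAB, (hAB.embeds_iff (hw τ A hA)).2 hN⟩

/-- These bounds must hold before it is known whether the first structure belongs to the class. This
is why `PairOK` tests the arities: they make the length of its code bounded in terms of the
parameter. -/
theorem PairOK.bounds {r : ℕ} (h : PairOK r x) :
    univFst x ≤ embParam x ∧ univSnd x ≤ x.length ∧ 1 ≤ Nat.log 2 x.length ∧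
      sndPos x ≤ x.length ∧ fstCode x ≤ codeBound (encBound r (embParam x)) := by
  obtain ⟨τ, A, B, hAB, hr⟩ := pairOK_iff.1 h
  obtain ⟨-, -, hA, -, henc, hle⟩ := hAB.facts
  have hn : univFst x = A.n := hA.univ
  obtain ⟨h1, h2⟩ := hAB.univSnd_le
  refine ⟨?_, h1, h2, hle, ?_⟩
  · rw [hn, embParam_eq hAB, Str.size]; omega
  · rw [embParam_eq hAB]
    exact (encode_le_codeBound _).trans (codeBound_mono (henc.length_le hr))

theorem _root_.Computable.natAdd {f g : ℕ → ℕ} (hf : Computable f) (hg : Computable g) :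
    Computable fun k => f k + g k := (Primrec.nat_add.to_comp : Computable₂ _).comp hf hg

theorem _root_.Computable.natMul {f g : ℕ → ℕ} (hf : Computable f) (hg : Computable g) :
    Computable fun k => f k * g k := (Primrec.nat_mul.to_comp : Computable₂ _).comp hf hg

theorem computable_guessBound (W : ℕ) : Computable (guessBound W) := by
  have c : ∀ a : ℕ, Computable fun _ : ℕ => a := fun a => Computable.const a
  have i : Computable fun k : ℕ => k := Computable.id
  exact ((c 2).natMul ((i.natMul i).natAdd ((c 2).natMul ((i.natAdd (c 1)).natMul (((c 2).natMul (i.natMul i)).natAdd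
    (c 2)))))).natAdd ((c 2).natMul ((c W).natMul i))

theorem computable_encBound (r : ℕ) : Computable (encBound r) := by
  have c : ∀ a : ℕ, Computable fun _ : ℕ => a := fun a => Computable.const a
  have i : Computable fun k : ℕ => k := Computable.id
  exact ((i.natMul (c (r + 2))).natAdd (c 1)).natAdd ((i.natAdd (c 1)).natAdd (i.natMul ((i.natMul (((c r).natMul
    (((c 2).natMul i).natAdd (c 1))).natAdd (c 1))).natAdd (c 1))))

/-- The part of the space bound that depends on the parameter. -/
def spaceBound (r : ℕ) (b : ℕ → ℕ) (k : ℕ) : ℕ :=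
  1 + k + (2 * (k * k) + 8 * ((k + 1) * (k * k)) + 4 * ((k + 1) * (k + 1))) +
    codeBound (encBound r k) + natSum b (codeBound (encBound r k))

theorem computable_spaceBound (r : ℕ) {b : ℕ → ℕ} (hb : Computable b) :
    Computable (spaceBound r b) := by
  have c : ∀ a : ℕ, Computable fun _ : ℕ => a := fun a => Computable.const a
  have i : Computable fun k : ℕ => k := Computable.id
  have h1 : Computable fun k => codeBound (encBound r k) :=
    primrec_codeBound.to_comp.comp (computable_encBound r)
  exact ((((c 1).natAdd i).natAdd ((((c 2).natMul (i.natMul i)).natAdd ((c 8).natMul ((i.natAdd (c 1)).natMul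
    (i.natMul i)))).natAdd ((c 4).natMul ((i.natAdd (c 1)).natMul (i.natAdd (c 1)))))).natAdd h1).natAdd
    ((computable_natSum hb).comp h1)

open Classical in
/-- Bound on the counters that are used besides those for deciding the class. -/
noncomputable def counterBound (r w : ℕ) (x : List Bool) : ℕ :=
  x.length + 2 + if PairOK r x then
    2 ^ certBits x + 2 ^ roundBits (w + 1) x + embParam x + fstCode x else 0

open Classical in
/-- Bound on the counters for deciding the class. -/
noncomputable def classBound (r : ℕ) (b : ℕ → ℕ) (x : List Bool) : ℕ :=
  if PairOK r x then b (fstCode x) else 0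

theorem le_counterBound (r w : ℕ) (x : List Bool) : x.length + 2 ≤ counterBound r w x :=
  Nat.le_add_right _ _

theorem PairOK.le_counterBound {r : ℕ} (h : PairOK r x) (w : ℕ) :
    2 ^ certBits x ≤ counterBound r w x ∧ 2 ^ roundBits (w + 1) x ≤ counterBound r w x ∧
      embParam x ≤ counterBound r w x ∧ x.length + 2 + fstCode x ≤ counterBound r w x := by
  rw [counterBound, if_pos h]
  generalize 2 ^ certBits x = a
  generalize 2 ^ roundBits (w + 1) x = a'
  omega

/-- The counter bound has at most five summands, each at most `2 ^ S`; this explains the additional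
`3` in the exponent. The factor `20` covers the constant `16` of `certBits_le_add`. -/
theorem counterBound_le (r w : ℕ) (b : ℕ → ℕ) (x : List Bool) :
    counterBound r w x ≤
      2 ^ ((w + 20) * (spaceBound r b (embParam x) + Nat.log 2 x.length) + 3) ∧
    classBound r b x ≤ spaceBound r b (embParam x) := by
  set ℓ := Nat.log 2 x.length with hℓ
  set F := spaceBound r b (embParam x) with hF
  have hF1 : 1 ≤ F := by rw [hF, spaceBound]; omega
  set S := (w + 20) * (F + ℓ) with hS
  have hSF : 20 * (F + ℓ) ≤ S := Nat.mul_le_mul_right _ (by omega)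
  have hpow : ∀ {i}, i ≤ S → 2 ^ i ≤ 2 ^ S := fun h => Nat.pow_le_pow_right (by omega) h
  have hx : x.length + 2 ≤ 2 ^ S := (length_le_pow x).trans (hpow (by omega))
  rw [pow_add, counterBound, classBound]
  split
  · next hok =>
    obtain ⟨h1, h2, -, -, h5⟩ := hok.bounds
    have e1 := certBits_le_add h1 h2
    have e2 : roundBits (w + 1) x ≤ S := by
      have : (univSnd x).size ≤ ℓ + 1 := (Nat.size_le_size h2).trans (size_le_log x.length)
      exact Nat.mul_le_mul (by omega) (by omega)
    have e3 := hpow e2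
    have e4 : fstCode x ≤ F := h5.trans (by rw [hF, spaceBound]; omega)
    have e5 : embParam x ≤ F := by rw [hF, spaceBound]; omega
    have e6 : certBits x ≤ S := by
      refine (e1.trans ?_).trans hSF
      rw [← hℓ]
      have : 2 * (embParam x * embParam x) + 8 * ((embParam x + 1) * (embParam x * embParam x)) +
        4 * ((embParam x + 1) * (embParam x + 1)) + 1 ≤ F := by rw [hF, spaceBound]; omega
      omega
    have e7 := hpow e6
    have e8 : F < 2 ^ F := Nat.lt_two_pow_self
    have e9 : 2 ^ F ≤ 2 ^ S := hpow (by omega)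
    exact ⟨by omega, (le_natSum h5).trans (by rw [hF, spaceBound]; omega)⟩
  · exact ⟨by omega, Nat.zero_le _⟩

theorem size_space_le (r w c : ℕ) (b : ℕ → ℕ) (x : List Bool) :
    (counterBound r w x ^ c + classBound r b x).size + 2 ≤
      ((w + 23) * c + 5) * (spaceBound r b (embParam x) + Nat.log 2 x.length) := by
  obtain ⟨h0, h1⟩ := counterBound_le r w b x
  have hF1 : 1 ≤ spaceBound r b (embParam x) := by rw [spaceBound]; omega
  have h2 := size_pow_le c h0
  have h3 := size_add_le (counterBound r w x ^ c) (classBound r b x)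
  have h4 := nat_size_le (classBound r b x)
  set F := spaceBound r b (embParam x)
  set ℓ := Nat.log 2 x.length
  have h5 : ((w + 20) * (F + ℓ) + 3) * c ≤ (w + 23) * c * (F + ℓ) := by
    have : (w + 20) * (F + ℓ) + 3 ≤ (w + 23) * (F + ℓ) := by
      rw [add_mul, add_mul]
      omega
    calc ((w + 20) * (F + ℓ) + 3) * c ≤ (w + 23) * (F + ℓ) * c := Nat.mul_le_mul_right _ this
      _ = _ := by ring
  rw [add_mul]
  omega

theorem inPATH_embProblem {𝒜 : StrClass} (hdec : 𝒜.IsDecidable) (har : 𝒜.BoundedArity)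
    (hpw : 𝒜.BoundedPathwidth) : InPATH (embProblem 𝒜) embParam := by
  classical
  obtain ⟨r, hr⟩ := har
  obtain ⟨w, hw⟩ := hpw
  obtain ⟨cD, b, hb, hD⟩ := exists_sem_mem hdec
  obtain ⟨M, c, hM⟩ := exists_rounds_machine (pd_pairOK r) hD pc_univFst pc_certBits
    (pc_roundBits (w + 1)) pd_certOK pd_roundOK
  -- The power serves the polynomially bounded programs and the computation of the code of the first
  -- structure. `classBound` serves the decision of the class; it is only added, because it is
  -- bounded by a function of the parameter alone.
  have key := fun x => hM x (counterBound r w x ^ (c + cD) + classBound r b x)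
    (counterBound r w x) (∃ τ, ∃ A ∈ 𝒜 τ, Encodes (x.take (sndPos x)) A) (le_counterBound r w x)
    ((Nat.pow_le_pow_right (by have := le_counterBound r w x; omega) (by omega)).trans
      (Nat.le_add_right _ _)) fun hok => by
      obtain ⟨h1, -, -, h4, -⟩ := hok.bounds
      obtain ⟨e1, e2, e3, e4⟩ := hok.le_counterBound w
      refine ⟨e1, e2, h1.trans e3,
        if ∃ τ, ∃ A ∈ 𝒜 τ, Encodes (x.take (sndPos x)) A then 1 else 0, ?_,
        fun _ => ⟨h4, ⟨?_, ?_⟩, ?_, ?_⟩, ?_⟩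
      · split <;> omega
      · split <;> omega
      · simp
      · exact ((Nat.pow_le_pow_left e4 _).trans
          (Nat.pow_le_pow_right (by omega) (by omega))).trans (Nat.le_add_right _ _)
      · rw [classBound, if_pos hok]
        exact Nat.le_add_left _ _
      · simp
  refine ⟨logSpaceComputable_embParam, guessBound (w + 1), computable_guessBound _, M,
    fun x => ?_, ⟨spaceBound r b, computable_spaceBound r hb, (w + 23) * (c + cD) + 5,
      fun x => (key x).1.mono (size_space_le r w (c + cD) b x)⟩, fun x => (key x).2.1 _ fun hok => ?_⟩
  · rw [(key x).2.2, mem_embProblem_iff hr hw]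
  · obtain ⟨h1, h2, h3, -⟩ := hok.bounds
    exact guesses_le h1 h2 h3

end ParamLog

theorem theorem4p6 (𝒜 : ParamLog.StrClass) (hdec : 𝒜.IsDecidable) (har : 𝒜.BoundedArity)
    (hpw : 𝒜.BoundedPathwidth) :
    ParamLog.InPATH (ParamLog.embProblem 𝒜) ParamLog.embParam :=
  ParamLog.inPATH_embProblem hdec har hpw
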